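/- **Conventions.** Orbifolds are Hausdorff and effective (Satake's V-manifolds): $X$ carries a maximal atlas of compatible uniformizing systems $(V,G,\pi)$, where $V\subset\mathbf R^N$ is open and connected, $G$ is a finite group of diffeomorphisms of $V$, and $\pi$ induces a homeomorphism of $V/G$ onto an open set $U=\pi(V)\subset X$. An injection $(V_1,G_1,\pi_1)\to(V_2,G_2,\pi_2)$ is a smooth open embedding $i:V_1\to V_2$ with $\pi_2\circ i=\pi_1$. An almost complex structure $J$ on $X$ is a family of smooth almost complex structures on the $V$'s preserved by all injections. A $C^\infty$ map $\tilde f$ of orbifolds over a continuous map $f$ is an equivalence class of collections of local smooth liftings of $f$ to uniformizing systems, whose domains cover the source and which induce isomorphic germs of liftings at every point. A compatible system $\xi$ of $\tilde f:Y\to X$ consists of an open cover $\{U_\alpha\}$ of $Y$, open sets $\{U'_\alpha\}$ of $X$ covering $f(Y)$, uniformizing systems $(V_\alpha,G_\alpha,\pi_\alpha)$, $(V'_\alpha,G'_\alpha,\pi'_\alpha)$ of these sets, and local liftings $\tilde f_\alpha:V_\alpha\to V'_\alpha$ belonging to $\tilde f$, such that: $U_\alpha\subset U_\beta$ implies $U'_\alpha\subset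 U'_\beta$; an inclusion $U_\alpha\subset U_\beta$ (resp. $U'_\alpha\subset U'_\beta$) implies that there is an injection of the corresponding uniformizing systems; each point of $U_\alpha\cap U_\beta$ (resp. $U'_\alpha\cap U'_\beta$) lies in some $U_\gamma$ (resp. $U'_\gamma$) contained in that intersection; together with an assignment $\lambda$ of an injection $\lambda(i):V'_\alpha\to V'_\beta$ to each injection $i:V_\alpha\to V_\beta$ with $\tilde f_\beta\circ i=\lambda(i)\circ\tilde f_\alpha$ and $\lambda(j\circ i)=\lambda(j)\circ\lambda(i)$. The map $\tilde f$ is good if it has a compatible system. A compatible system $\xi$ pulls back an orbibundle $E\to X$ to an orbibundle $E^*_\xi\to Y$ (over $V_\alpha$ pull back by $\tilde f_\alpha$; the lift of $i$ is the pull-back of the lift of $\lambda(i)$), with a canonical morphism $\bar f_\xi:E^*_\xi\to E$. Two compatible systems $\xi_1,\xi_2$ of $\tilde f$ are isomorphic if for every orbibundle $E\to X$ there is an orbibundle isomorphism $\phi:E^*_{\xi_1}\to E^*_{\xi_2}$ with $\bar f_{\xi_1}=\bar f_{\xi_2}\circ\phi$. Let $\Sigma$ be a closed connected Riemann surface of genus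 $g$ with distinct marked points $\mathbf z=(z_1,\dots,z_k)$. An orbifold structure on $\Sigma$ with singular set contained in $\mathbf z$ is one whose uniformizing systems are locally, in smooth coordinates on $V$ and holomorphic coordinates on $\Sigma$, of the form $w\mapsto w^m$, with $m=1$ away from $\mathbf z$ (so it is given by multiplicities $m_1,\dots,m_k\ge1$). For maps from such an orbifold only those compatible systems are considered for which all the homomorphisms $\lambda_\alpha:G_\alpha\to G'_\alpha$ given by $\lambda$ are injective. A continuous map $f:\Sigma\to X$ is pseudo-holomorphic if every $z\in\Sigma$ has a disc neighbourhood with a branched covering $w\mapsto w^{m_z}$, $m_z\ge1$, from a disc, on which $f$ lifts to a smooth map $u$ into some uniformizing system of $X$ with $du\circ i=J\circ du$. **Lemma 4.3.** Let $X$ be an orbifold with almost complex structure $J$. For every pseudo-holomorphic map $f$ from a closed Riemann surface $\Sigma$ of genus $g$ with $k$ marked points $\mathbf z$ into $(X,J)$, there are only finitely many orbifold structures on $\Sigma$ with singular set contained in $\mathbf z$ for which $f$ lifts to a good map, and for each orbifold structure on $\Sigma$ with singular set contained in $\mathbf z$ there are only finitely many pairs $(\tilde f,\xi)$, where $\tilde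 f$ is a good map with underlying map $f$ and $\xi$ is an isomorphism class of compatible systems of $\tilde f$. If $X$ is compact, the total number of triples (orbifold structure, $\tilde f$, $\xi$) is bounded from above by a constant $C(X,g,k)$ depending only on the orbifold $X$ and on $g$ and $k$ (in particular not on $J$, $\Sigma$, $\mathbf z$ or $f$). -/

import Mathlib

open Set Topology TopologicalSpace
open scoped Manifold ContDiff

namespace Orb

/-! ## Orbifolds (V-manifolds), modelled on a finite dimensional real vector space -/

/-- A uniformizing system `(V, G, π)` on a space `X`: `V` is a connected (in particular nonempty)
open subset of the model space, `G` is a finite group of diffeomorphisms of `V` (so the action is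
effective), and `π : V → X` induces a homeomorphism of `V / G` onto an open subset of `X`. -/
structure UChart (E : Type*) [NormedAddCommGroup E] [NormedSpace ℝ E]
    (X : Type*) [TopologicalSpace X] where
  V : Opens E
  connected : IsConnected (V : Set E)
  G : Subgroup (V ≃ₜ V)
  finite : Finite G
  smooth : ∀ g ∈ G, ContMDiff 𝓘(ℝ, E) 𝓘(ℝ, E) ∞ (g : V → V)
  π : V → X
  continuous : Continuous π
  isOpenMap : IsOpenMap π
  fibre : ∀ x y : V, π x = π y ↔ ∃ g ∈ G, g x = y

section Basic

variable {E : Type*} [NormedAddCommGroup E] [NormedSpace ℝ E]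
  {X : Type*} [TopologicalSpace X]

/-- The open set `U = π(V)` uniformized by a uniformizing system. -/
def UChart.U (c : UChart E X) : Set X := range c.π

/-- An injection `(V, G, π) → (V', G', π')`: a smooth open embedding `φ : V → V'` (that is, an
injective local diffeomorphism) with `π' ∘ φ = π`. -/
@[ext] structure Injection (c d : UChart E X) where
  toFun : c.V → d.V
  injective : Function.Injective toFun
  isLocalDiffeomorph : IsLocalDiffeomorph 𝓘(ℝ, E) 𝓘(ℝ, E) ∞ toFun
  comm : ∀ x, d.π (toFun x) = c.π x

instance (c d : UChart E X) : CoeFun (Injection c d) fun _ => c.V → d.V := ⟨Injection.toFun⟩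

/-- Composition of injections. -/
def Injection.comp {b c d : UChart E X} (j : Injection c d) (i : Injection b c) :
    Injection b d where
  toFun := j ∘ i
  injective := j.injective.comp i.injective
  isLocalDiffeomorph := fun x =>
    (i.isLocalDiffeomorph x).comp 𝓘(ℝ, E) (d.V) (j.isLocalDiffeomorph (i x))
  comm x := by simp [j.comm, i.comm]

/-- An element of the group `G` of a uniformizing system, regarded as an injection of the system
into itself. -/
def Injection.ofGroup {c : UChart E X} (g : c.G) : Injection c c where
  toFun := g.1
  injective := g.1.injective
  isLocalDiffeomorph := Diffeomorph.isLocalDiffeomorph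
    { toEquiv := g.1.toEquiv
      contMDiff_toFun := c.smooth g.1 g.2
      contMDiff_invFun := c.smooth (g.1⁻¹) (c.G.inv_mem g.2) }
  comm x := ((c.fibre x (g.1 x)).2 ⟨g.1, g.2, rfl⟩).symm

/-- A local change of uniformizing systems: a diffeomorphism `h` from an open subset of `V` onto an
open subset of `V'` with `π' ∘ h = π` where `h` is defined. -/
structure Change (c d : UChart E X) where
  diffeo : PartialDiffeomorph 𝓘(ℝ, E) 𝓘(ℝ, E) c.V d.V ∞
  comm : ∀ x ∈ diffeo.source, d.π (diffeo x) = c.π x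

instance (c d : UChart E X) : CoeFun (Change c d) fun _ => c.V → d.V := ⟨fun h => h.diffeo⟩

/-- The domain of a local change. -/
def Change.source {c d : UChart E X} (h : Change c d) : Set c.V := h.diffeo.source

/-- Two uniformizing systems are compatible if any two of their points lying over the same point
of `X` correspond to each other under a local change. -/
def Compatible (c d : UChart E X) : Prop :=
  ∀ (x : c.V) (y : d.V), c.π x = d.π y → ∃ h : Change c d, x ∈ h.source ∧ h x = y

end Basic

/-- An orbifold structure on `X`: a maximal atlas of pairwise compatible uniformizing systems. -/
@[ext] structure Orbifold (E : Type*) [NormedAddCommGroup E] [NormedSpace ℝ E]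
    (X : Type*) [TopologicalSpace X] where
  charts : Set (UChart E X)
  cover : ∀ p : X, ∃ c ∈ charts, p ∈ c.U
  compatible : ∀ c ∈ charts, ∀ d ∈ charts, Compatible c d
  maximal : ∀ c : UChart E X, (∀ d ∈ charts, Compatible c d) → c ∈ charts

/-- A smooth almost complex structure on an orbifold: on every uniformizing system a smooth field
of endomorphisms of square `-1`, preserved by all injections (in particular `G`-invariant). -/
structure AlmostComplex {E : Type*} [NormedAddCommGroup E] [NormedSpace ℝ E]
    {X : Type*} [TopologicalSpace X] (O : Orbifold E X) where
  J : ∀ c : O.charts, c.1.V → E →L[ℝ] E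
  smooth : ∀ c, ContMDiff 𝓘(ℝ, E) 𝓘(ℝ, E →L[ℝ] E) ∞ (J c)
  sq : ∀ c x v, J c x (J c x v) = -v
  invariant : ∀ (c d : O.charts) (i : Injection c.1 d.1) (x : c.1.V) (v : E),
    (mfderiv 𝓘(ℝ, E) 𝓘(ℝ, E) i x : E →L[ℝ] E) (J c x v) =
      J d (i x) ((mfderiv 𝓘(ℝ, E) 𝓘(ℝ, E) i x : E →L[ℝ] E) v)

/-! ## Smooth maps between orbifolds -/

section Maps

variable {E : Type*} [NormedAddCommGroup E] [NormedSpace ℝ E]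
  {X : Type*} [TopologicalSpace X]
  {E' : Type*} [NormedAddCommGroup E'] [NormedSpace ℝ E']
  {X' : Type*} [TopologicalSpace X']

/-- A local smooth lifting of `f : X → X'` between uniformizing systems. -/
structure LocalLift (E E' : Type*) [NormedAddCommGroup E] [NormedSpace ℝ E]
    [NormedAddCommGroup E'] [NormedSpace ℝ E'] (f : X → X') where
  dom : UChart E X
  cod : UChart E' X'
  toFun : dom.V → cod.V
  smooth : ContMDiff 𝓘(ℝ, E) 𝓘(ℝ, E') ∞ toFun
  comm : ∀ x, cod.π (toFun x) = f (dom.π x)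
  equivariant : ∀ g ∈ dom.G, ∃ g' ∈ cod.G, ∀ x, toFun (g x) = g' (toFun x)

/-- Two local liftings of `f` define the same germ of liftings at every point of `X` over which
both are defined: near points with the same image in `X` they agree up to local changes in the
source and in the target. -/
def LocalLift.SameGerms {f : X → X'} (l m : LocalLift E E' f) : Prop :=
  ∀ (x : l.dom.V) (y : m.dom.V), l.dom.π x = m.dom.π y →
    ∃ (h : Change l.dom m.dom) (h' : Change l.cod m.cod),
      x ∈ h.source ∧ h x = y ∧ l.toFun x ∈ h'.source ∧
        ∀ᶠ w in 𝓝 x, h' (l.toFun w) = m.toFun (h w)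

/-- A `C^∞` map of orbifolds with underlying continuous map `f`: an equivalence class of
collections of local smooth liftings of `f`, represented by the maximal collection in the class.
-/
@[ext] structure SmoothMap (O : Orbifold E X) (O' : Orbifold E' X') (f : C(X, X')) where
  lifts : Set (LocalLift E E' f)
  mem : ∀ l ∈ lifts, l.dom ∈ O.charts ∧ l.cod ∈ O'.charts
  cover : ∀ p : X, ∃ l ∈ lifts, p ∈ l.dom.U
  sameGerms : ∀ l ∈ lifts, ∀ m ∈ lifts, l.SameGerms m
  maximal : ∀ l : LocalLift E E' f, l.dom ∈ O.charts → l.cod ∈ O'.charts →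
    (∀ m ∈ lifts, l.SameGerms m) → l ∈ lifts

/-- A compatible system of the `C^∞` map `F` with underlying map `f`. A map is *good* if it has
one. The members `U_α = (lift α).dom.U` of the cover of `X` and `U'_α = (lift α).cod.U` of the cover
of `f(X)` are given together with the uniformizing systems and the local liftings
`V_α → V'_α`. (That `f(U_α) ⊆ U'_α`, and so that the `U'_α` cover `f(X)`, is part of
`LocalLift`.) -/
structure CompatibleSystem {O : Orbifold E X} {O' : Orbifold E' X'} {f : C(X, X')}
    (F : SmoothMap O O' f) where
  Λ : Type
  lift : Λ → LocalLift E E' f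
  lift_mem : ∀ α, lift α ∈ F.lifts
  cover : ∀ p, ∃ α, p ∈ (lift α).dom.U
  exists_injection : ∀ α β, (lift α).dom.U ⊆ (lift β).dom.U →
    Nonempty (Injection (lift α).dom (lift β).dom)
  exists_injection' : ∀ α β, (lift α).cod.U ⊆ (lift β).cod.U →
    Nonempty (Injection (lift α).cod (lift β).cod)
  basis : ∀ α β, ∀ p ∈ (lift α).dom.U ∩ (lift β).dom.U,
    ∃ γ, p ∈ (lift γ).dom.U ∧ (lift γ).dom.U ⊆ (lift α).dom.U ∩ (lift β).dom.U
  basis' : ∀ α β, ∀ p ∈ (lift α).cod.U ∩ (lift β).cod.U,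
    ∃ γ, p ∈ (lift γ).cod.U ∧ (lift γ).cod.U ⊆ (lift α).cod.U ∩ (lift β).cod.U
  subset_of_subset : ∀ α β, (lift α).dom.U ⊆ (lift β).dom.U → (lift α).cod.U ⊆ (lift β).cod.U
  lam : ∀ {α β}, Injection (lift α).dom (lift β).dom → Injection (lift α).cod (lift β).cod
  lift_comm : ∀ {α β} (i : Injection (lift α).dom (lift β).dom) (x : (lift α).dom.V),
    (lift β).toFun (i x) = lam i ((lift α).toFun x)
  lam_comp : ∀ {α β γ} (j : Injection (lift β).dom (lift γ).dom)
    (i : Injection (lift α).dom (lift β).dom), lam (j.comp i) = (lam j).comp (lam i)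

/-- The requirement that all the homomorphisms `λ_α : G_α → G'_α` given by a compatible system be
injective. -/
def CompatibleSystem.Mono {O : Orbifold E X} {O' : Orbifold E' X'} {f : C(X, X')}
    {F : SmoothMap O O' f} (ξ : CompatibleSystem F) : Prop :=
  ∀ α, Function.Injective fun g : (ξ.lift α).dom.G => ξ.lam (Injection.ofGroup g)

end Maps

/-! ## Orbibundles, pull-backs, isomorphism of compatible systems -/

/-- The standard fibre of a rank `r` orbibundle. -/
abbrev Fib (r : ℕ) : Type := EuclideanSpace ℝ (Fin r)

/-- A rank `r` orbibundle with respect to a family of uniformizing systems: a smooth vector bundle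
over each `V_α`, and over each injection `V_α → V_β` a smooth bundle map that is an isomorphism on
fibres, functorially. The bundle over `V_α` is presented by local trivializations
`t : triv α` over open sets `dom t` covering `V_α`; `g t s i x` is the bundle map over the
injection `i`, from the fibre at `x` to the fibre at `i x`, in the trivializations `t` and `s`.
(For `i` the identity these are the transition functions of the bundle over `V_α`.) -/
structure Orbibundle {E : Type*} [NormedAddCommGroup E] [NormedSpace ℝ E]
    {X : Type*} [TopologicalSpace X] {Λ : Type*} (c : Λ → UChart E X) (r : ℕ) where
  triv : Λ → Type
  dom : ∀ {α}, triv α → Set (c α).V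
  isOpen_dom : ∀ {α} (t : triv α), IsOpen (dom t)
  cover : ∀ α (x : (c α).V), ∃ t : triv α, x ∈ dom t
  g : ∀ {α β}, triv α → triv β → Injection (c α) (c β) → (c α).V → (Fib r ≃L[ℝ] Fib r)
  smooth : ∀ {α β} (t : triv α) (s : triv β) (i : Injection (c α) (c β)),
    ContMDiffOn 𝓘(ℝ, E) 𝓘(ℝ, Fib r →L[ℝ] Fib r) ∞
      (fun x => (g t s i x : Fib r →L[ℝ] Fib r)) (dom t ∩ i ⁻¹' dom s)
  cocycle : ∀ {α β γ} (t : triv α) (s : triv β) (u : triv γ) (j : Injection (c β) (c γ))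
    (i : Injection (c α) (c β)) (x : (c α).V), x ∈ dom t → i x ∈ dom s → j (i x) ∈ dom u →
    g t u (j.comp i) x = g s u j (i x) * g t s i x

/-- An orbibundle over an orbifold. -/
abbrev Orbifold.Bundle {E : Type*} [NormedAddCommGroup E] [NormedSpace ℝ E]
    {X : Type*} [TopologicalSpace X] (O : Orbifold E X) (r : ℕ) :=
  Orbibundle (fun c : O.charts => c.1) r

section Bundles

variable {E : Type*} [NormedAddCommGroup E] [NormedSpace ℝ E]
  {X : Type*} [TopologicalSpace X]
  {E' : Type*} [NormedAddCommGroup E'] [NormedSpace ℝ E']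
  {X' : Type*} [TopologicalSpace X']

/-- An isomorphism, over the identity of the orbifold, of two orbibundles presented with respect to
two families of uniformizing systems of the same orbifold: over every local change `k` from
`V_α` to `V_β` a smooth family `A t s k x` of isomorphisms from the fibre of `P` at `x` to the fibre
of `Q` at `k x` (written in trivializations `t` and `s`), compatible with the bundle maps of `P` and
`Q` over injections. -/
structure Orbibundle.Iso {Λ₁ Λ₂ : Type*} {c : Λ₁ → UChart E X} {d : Λ₂ → UChart E X} {r : ℕ}
    (P : Orbibundle c r) (Q : Orbibundle d r) where
  A : ∀ {α β}, P.triv α → Q.triv β → Change (c α) (d β) → (c α).V → (Fib r ≃L[ℝ] Fib r)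
  smooth : ∀ {α β} (t : P.triv α) (s : Q.triv β) (k : Change (c α) (d β)),
    ContMDiffOn 𝓘(ℝ, E) 𝓘(ℝ, Fib r →L[ℝ] Fib r) ∞
      (fun x => (A t s k x : Fib r →L[ℝ] Fib r)) {x | x ∈ k.source ∧ x ∈ P.dom t ∧ k x ∈ Q.dom s}
  natural : ∀ {α α' β β'} (t : P.triv α) (t' : P.triv α') (s : Q.triv β) (s' : Q.triv β')
    (i : Injection (c α) (c α')) (j : Injection (d β) (d β'))
    (k : Change (c α) (d β)) (k' : Change (c α') (d β')) (x : (c α).V),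
    x ∈ k.source → i x ∈ k'.source → (∀ᶠ w in 𝓝 x, k' (i w) = j (k w)) →
    x ∈ P.dom t → i x ∈ P.dom t' → k x ∈ Q.dom s → j (k x) ∈ Q.dom s' →
    A t' s' k' (i x) * P.g t t' i x = Q.g s s' j (k x) * A t s k x

/-- `T` is the isomorphism, from the fibre of `B` at `x ∈ V_c` to the fibre at `h x ∈ V_d` (written
in trivializations `t` and `s`), by which the bundle `B` lifts the local change `h`. Near `x`, the
change `h` has the form `b ∘ a⁻¹` with injections `a`, `b` of a third uniformizing system. -/
def Orbibundle.IsTransition {O : Orbifold E X} {r : ℕ} (B : O.Bundle r) {c d : O.charts}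
    (t : B.triv c) (s : B.triv d) (h : Change c.1 d.1) (x : c.1.V)
    (T : Fib r ≃L[ℝ] Fib r) : Prop :=
  ∃ (e : O.charts) (q : B.triv e) (a : Injection e.1 c.1) (b : Injection e.1 d.1) (w : e.1.V),
    w ∈ B.dom q ∧ a w = x ∧ (∀ᶠ v in 𝓝 w, h (a v) = b v) ∧
      T * B.g q t a w = B.g q s b w

variable {O : Orbifold E X} {O' : Orbifold E' X'} {f : C(X, X')} {F : SmoothMap O O' f}

/-- The target system of the index `α`, as a member of the atlas. -/
def CompatibleSystem.cod (ξ : CompatibleSystem F) (α : ξ.Λ) : O'.charts :=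
  ⟨(ξ.lift α).cod, (F.mem _ (ξ.lift_mem α)).2⟩

/-- The pull-back of an orbibundle by a compatible system: over `V_α` it is the pull-back by the
local lifting `V_α → V'_α`, and the bundle map over an injection `i` is the pull-back of the
one over `λ(i)`. -/
def CompatibleSystem.pullback (ξ : CompatibleSystem F) {r : ℕ} (B : O'.Bundle r) :
    Orbibundle (fun α => (ξ.lift α).dom) r where
  triv α := B.triv (ξ.cod α)
  dom {α} t := (ξ.lift α).toFun ⁻¹' B.dom t
  isOpen_dom {α} t := (B.isOpen_dom t).preimage (ξ.lift α).smooth.continuous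
  cover α x := B.cover (ξ.cod α) ((ξ.lift α).toFun x)
  g {α β} t s i x :=
    B.g (α := ξ.cod α) (β := ξ.cod β) t s (ξ.lam i) ((ξ.lift α).toFun x)
  smooth {α β} t s i := by
    refine (B.smooth (α := ξ.cod α) (β := ξ.cod β) t s (ξ.lam i)).comp
      (ξ.lift α).smooth.contMDiffOn ?_
    rintro x ⟨hx, hx'⟩
    refine ⟨hx, ?_⟩
    have h : (ξ.lift β).toFun (i x) ∈ B.dom s := hx'
    rw [ξ.lift_comm] at h
    exact h
  cocycle {α β γ} t s u j i x ht hs hu := by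
    have hs' : (ξ.lift β).toFun (i x) ∈ B.dom s := hs
    have hu' : (ξ.lift γ).toFun (j (i x)) ∈ B.dom u := hu
    rw [ξ.lift_comm, ξ.lift_comm] at hu'
    rw [ξ.lift_comm] at hs'
    rw [ξ.lam_comp, ξ.lift_comm]
    exact B.cocycle (α := ξ.cod α) (β := ξ.cod β) (γ := ξ.cod γ) t s u (ξ.lam j) (ξ.lam i)
      ((ξ.lift α).toFun x) ht hs' hu'

/-- The equation `f̄_ξ = f̄_η ∘ φ` between bundle maps (which are `C^∞` maps of orbifolds) from
`E*_ξ` to `E = B`. Over a local change `k` from `V_α` to `V_β`, the left side has the local lifting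
`(x, v) ↦ (lift_ξ x, v)`, and the right side `(x, v) ↦ (lift_η (k x), A x v)`. They define the same
germ at each point if they agree up to a local change `k'` of the target, lifted to `B`. -/
def CompatibleSystem.Covers (ξ η : CompatibleSystem F) {r : ℕ} (B : O'.Bundle r)
    (φ : (ξ.pullback B).Iso (η.pullback B)) : Prop :=
  ∀ (α : ξ.Λ) (β : η.Λ) (k : Change (ξ.lift α).dom (η.lift β).dom), ∀ x ∈ k.source,
    ∃ k' : Change (ξ.lift α).cod (η.lift β).cod, (ξ.lift α).toFun x ∈ k'.source ∧
      ∀ᶠ w in 𝓝 x, k' ((ξ.lift α).toFun w) = (η.lift β).toFun (k w) ∧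
        ∀ (t : (ξ.pullback B).triv α) (s : (η.pullback B).triv β),
          w ∈ (ξ.pullback B).dom t → k w ∈ (η.pullback B).dom s →
          Orbibundle.IsTransition B (c := ξ.cod α) (d := η.cod β) t s k' ((ξ.lift α).toFun w)
            (φ.A t s k w)

/-- Two compatible systems of the same `C^∞` map are isomorphic if for every orbibundle `B` on the
target there is an isomorphism `φ` of the pull-backs with `f̄_ξ = f̄_η ∘ φ`. -/
def CompatibleSystem.Isomorphic (ξ η : CompatibleSystem F) : Prop :=
  ∀ (r : ℕ) (B : O'.Bundle r), ∃ φ : (ξ.pullback B).Iso (η.pullback B), ξ.Covers η B φ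

end Bundles

/-! ## Marked Riemann surfaces and pseudo-holomorphic maps -/

/-- The side identifications of the regular `4g`-gon (the unit disc with boundary circle divided
into `4g` arcs) with boundary word `∏ a_b a'_b a_b⁻¹ a'_b⁻¹`, `b < g`. -/
def PolygonRel (g : ℕ) (p q : Metric.closedBall (0 : ℂ) 1) : Prop :=
  ∃ b < g, ∃ ε : ℕ, ε < 2 ∧ ∃ s ∈ Icc (0 : ℝ) 1,
    (p : ℂ) = Complex.exp (2 * Real.pi * Complex.I * ((4 * b + ε + s) / (4 * g))) ∧
    (q : ℂ) = Complex.exp (2 * Real.pi * Complex.I * ((4 * b + ε + 2 + (1 - s)) / (4 * g)))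

/-- `S` is a closed oriented surface of genus `g`: homeomorphic to the sphere if `g = 0`, to the
`4g`-gon with sides identified if `g ≥ 1`. -/
def HasGenus (S : Type*) [TopologicalSpace S] : ℕ → Prop
  | 0 => Nonempty (S ≃ₜ Metric.sphere (0 : EuclideanSpace ℝ (Fin 3)) 1)
  | g + 1 => Nonempty (S ≃ₜ Quot (PolygonRel (g + 1)))

section Surfaces

variable {S : Type*} [TopologicalSpace S] [ChartedSpace ℂ S]

/-- An orbifold structure on the Riemann surface `S` whose singular set is contained in the set of
marked points `z`: every uniformizing system is, locally and in suitable smooth coordinates, of the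
form `w ↦ w ^ m` with respect to a holomorphic coordinate `ψ` of `S`, with `m = 1` except
possibly over marked points. -/
def IsOrbifoldSurface {k : ℕ} (z : Fin k → S) (O : Orbifold ℂ S) : Prop :=
  ∀ c ∈ O.charts, ∀ x : c.V, ∃ m : ℕ, 1 ≤ m ∧ (m ≠ 1 → c.π x ∈ range z) ∧
    ∃ ψ ∈ IsManifold.maximalAtlas 𝓘(ℂ) ω S, c.π x ∈ ψ.source ∧ ψ (c.π x) = 0 ∧
      ∃ h : PartialDiffeomorph 𝓘(ℝ, ℂ) 𝓘(ℝ, ℂ) c.V ℂ ∞, x ∈ h.source ∧ h x = 0 ∧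
        ∀ w ∈ h.source, c.π w ∈ ψ.source ∧ ψ (c.π w) = h w ^ m

variable {E : Type*} [NormedAddCommGroup E] [NormedSpace ℝ E]
  {X : Type*} [TopologicalSpace X] {O : Orbifold E X}

/-- Pseudo-holomorphic maps from a Riemann surface to an almost complex orbifold: every point `p`
has a disc neighbourhood `{|ψ| < ρ ^ m}` with branched covering `w ↦ w ^ m` from `{|w| < ρ}`, over
which the map has a smooth lifting `u` to some uniformizing system, with `du ∘ i = J ∘ du`. -/
def IsPseudoHolomorphic (J : AlmostComplex O) (f : C(S, X)) : Prop :=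
  ∀ p : S, ∃ m : ℕ, 1 ≤ m ∧ ∃ ρ > (0 : ℝ),
    ∃ ψ ∈ IsManifold.maximalAtlas 𝓘(ℂ) ω S, p ∈ ψ.source ∧ ψ p = 0 ∧
      Metric.ball (0 : ℂ) (ρ ^ m) ⊆ ψ.target ∧
      ∃ (c : O.charts) (u : ℂ → E), ContDiffOn ℝ ∞ u (Metric.ball 0 ρ) ∧
        ∀ w ∈ Metric.ball (0 : ℂ) ρ, ∃ hw : u w ∈ c.1.V,
          c.1.π ⟨u w, hw⟩ = f (ψ.symm (w ^ m)) ∧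
          ∀ v : ℂ, fderiv ℝ u w (Complex.I * v) = J.J c ⟨u w, hw⟩ (fderiv ℝ u w v)

/-- The pairs `(F, [ξ])`, where `F` is a good map with underlying map `f` from the orbifold surface
`(S, OS)` to the orbifold `(X, O)`, and `[ξ]` is an isomorphism class of compatible systems of
`F` (all whose homomorphisms of local groups are required to be injective). -/
def GoodLifts (OS : Orbifold ℂ S) (O : Orbifold E X) (f : C(S, X)) :=
  Σ F : SmoothMap OS O f,
    Quot fun ξ η : {ξ : CompatibleSystem F // ξ.Mono} => ξ.1.Isomorphic η.1

end Surfaces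

end Orb

set_option linter.unusedSectionVars false

/-! Let `M` bound the orders of the isotropy groups of `X` along the image of `f`. It exists because
the image is compact, and it depends only on `X` when `X` is compact. Everything is counted in terms
of `M`, the genus and the number of marked points.

Orbifold structures. A structure on the surface is determined by its multiplicities
(`orbifold_eq_of_localForm`). A multiplicity is at most the order of the isotropy group of the
source (`LocalForm.le_ncard_stab`), and the injective homomorphisms of a compatible system embed
this group in an isotropy group of `X` (`CompatibleSystem.ncard_stab_le`). So every multiplicity is
at most `M`, and at most `(M + 1) ^ k` structures occur.

The smooth map is unique. An element of a chart group is determined by its 1-jet at one point, and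
two local changes of charts differ near a point by one group element (`Loc.exists_group`). Two lifts
of `f` to one chart differ pointwise by elements of a finite group, so one element works on some
nonempty open set. Unique continuation for pseudo-holomorphic curves, proved by a Carleman estimate
with the weights `z ^ (-n)`, spreads this equality (`GoodNhd.exists_group`). Hence any two lifts
have the same germs (`subsingleton_smoothMap`).

Compatible systems. The assignment `λ` extends from injections to germs of local changes
(`CompatibleSystem.Trans`). Away from a finite set `Z` containing the marked points, a germ of
isomorphism from `ξ` to `η` is a germ of a local change of the target that carries the lift of `ξ`
to the lift of `η`. These germs are the local sections of a covering space, and the automorphisms of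
`ξ` over a point embed in an isotropy group, so there are at most `M` of them. Taking derivatives,
read in frames at chosen base points, turns all this into functions with values in the linear
automorphisms of the model space; this is the local system `CompatibleSystem.locSys`.

Such objects are counted by cutting the punctured surface into star-shaped strips, over which any
two objects are isomorphic by homotopy lifting. Each interval along which strips or sides are glued
contributes a factor at most `M` (`LocSys.Bd.glue`), and the number of intervals is bounded by the
genus and the number of punctures (`LocSys.exists_bound`). A section over the complement of `Z`
extends over `Z`, because a punctured disc is connected (`exists_along`). It then acts on every
orbibundle through the lifts of local changes, which is an isomorphism of compatible systems
(`isomorphic_of_mem_germ`). -/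

namespace Orb

/-! ### Derivatives of maps between open subsets of normed spaces -/

section Calculus

variable {E : Type*} [NormedAddCommGroup E] [NormedSpace ℝ E]
  {F : Type*} [NormedAddCommGroup F] [NormedSpace ℝ F]
  {K : Type*} [NormedAddCommGroup K] [NormedSpace ℝ K]

/-- Extension by zero of a map defined on an open subset of a normed space. -/
noncomputable def ext0 {U : Opens E} (f : U → F) : E → F := Function.extend Subtype.val f 0

lemma ext0_coe {U : Opens E} (f : U → F) (x : U) : ext0 f x = f x :=
  Subtype.val_injective.extend_apply _ _ _

lemma map_val_nhds {U : Opens E} (x : U) : Filter.map Subtype.val (𝓝 x) = 𝓝 (x : E) :=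
  map_nhds_subtype_coe_eq_nhds x.2 (U.2.mem_nhds x.2)

lemma ext0_congr {U : Opens E} {f g : U → F} {x : U} (h : f =ᶠ[𝓝 x] g) :
    ext0 f =ᶠ[𝓝 (x : E)] ext0 g := by
  rw [← map_val_nhds x, Filter.EventuallyEq, Filter.eventually_map]
  filter_upwards [h] with y hy
  rw [ext0_coe, ext0_coe, hy]

/-- Smoothness at a point of a map on an open subset, in terms of its extension. -/
lemma contMDiffAt_iff_ext0 {U : Opens E} {f : U → F} {x : U} {n : ℕ∞ω} :
    ContMDiffAt 𝓘(ℝ, E) 𝓘(ℝ, F) n f x ↔ ContDiffAt ℝ n (ext0 f) x := by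
  rw [← contMDiffAt_iff_contDiffAt, ← contMDiffAt_subtype_iff]
  simp_rw [ext0_coe]

lemma contMDiffAt_iff_ext0' {U : Opens E} {V : Opens F} {f : U → V} {x : U} :
    ContMDiffAt 𝓘(ℝ, E) 𝓘(ℝ, F) ∞ f x ↔ ContDiffAt ℝ ∞ (ext0 (Subtype.val ∘ f)) x := by
  rw [← contMDiffAt_iff_ext0, ContMDiffAt.subtypeVal_comp_iff]

/-- The derivative of a map between open subsets of normed spaces. -/
noncomputable def dv {U : Opens E} {V : Opens F} (f : U → V) (x : U) : E →L[ℝ] F :=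
  fderiv ℝ (ext0 (Subtype.val ∘ f)) x

lemma dv_congr {U : Opens E} {V : Opens F} {f g : U → V} {x : U} (h : f =ᶠ[𝓝 x] g) :
    dv f x = dv g x :=
  (ext0_congr (h.fun_comp Subtype.val)).fderiv_eq

lemma dv_id {U : Opens E} (x : U) : dv (id : U → U) x = ContinuousLinearMap.id ℝ E := by
  have : ext0 (Subtype.val ∘ (id : U → U)) =ᶠ[𝓝 (x : E)] id := by
    rw [← map_val_nhds x, Filter.EventuallyEq, Filter.eventually_map]
    exact Filter.Eventually.of_forall fun y => ext0_coe _ y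
  rw [dv, this.fderiv_eq, fderiv_id]

lemma dv_comp {U : Opens E} {V : Opens F} {W : Opens K} {f : U → V} {g : V → W} {x : U}
    (hf : ContMDiffAt 𝓘(ℝ, E) 𝓘(ℝ, F) ∞ f x) (hg : ContMDiffAt 𝓘(ℝ, F) 𝓘(ℝ, K) ∞ g (f x)) :
    dv (g ∘ f) x = (dv g (f x)).comp (dv f x) := by
  have hf' := (contMDiffAt_iff_ext0'.1 hf).differentiableAt (by simp)
  have hg' := (contMDiffAt_iff_ext0'.1 hg).differentiableAt (by simp)
  have : ext0 (Subtype.val ∘ (g ∘ f)) =ᶠ[𝓝 (x : E)]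
      ext0 (Subtype.val ∘ g) ∘ ext0 (Subtype.val ∘ f) := by
    rw [← map_val_nhds x, Filter.EventuallyEq, Filter.eventually_map]
    refine Filter.Eventually.of_forall fun y => ?_
    rw [Function.comp_apply, ext0_coe, ext0_coe]
    exact (ext0_coe (Subtype.val ∘ g) (f y)).symm
  rw [dv, this.fderiv_eq]
  have hx : ext0 (Subtype.val ∘ f) x = f x := ext0_coe _ x
  rw [fderiv_comp _ (by rw [hx]; exact hg') hf', hx]
  rfl

lemma contDiffAt_dv {U : Opens E} {V : Opens F} {f : U → V} {x : U}
    (hf : ContMDiffAt 𝓘(ℝ, E) 𝓘(ℝ, F) ∞ f x) : ContinuousAt (dv f) x := by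
  have h := ((contMDiffAt_iff_ext0'.1 hf).fderiv_right (m := 0) (by simp)).continuousAt
  exact h.comp_of_eq continuous_subtype_val.continuousAt rfl

lemma mfderiv_eq_dv {U : Opens E} {V : Opens F} {f : U → V} {x : U}
    (hf : ContMDiffAt 𝓘(ℝ, E) 𝓘(ℝ, F) ∞ f x) :
    (mfderiv 𝓘(ℝ, E) 𝓘(ℝ, F) f x : E →L[ℝ] F) = dv f x := by
  have h1 := hf.mdifferentiableAt (by simp)
  refine (if_pos h1).trans ?_
  rw [dv]
  simp only [modelWithCornersSelf_coe, range_id, fderivWithin_univ]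
  have hx : (extChartAt 𝓘(ℝ, E) x) x = (x : E) := rfl
  rw [hx]
  refine Filter.EventuallyEq.fderiv_eq ?_
  rw [← map_val_nhds x, Filter.EventuallyEq, Filter.eventually_map]
  refine Filter.Eventually.of_forall fun y => ?_
  rw [ext0_coe]
  have : (chartAt E x).symm (y : E) = y :=
    (chartAt E x).left_inv (x := y) (by
      change y ∈ ((chartAt E (x : E)).subtypeRestr ⟨x⟩).source
      rw [OpenPartialHomeomorph.subtypeRestr_source]
      exact mem_univ _)
  simp only [writtenInExtChartAt, mfld_simps, this]
  rfl
 
end Calculus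

/-! ### Germs of local changes of charts and their 1-jets -/

section Local

variable {E : Type*} [NormedAddCommGroup E] [NormedSpace ℝ E]
  {X : Type*} [TopologicalSpace X]

/-- `φ` is, near `x`, a local change of uniformizing systems. -/
def Loc (c d : UChart E X) (φ : c.V → d.V) (x : c.V) : Prop :=
  IsLocalDiffeomorphAt 𝓘(ℝ, E) 𝓘(ℝ, E) ∞ φ x ∧ ∀ᶠ w in 𝓝 x, d.π (φ w) = c.π w

variable {b c d : UChart E X}

lemma Change.loc (h : Change c d) {x : c.V} (hx : x ∈ h.source) : Loc c d h x :=
  ⟨⟨h.diffeo, hx, Set.eqOn_refl _ _⟩,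
    Filter.eventually_of_mem (h.diffeo.open_source.mem_nhds hx) h.comm⟩

lemma Injection.loc (i : Injection c d) (x : c.V) : Loc c d i x :=
  ⟨i.isLocalDiffeomorph x, Filter.Eventually.of_forall i.comm⟩

lemma loc_of_group {g : c.V ≃ₜ c.V} (hg : g ∈ c.G) (x : c.V) : Loc c c g x :=
  (Injection.ofGroup ⟨g, hg⟩).loc x

lemma loc_id (x : c.V) : Loc c c id x := by
  have := loc_of_group c.G.one_mem x
  exact this

namespace Loc

lemma contMDiffAt {φ : c.V → d.V} {x : c.V} (h : Loc c d φ x) :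
    ContMDiffAt 𝓘(ℝ, E) 𝓘(ℝ, E) ∞ φ x := h.1.contMDiffAt

lemma continuousAt {φ : c.V → d.V} {x : c.V} (h : Loc c d φ x) : ContinuousAt φ x :=
  h.contMDiffAt.continuousAt

lemma comm {φ : c.V → d.V} {x : c.V} (h : Loc c d φ x) : d.π (φ x) = c.π x :=
  h.2.self_of_nhds

lemma comp {φ : b.V → c.V} {ψ : c.V → d.V} {x : b.V} (hψ : Loc c d ψ (φ x))
    (hφ : Loc b c φ x) : Loc b d (ψ ∘ φ) x := by
  refine ⟨hφ.1.comp _ _ hψ.1, ?_⟩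
  filter_upwards [hφ.2, hφ.continuousAt.eventually hψ.2] with w h1 h2
  rw [Function.comp_apply, h2, h1]

lemma congr {φ ψ : c.V → d.V} {x : c.V} (h : Loc c d φ x) (e : ∀ᶠ w in 𝓝 x, φ w = ψ w) :
    Loc c d ψ x := by
  obtain ⟨⟨Φ, hx, hΦ⟩, h2⟩ := h
  obtain ⟨U, hU, hUo, hxU⟩ := eventually_nhds_iff.1 e
  refine ⟨⟨{ toPartialEquiv := (Φ.toOpenPartialHomeomorph.restrOpen U hUo).toPartialEquiv
             open_source := (Φ.toOpenPartialHomeomorph.restrOpen U hUo).open_source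
             open_target := (Φ.toOpenPartialHomeomorph.restrOpen U hUo).open_target
             contMDiffOn_toFun := Φ.contMDiffOn_toFun.mono fun y hy => ?_
             contMDiffOn_invFun := Φ.contMDiffOn_invFun.mono fun y hy => ?_ }, ?_, ?_⟩, ?_⟩
  · simp only [OpenPartialHomeomorph.restrOpen_source] at hy
    exact hy.1
  · simp [OpenPartialHomeomorph.restrOpen] at hy
    exact hy.1
  · simp only [OpenPartialHomeomorph.restrOpen_source]
    exact ⟨hx, hxU⟩
  · intro y hy
    simp only [OpenPartialHomeomorph.restrOpen_source] at hy
    exact (hU y hy.2).symm.trans (hΦ hy.1)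
  · filter_upwards [h2, e] with w h1 h2
    rw [← h2, h1]

lemma eventually {φ : c.V → d.V} {x : c.V} (h : Loc c d φ x) :
    ∀ᶠ w in 𝓝 x, Loc c d φ w := by
  obtain ⟨⟨Φ, hx, hΦ⟩, h2⟩ := h
  filter_upwards [Φ.open_source.mem_nhds hx, h2.eventually_nhds] with w hw h3
  exact ⟨⟨Φ, hw, hΦ⟩, h3⟩

lemma exists_inv {φ : c.V → d.V} {x : c.V} (h : Loc c d φ x) :
    ∃ ψ : d.V → c.V, Loc d c ψ (φ x) ∧ ψ (φ x) = x ∧ (∀ᶠ w in 𝓝 x, ψ (φ w) = w) ∧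
      ∀ᶠ y in 𝓝 (φ x), φ (ψ y) = y := by
  have h1 := h.1
  have hl : h1.localInverse (φ x) = x := h1.localInverse_left_inv h1.localInverse_mem_target
  refine ⟨h1.localInverse, ⟨h1.localInverse_isLocalDiffeomorphAt, ?_⟩, hl,
    h1.localInverse_eventuallyEq_left, h1.localInverse_eventuallyEq_right⟩
  have hc : ContinuousAt h1.localInverse (φ x) := h1.localInverse_contMDiffAt.continuousAt
  have h2 := h.2
  rw [ContinuousAt, hl] at hc
  filter_upwards [h1.localInverse_eventuallyEq_right, hc.eventually h2] with y h3 h4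
  rw [← h4]
  exact congrArg d.π h3

lemma map_nhds {φ : c.V → d.V} {x : c.V} (h : Loc c d φ x) :
    Filter.map φ (𝓝 x) = 𝓝 (φ x) := by
  obtain ⟨ψ, hψ, h0, h1, h2⟩ := h.exists_inv
  refine le_antisymm h.continuousAt ?_
  have hc := hψ.continuousAt
  rw [ContinuousAt, h0] at hc
  calc 𝓝 (φ x) = Filter.map (φ ∘ ψ) (𝓝 (φ x)) := by
        rw [← Filter.map_congr (m₂ := φ ∘ ψ) (m₁ := id) (h2.mono fun y hy => hy.symm), Filter.map_id]
    _ ≤ Filter.map φ (𝓝 x) := by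
        rw [← Filter.map_map]
        exact Filter.map_mono hc

lemma eventually_of_map {φ : c.V → d.V} {x : c.V} (h : Loc c d φ x) {p : d.V → Prop} :
    (∀ᶠ y in 𝓝 (φ x), p y) ↔ ∀ᶠ w in 𝓝 x, p (φ w) := by
  rw [← h.map_nhds, Filter.eventually_map]

/-- A local change at a point is the germ of a `Change`. -/
lemma exists_change {φ : c.V → d.V} {x : c.V} (h : Loc c d φ x) :
    ∃ k : Change c d, x ∈ k.source ∧ (∀ w ∈ k.source, k w = φ w) := by
  obtain ⟨⟨Φ, hx, hΦ⟩, h2⟩ := h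
  obtain ⟨U, hU, hUo, hxU⟩ := eventually_nhds_iff.1 h2
  refine ⟨⟨{ toPartialEquiv := (Φ.toOpenPartialHomeomorph.restrOpen U hUo).toPartialEquiv
             open_source := (Φ.toOpenPartialHomeomorph.restrOpen U hUo).open_source
             open_target := (Φ.toOpenPartialHomeomorph.restrOpen U hUo).open_target
             contMDiffOn_toFun := Φ.contMDiffOn_toFun.mono fun y hy => ?_
             contMDiffOn_invFun := Φ.contMDiffOn_invFun.mono fun y hy => ?_ }, ?_⟩, ?_, ?_⟩
  · simp only [OpenPartialHomeomorph.restrOpen_source] at hy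
    exact hy.1
  · simp [OpenPartialHomeomorph.restrOpen] at hy
    exact hy.1
  · intro w hw
    simp only [OpenPartialHomeomorph.restrOpen_source] at hw
    rw [← hU w hw.2]
    exact congrArg d.π (hΦ hw.1).symm
  · simp only [Change.source, OpenPartialHomeomorph.restrOpen_source]
    exact ⟨hx, hxU⟩
  · intro w hw
    simp only [Change.source, OpenPartialHomeomorph.restrOpen_source] at hw
    exact (hΦ hw.1).symm

end Loc

/-- Germs of inverse diffeomorphisms have mutually inverse derivatives. -/
lemma Loc.exists_equiv {φ : c.V → d.V} {x : c.V} (h : Loc c d φ x) :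
    ∃ e : E ≃L[ℝ] E, (e : E →L[ℝ] E) = dv φ x := by
  obtain ⟨ψ, hψ, h0, h1, h2⟩ := h.exists_inv
  have e1 : (dv ψ (φ x)).comp (dv φ x) = ContinuousLinearMap.id ℝ E := by
    rw [← dv_comp h.contMDiffAt hψ.contMDiffAt, ← dv_id x]
    exact dv_congr h1
  have hφ' : Loc c d φ (ψ (φ x)) := by rwa [h0]
  have e2 : (dv φ x).comp (dv ψ (φ x)) = ContinuousLinearMap.id ℝ E := by
    have := dv_comp hψ.contMDiffAt hφ'.contMDiffAt
    rw [h0] at this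
    rw [← this, ← dv_id (φ x)]
    exact dv_congr h2
  exact ⟨ContinuousLinearEquiv.equivOfInverse (dv φ x) (dv ψ (φ x))
    (fun v => DFunLike.congr_fun e1 v) (fun v => DFunLike.congr_fun e2 v), rfl⟩

open Classical in
/-- The derivative of a local change, as a linear automorphism (the identity as junk value). -/
noncomputable def der (φ : c.V → d.V) (x : c.V) : E ≃L[ℝ] E :=
  if h : ∃ e : E ≃L[ℝ] E, (e : E →L[ℝ] E) = dv φ x then h.choose else 1

lemma Loc.coe_der {φ : c.V → d.V} {x : c.V} (h : Loc c d φ x) :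
    (der φ x : E →L[ℝ] E) = dv φ x := by
  rw [der, dif_pos h.exists_equiv]
  exact h.exists_equiv.choose_spec

lemma der_congr {φ ψ : c.V → d.V} {x : c.V} (h : ∀ᶠ w in 𝓝 x, φ w = ψ w) :
    der φ x = der ψ x := by
  rw [der, der, dv_congr h]

lemma Loc.der_comp {φ : b.V → c.V} {ψ : c.V → d.V} {x : b.V} (hψ : Loc c d ψ (φ x))
    (hφ : Loc b c φ x) : der (ψ ∘ φ) x = der ψ (φ x) * der φ x := by
  apply ContinuousLinearEquiv.coe_injective
  rw [(hψ.comp hφ).coe_der, dv_comp hφ.contMDiffAt hψ.contMDiffAt, ← hψ.coe_der, ← hφ.coe_der]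
  rfl

lemma der_id (x : c.V) : der (id : c.V → c.V) x = 1 := by
  apply ContinuousLinearEquiv.coe_injective
  rw [(loc_id x).coe_der, dv_id]
  rfl

/-- The averaging argument: a diffeomorphism of finite order with a fixed point at which its
derivative is the identity is the identity near this point. -/
lemma eventually_eq_of_dv_eq_id [FiniteDimensional ℝ E] {g : c.V ≃ₜ c.V} (hg : g ∈ c.G)
    {x : c.V} (hx : g x = x) (hd : dv g x = ContinuousLinearMap.id ℝ E) :
    ∀ᶠ w in 𝓝 x, g w = w := by
  have := c.finite
  obtain ⟨n, hn, hgn⟩ : ∃ n, 0 < n ∧ g ^ n = 1 := by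
    obtain ⟨n, hn, h⟩ := (isOfFinOrder_of_finite (⟨g, hg⟩ : c.G)).exists_pow_eq_one
    exact ⟨n, hn, by simpa using congrArg Subtype.val h⟩
  have hpx : ∀ k, (g ^ k) x = x := by
    intro k
    induction k with
    | zero => rfl
    | succ k ih => rw [pow_succ, Homeomorph.mul_apply, hx, ih]
  have hpd : ∀ k, dv (g ^ k : c.V ≃ₜ c.V) x = ContinuousLinearMap.id ℝ E := by
    intro k
    induction k with
    | zero => exact dv_id x
    | succ k ih =>
      have : ((g ^ (k + 1) : c.V ≃ₜ c.V) : c.V → c.V) = (g ^ k : c.V ≃ₜ c.V) ∘ g := by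
        rw [pow_succ]; rfl
      rw [this, dv_comp (c.smooth g hg x) (c.smooth _ (c.G.pow_mem hg k) _), hx, ih, hd]
      rfl
  -- The sum over the powers of `g` has derivative `n • id` at `x`, so it is injective near `x`.
  -- Since `g ^ n = 1`, precomposing it with `g` only permutes the summands.
  let φ : E → E := fun y => ∑ k ∈ Finset.range n, ext0 (Subtype.val ∘ (g ^ k : c.V ≃ₜ c.V)) y
  have hφ : HasStrictFDerivAt φ ((ContinuousLinearEquiv.smulLeft
      (Units.mk0 (n : ℝ) (by positivity)) : E ≃L[ℝ] E) : E →L[ℝ] E) (x : E) := by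
    have h1 : HasStrictFDerivAt φ (∑ k ∈ Finset.range n, ContinuousLinearMap.id ℝ E) (x : E) := by
      refine HasStrictFDerivAt.fun_sum fun k _ => ?_
      rw [← hpd k]
      exact (contMDiffAt_iff_ext0'.1
        (c.smooth _ (c.G.pow_mem hg k) x)).hasStrictFDerivAt (by simp)
    convert h1 using 1
    ext v
    simp [Units.smul_def, Nat.cast_smul_eq_nsmul]
  have hinv := hφ.eventually_left_inverse
  rw [← map_val_nhds x, Filter.eventually_map] at hinv
  have hgc : Filter.Tendsto g (𝓝 x) (𝓝 x) := by
    have := g.continuous.continuousAt (x := x)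
    rwa [ContinuousAt, hx] at this
  filter_upwards [hinv, hgc.eventually hinv] with w h1 h2
  have : φ (g w) = φ w := by
    have h3 : ∀ k, ext0 (Subtype.val ∘ (g ^ k : c.V ≃ₜ c.V)) (g w : E) =
        ext0 (Subtype.val ∘ (g ^ (k + 1) : c.V ≃ₜ c.V)) (w : E) := by
      intro k
      rw [ext0_coe, ext0_coe, pow_succ]
      rfl
    have h4 := Finset.sum_range_succ' (fun k => ext0 (Subtype.val ∘ (g ^ k : c.V ≃ₜ c.V)) (w : E)) n
    rw [Finset.sum_range_succ, hgn] at h4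
    simp only [φ, h3]
    simpa using h4.symm
  rw [this, h1] at h2
  exact (Subtype.ext h2).symm

/-- An element of the group of a uniformizing system with a fixed point at which its derivative is
the identity is trivial. -/
lemma eq_one_of_dv_eq_id [FiniteDimensional ℝ E] {g : c.V ≃ₜ c.V} (hg : g ∈ c.G)
    {x : c.V} (hx : g x = x) (hd : dv g x = ContinuousLinearMap.id ℝ E) : g = 1 := by
  have hV : PreconnectedSpace c.V :=
    isPreconnected_iff_preconnectedSpace.1 c.connected.isPreconnected
  -- Closed by continuity of the 1-jet, open by the local statement; the chart is connected.
  have hcl : IsClopen {y : c.V | g y = y ∧ dv g y = ContinuousLinearMap.id ℝ E} := by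
    constructor
    · refine (isClosed_eq g.continuous continuous_id).inter
        (isClosed_eq (continuous_iff_continuousAt.2 fun y => ?_) continuous_const)
      exact contDiffAt_dv (c.smooth g hg y)
    · refine isOpen_iff_mem_nhds.2 fun y hy => ?_
      filter_upwards [(eventually_eq_of_dv_eq_id hg hy.1 hy.2).eventually_nhds] with w hw
      exact ⟨hw.self_of_nhds, (dv_congr hw).trans (dv_id w)⟩
  have := hcl.eq_univ ⟨x, hx, hd⟩
  ext y
  have hy : y ∈ {y : c.V | g y = y ∧ dv g y = ContinuousLinearMap.id ℝ E} := by
    rw [this]; trivial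
  rw [hy.1]
  rfl

/-- The chain rule shows that `g'⁻¹ * g` fixes `x` with derivative the identity, so it is trivial.
-/
lemma eq_of_der_eq [FiniteDimensional ℝ E] {g g' : c.V ≃ₜ c.V} (hg : g ∈ c.G) (hg' : g' ∈ c.G)
    {x : c.V} (hx : g x = g' x) (hd : der g x = der g' x) : g = g' := by
  have h1 : Loc c c (g'⁻¹ : c.V ≃ₜ c.V) (g' x) := loc_of_group (c.G.inv_mem hg') _
  have h2 : g'⁻¹ * g = 1 := by
    refine eq_one_of_dv_eq_id (x := x) (c.G.mul_mem (c.G.inv_mem hg') hg) ?_ ?_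
    · rw [Homeomorph.mul_apply, hx]
      exact g'.symm_apply_apply x
    · have e1 : der ((g'⁻¹ : c.V ≃ₜ c.V) ∘ g) x = der ((g'⁻¹ : c.V ≃ₜ c.V) ∘ g') x := by
        rw [Loc.der_comp (by rw [hx]; exact h1) (loc_of_group hg x),
          Loc.der_comp h1 (loc_of_group hg' x), hd, hx]
      have e2 : ((g'⁻¹ : c.V ≃ₜ c.V) ∘ g') = id := by
        ext y; simp [Homeomorph.inv_def]
      have e3 := (loc_of_group (c.G.mul_mem (c.G.inv_mem hg') hg) x).coe_der
      rw [← e3, show ((g'⁻¹ * g : c.V ≃ₜ c.V) : c.V → c.V) = (g'⁻¹ : c.V ≃ₜ c.V) ∘ g from rfl, e1,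
        e2, der_id]
      rfl
  exact (inv_mul_eq_one.1 h2).symm

lemma eq_of_eventually_eq [FiniteDimensional ℝ E] {g g' : c.V ≃ₜ c.V} (hg : g ∈ c.G)
    (hg' : g' ∈ c.G) {x : c.V} (h : ∀ᶠ w in 𝓝 x, g w = g' w) : g = g' :=
  eq_of_der_eq hg hg' h.self_of_nhds (der_congr h)

end Local

end Orb

namespace Orb

/-! ### Finite closed covers and locally constant functions -/

section Topology

/-- A finite family of relatively closed sets covering a nonempty open set has a member with an
interior point in it. -/
lemma exists_eventually_mem_of_finite_cover {Y ι : Type*} [TopologicalSpace Y] [Finite ι]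
    {O : Set Y} (hO : IsOpen O) (hne : O.Nonempty) {A : ι → Set Y}
    (hcov : ∀ w ∈ O, ∃ i, w ∈ A i)
    (hcl : ∀ i, ∀ w ∈ O, (∃ᶠ y in 𝓝 w, y ∈ A i) → w ∈ A i) :
    ∃ i, ∃ w ∈ O, ∀ᶠ y in 𝓝 w, y ∈ A i := by
  classical
  by_contra! hc
  -- If no `A i` has an interior point, the members can be avoided one after another on ever smaller
  -- open sets, until a point lies in none of them.
  have key : ∀ s : Finset ι, ∃ O' ⊆ O, IsOpen O' ∧ O'.Nonempty ∧ ∀ i ∈ s, ∀ y ∈ O', y ∉ A i := by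
    intro s
    induction s using Finset.induction_on with
    | empty => exact ⟨O, subset_rfl, hO, hne, by simp⟩
    | insert i s _ ih =>
      obtain ⟨O', hO', hop, ⟨w, hw⟩, hd⟩ := ih
      have h1 : ∃ᶠ y in 𝓝 w, y ∉ A i := by
        simpa [Filter.not_eventually] using hc i w (hO' hw)
      obtain ⟨y, hy1, hy2⟩ := (h1.and_eventually (hop.mem_nhds hw)).exists
      have h2 : ∀ᶠ y' in 𝓝 y, y' ∉ A i := by
        by_contra h3
        rw [Filter.not_eventually] at h3
        exact hy1 (hcl i y (hO' hy2) (by simpa using h3))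
      obtain ⟨W, hW, hWo, hyW⟩ := eventually_nhds_iff.1 h2
      refine ⟨O' ∩ W, inter_subset_left.trans hO', hop.inter hWo, ⟨y, hy2, hyW⟩, ?_⟩
      intro j hj z hz
      rcases Finset.mem_insert.1 hj with rfl | hj
      · exact hW z hz.2
      · exact hd j hj z hz.1
  have := Fintype.ofFinite ι
  obtain ⟨O', hO', -, ⟨w, hw⟩, hd⟩ := key Finset.univ
  obtain ⟨i, hi⟩ := hcov w (hO' hw)
  exact hd i (Finset.mem_univ i) w hw hi

/-- A locally constant function on a preconnected set is constant. -/
lemma eq_of_locally_const {Y β : Type*} [TopologicalSpace Y] {S : Set Y} (hS : IsPreconnected S)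
    {γ : Y → β} (h : ∀ x ∈ S, ∀ᶠ y in 𝓝[S] x, γ y = γ x) {x y : Y} (hx : x ∈ S) (hy : y ∈ S) :
    γ x = γ y := by
  let : TopologicalSpace β := ⊥
  have : DiscreteTopology β := ⟨rfl⟩
  refine hS.constant (f := γ) (fun z hz => ?_) hx hy
  rw [ContinuousWithinAt, nhds_discrete]
  exact Filter.tendsto_pure.2 (h z hz)

lemma eq_of_frequently_eq {Y Z : Type*} [TopologicalSpace Y] [TopologicalSpace Z] [T2Space Z]
    {f g : Y → Z} {w : Y} (hf : ContinuousAt f w) (hg : ContinuousAt g w)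
    (h : ∃ᶠ y in 𝓝 w, f y = g y) : f w = g w := by
  by_contra hne
  exact h (((hf.prodMk_nhds hg).eventually
    (isClosed_diagonal.isOpen_compl.mem_nhds (x := (f w, g w)) hne)).mono fun y hy => hy)

lemma frequently_exists_of_finite {Y ι : Type*} [Finite ι] {l : Filter Y} {p : ι → Y → Prop}
    (h : ∃ᶠ y in l, ∃ i, p i y) : ∃ i, ∃ᶠ y in l, p i y := by
  by_contra! hc
  refine h ?_
  have : ∀ᶠ y in l, ∀ i, ¬ p i y := by
    rw [Filter.eventually_all]
    intro i
    exact hc i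
  filter_upwards [this] with y hy
  simpa using hy

end Topology

/-! ### Local changes are unique up to the chart group -/

section Rigidity

variable {E : Type*} [NormedAddCommGroup E] [NormedSpace ℝ E] [FiniteDimensional ℝ E]
  {X : Type*} [TopologicalSpace X] {b c d : UChart E X}

/-- Two local changes at a point differ by an element of the group. -/
lemma Loc.exists_group {φ ψ : c.V → d.V} {x : c.V} (hφ : Loc c d φ x) (hψ : Loc c d ψ x) :
    ∃ g ∈ d.G, ∀ᶠ w in 𝓝 x, ψ w = g (φ w) := by
  have := d.finite
  have : LocallyConnectedSpace c.V := c.V.2.locallyConnectedSpace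
  obtain ⟨O', hO', hO'x⟩ := (hφ.eventually.and hψ.eventually).exists_mem
  obtain ⟨O, ⟨hOo, hxO, hOc⟩, hOO'⟩ :=
    (LocallyConnectedSpace.open_connected_basis x).mem_iff.1 hO'
  have hL : ∀ w ∈ O, Loc c d φ w ∧ Loc c d ψ w := fun w hw => hO'x w (hOO' hw)
  have hLg : ∀ g : d.G, ∀ w ∈ O, Loc c d (g.1 ∘ φ) w := fun g w hw =>
    (loc_of_group g.2 _).comp (hL w hw).1
  -- Equality of 1-jets, not just of values: a 1-jet determines the group element, so these
  -- relatively closed sets are disjoint in `O`, whereas a value may be shared by several elements.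
  let C : d.G → Set c.V := fun g => {w | g.1 (φ w) = ψ w ∧ dv (g.1 ∘ φ) w = dv ψ w}
  have hcl : ∀ g, ∀ w ∈ O, (∃ᶠ y in 𝓝 w, y ∈ C g) → w ∈ C g := by
    intro g w hw hf
    constructor
    · exact eq_of_frequently_eq (hLg g w hw).continuousAt (hL w hw).2.continuousAt
        (hf.mono fun y hy => hy.1)
    · exact eq_of_frequently_eq (contDiffAt_dv (hLg g w hw).contMDiffAt)
        (contDiffAt_dv (hL w hw).2.contMDiffAt) (hf.mono fun y hy => hy.2)
  have hcov : ∀ w ∈ O, ∃ g, w ∈ C g := by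
    intro w hw
    -- In any small open set some equality of values holds near a point, and there derivatives agree
    -- too. So the union of the `C g` is dense in `O`; being a finite union of relatively closed
    -- sets, it is all of `O`.
    have : ∃ᶠ y in 𝓝 w, ∃ g, y ∈ C g := by
      rw [Filter.frequently_iff]
      intro U hU
      obtain ⟨W, hWU, hWo, hwW⟩ := mem_nhds_iff.1 hU
      obtain ⟨g, y, hy, hyg⟩ := exists_eventually_mem_of_finite_cover
        (A := fun g : d.G => {w | g.1 (φ w) = ψ w}) (hWo.inter hOo) ⟨w, hwW, hw⟩
        (fun w' hw' => by
          obtain ⟨g, hg, h⟩ := (d.fibre (φ w') (ψ w')).1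
            ((hL w' hw'.2).1.comm.trans (hL w' hw'.2).2.comm.symm)
          exact ⟨⟨g, hg⟩, h⟩)
        (fun g w' hw' hf => eq_of_frequently_eq (hLg g w' hw'.2).continuousAt
          (hL w' hw'.2).2.continuousAt hf)
      exact ⟨y, hWU hy.1, g, hyg.self_of_nhds, dv_congr hyg⟩
    obtain ⟨g, hg⟩ := frequently_exists_of_finite this
    exact ⟨g, hcl g w hw hg⟩
  have huniq : ∀ w ∈ O, ∀ g g', w ∈ C g → w ∈ C g' → g = g' := by
    intro w hw g g' hg hg'
    refine Subtype.ext (eq_of_der_eq (x := φ w) g.2 g'.2 (hg.1.trans hg'.1.symm) ?_)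
    have h1 := Loc.der_comp (loc_of_group g.2 _) (hL w hw).1
    have h2 := Loc.der_comp (loc_of_group g'.2 _) (hL w hw).1
    have h3 : der (g.1 ∘ φ) w = der (g'.1 ∘ φ) w := by
      rw [der, der, hg.2, hg'.2]
    rw [h1, h2] at h3
    exact mul_right_cancel h3
  choose! γ hγ using hcov
  have hconst : ∀ w ∈ O, γ x = γ w := fun w hw => by
    refine eq_of_locally_const hOc.isPreconnected (fun y hy => ?_) hxO hw
    have : ∀ᶠ z in 𝓝 y, ∀ g, g ≠ γ y → z ∉ C g := by
      rw [Filter.eventually_all]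
      intro g
      by_cases h : g = γ y
      · simp [h]
      · have : ∀ᶠ z in 𝓝 y, z ∉ C g := by
          by_contra h3
          rw [Filter.not_eventually] at h3
          exact h (huniq y hy _ _ (hcl g y hy (by simpa using h3)) (hγ y hy))
        filter_upwards [this] with z hz _ using hz
    filter_upwards [nhdsWithin_le_nhds this, self_mem_nhdsWithin] with z hz hzO
    by_contra h
    exact hz _ h (hγ z hzO)
  refine ⟨(γ x).1, (γ x).2, ?_⟩
  filter_upwards [hOo.mem_nhds hxO] with w hw
  rw [hconst w hw]
  exact (hγ w hw).1.symm

/-- The germ of a local change is determined by its `1`-jet. -/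
lemma Loc.eventually_eq_of_der_eq {φ ψ : c.V → d.V} {x : c.V} (hφ : Loc c d φ x)
    (hψ : Loc c d ψ x) (h0 : φ x = ψ x) (h1 : der φ x = der ψ x) : ∀ᶠ w in 𝓝 x, φ w = ψ w := by
  obtain ⟨g, hg, h⟩ := hφ.exists_group hψ
  have h2 : der ψ x = der g (φ x) * der φ x := by
    rw [← Loc.der_comp (loc_of_group hg _) hφ]
    exact der_congr h
  rw [← h1] at h2
  have h3 : g = 1 := by
    refine eq_of_der_eq (x := φ x) hg d.G.one_mem ?_ ?_
    · rw [← h.self_of_nhds, ← h0]; rfl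
    · have h4 : der g (φ x) = 1 := by simpa using h2
      rw [h4]
      exact (der_id _).symm
  filter_upwards [h] with w hw
  rw [hw, h3]; rfl

/-- Near each point the two changes differ by one fixed group element, which is trivial as soon as
they agree near some nearby point. So agreement of germs is both an open and a closed condition. -/
lemma Loc.eqOn_of_eventually_eq {φ ψ : c.V → d.V} {S : Set c.V} (hS : IsPreconnected S)
    (hφ : ∀ x ∈ S, Loc c d φ x) (hψ : ∀ x ∈ S, Loc c d ψ x) {x : c.V} (hx : x ∈ S)
    (h : ∀ᶠ w in 𝓝 x, φ w = ψ w) : ∀ y ∈ S, ∀ᶠ w in 𝓝 y, φ w = ψ w := by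
  intro y hy
  have key : ∀ z ∈ S, ∀ᶠ z' in 𝓝[S] z,
      (∀ᶠ w in 𝓝 z', φ w = ψ w) = (∀ᶠ w in 𝓝 z, φ w = ψ w) := by
    intro z hz
    obtain ⟨g, hg, h1⟩ := (hφ z hz).exists_group (hψ z hz)
    by_cases h2 : ∀ᶠ w in 𝓝 z, φ w = ψ w
    · filter_upwards [nhdsWithin_le_nhds h2.eventually_nhds] with z' hz'
      simp [hz', h2]
    · filter_upwards [nhdsWithin_le_nhds h1.eventually_nhds, self_mem_nhdsWithin] with z' hz' hS'
      simp only [h2, eq_iff_iff, iff_false]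
      intro h3
      have : g = 1 := by
        refine eq_of_eventually_eq (x := φ z') hg d.G.one_mem ?_
        rw [(hφ z' hS').eventually_of_map]
        filter_upwards [hz', h3] with w e1 e2
        rw [← e1, ← e2]; rfl
      refine h2 ?_
      filter_upwards [h1] with w hw
      rw [hw, this]; rfl
  exact (eq_of_locally_const hS key hx hy) ▸ h

/-- Two injections that agree near a point are equal. -/
lemma Injection.eq_of_eventually_eq {i j : Injection c d} {x : c.V}
    (h : ∀ᶠ w in 𝓝 x, i w = j w) : i = j := by
  have hV : PreconnectedSpace c.V :=
    isPreconnected_iff_preconnectedSpace.1 c.connected.isPreconnected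
  ext1
  funext y
  exact (Loc.eqOn_of_eventually_eq isPreconnected_univ (fun x _ => i.loc x) (fun x _ => j.loc x)
    (mem_univ x) h y (mem_univ y)).self_of_nhds

lemma Compatible.exists_loc (h : Compatible c d) {x : c.V} {y : d.V} (hxy : c.π x = d.π y) :
    ∃ φ : c.V → d.V, Loc c d φ x ∧ φ x = y := by
  obtain ⟨k, hk, hky⟩ := h x y hxy
  exact ⟨k, k.loc hk, hky⟩

end Rigidity

/-- A map with a smooth local inverse is a local diffeomorphism. -/
lemma isLocalDiffeomorphAt_of_inv {E F M N : Type*} [NormedAddCommGroup E] [NormedSpace ℝ E]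
    [NormedAddCommGroup F] [NormedSpace ℝ F] [TopologicalSpace M] [TopologicalSpace N]
    [ChartedSpace E M] [ChartedSpace F N] {f : M → N} {g : N → M} {O : Set M} {O' : Set N}
    (hO : IsOpen O) (hO' : IsOpen O') (hf : ContMDiffOn 𝓘(ℝ, E) 𝓘(ℝ, F) ∞ f O)
    (hg : ContMDiffOn 𝓘(ℝ, F) 𝓘(ℝ, E) ∞ g O') (hgf : ∀ x ∈ O, g (f x) = x)
    (hfg : ∀ y ∈ O', f (g y) = y) {x : M} (hx : x ∈ O) (hfx : f x ∈ O') :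
    IsLocalDiffeomorphAt 𝓘(ℝ, E) 𝓘(ℝ, F) ∞ f x :=
  ⟨{ toFun := f
     invFun := g
     source := O ∩ f ⁻¹' O'
     target := O' ∩ g ⁻¹' O
     map_source' := fun y hy => ⟨hy.2, by simpa [hgf y hy.1] using hy.1⟩
     map_target' := fun y hy => ⟨hy.2, by simpa [hfg y hy.1] using hy.1⟩
     left_inv' := fun y hy => hgf y hy.1
     right_inv' := fun y hy => hfg y hy.1
     open_source := hf.continuousOn.isOpen_inter_preimage hO hO'
     open_target := hg.continuousOn.isOpen_inter_preimage hO' hO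
     contMDiffOn_toFun := hf.mono inter_subset_left
     contMDiffOn_invFun := hg.mono inter_subset_left }, ⟨hx, hfx⟩, fun _ _ => rfl⟩

end Orb

namespace Orb

/-! ### Restriction of charts to small invariant sets -/

section SmallCharts

variable {E : Type*} [NormedAddCommGroup E] [NormedSpace ℝ E]
  {X : Type*} [TopologicalSpace X] {c d : UChart E X}

/-- A connected open subset of a chart that is mapped to itself by the elements of `G` that do not
displace it from itself. -/
structure UChart.Stable (c : UChart E X) (N : Set c.V) : Prop where
  isOpen : IsOpen N
  connected : IsConnected N
  image_eq : ∀ g ∈ c.G, ∀ x ∈ N, g x ∈ N → ∀ y ∈ N, g y ∈ N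

namespace UChart.Stable

variable {N : Set c.V} (hN : c.Stable N)

/-- The domain of the restricted uniformizing system. -/
def opens (_ : c.Stable N) : Opens E :=
  ⟨Subtype.val '' N, c.V.2.isOpenMap_subtype_val _ (by assumption : c.Stable N).isOpen⟩

/-- The inclusion of the restricted domain. -/
def incl (y : hN.opens) : c.V := ⟨y.1, by obtain ⟨z, -, h⟩ := y.2; rw [← h]; exact z.2⟩

lemma incl_mem (y : hN.opens) : hN.incl y ∈ N := by
  obtain ⟨z, hz, h⟩ := y.2
  have : hN.incl y = z := Subtype.ext h.symm
  rwa [this]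

lemma incl_injective : Function.Injective hN.incl := fun _ _ h =>
  Subtype.ext (congrArg (Subtype.val : c.V → E) h)

/-- The point of the restricted domain given by a point of `N`. -/
def pt (x : c.V) (hx : x ∈ N) : hN.opens := ⟨x.1, x, hx, rfl⟩

lemma continuous_incl : Continuous hN.incl := continuous_subtype_val.subtype_mk _

lemma isOpenMap_incl : IsOpenMap hN.incl := by
  intro W hW
  obtain ⟨W', hW', rfl⟩ := isOpen_induced_iff.1 hW
  have : hN.incl '' (Subtype.val ⁻¹' W') = N ∩ Subtype.val ⁻¹' W' := by
    ext z
    constructor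
    · rintro ⟨y, hy, rfl⟩
      exact ⟨hN.incl_mem y, hy⟩
    · rintro ⟨hz, hz'⟩
      exact ⟨hN.pt z hz, hz', rfl⟩
  rw [this]
  exact hN.isOpen.inter (hW'.preimage continuous_subtype_val)

/-- The restriction of the inclusion's local inverse. -/
lemma isLocalDiffeomorph_incl :
    IsLocalDiffeomorph 𝓘(ℝ, E) 𝓘(ℝ, E) ∞ hN.incl := by
  classical
  intro y
  let r : c.V → hN.opens := fun x => if hx : x ∈ N then hN.pt x hx else y
  have hr : ∀ x (hx : x ∈ N), r x = hN.pt x hx := fun x hx => dif_pos hx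
  refine isLocalDiffeomorphAt_of_inv (g := r) isOpen_univ hN.isOpen ?_ ?_ ?_ ?_ (mem_univ y)
    (hN.incl_mem y)
  · refine ContMDiff.contMDiffOn ?_
    rw [← ContMDiff.subtypeVal_comp_iff]
    exact contMDiff_subtype_val
  · intro x hx
    refine ContMDiffAt.contMDiffWithinAt ?_
    rw [← ContMDiffAt.subtypeVal_comp_iff]
    refine (contMDiff_subtype_val x).congr_of_eventuallyEq ?_
    filter_upwards [hN.isOpen.mem_nhds hx] with z hz
    rw [Function.comp_apply, hr z hz]
    rfl
  · intro z _
    exact hr _ (hN.incl_mem z)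
  · intro z hz
    rw [hr z hz]
    rfl

/-- The group of the restricted uniformizing system. -/
def group : Subgroup (hN.opens ≃ₜ hN.opens) where
  carrier := {k | ∃ g ∈ c.G, ∀ y, hN.incl (k y) = g (hN.incl y)}
  mul_mem' := by
    rintro k k' ⟨g, hg, h⟩ ⟨g', hg', h'⟩
    refine ⟨g * g', c.G.mul_mem hg hg', fun y => ?_⟩
    rw [Homeomorph.mul_apply, Homeomorph.mul_apply, h, h']
  one_mem' := ⟨1, c.G.one_mem, fun y => rfl⟩
  inv_mem' := by
    rintro k ⟨g, hg, h⟩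
    refine ⟨g⁻¹, c.G.inv_mem hg, fun y => ?_⟩
    have h1 := h (k⁻¹ y)
    have h2 : k (k⁻¹ y) = y := k.apply_symm_apply y
    rw [h2] at h1
    rw [h1]
    exact (g.symm_apply_apply _).symm

lemma exists_group {g : c.V ≃ₜ c.V} (hg : g ∈ c.G) {x : c.V} (hx : x ∈ N) (hgx : g x ∈ N) :
    ∃ k ∈ hN.group, ∀ y, hN.incl (k y) = g (hN.incl y) := by
  have h1 := hN.image_eq g hg x hx hgx
  have h2 := hN.image_eq g⁻¹ (c.G.inv_mem hg) (g x) hgx (by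
    rw [show (g⁻¹ : c.V ≃ₜ c.V) (g x) = x from g.symm_apply_apply x]; exact hx)
  let k : hN.opens ≃ₜ hN.opens :=
    { toFun := fun y => hN.pt (g (hN.incl y)) (h1 _ (hN.incl_mem y))
      invFun := fun y => hN.pt ((g⁻¹ : c.V ≃ₜ c.V) (hN.incl y)) (h2 _ (hN.incl_mem y))
      left_inv := fun y => hN.incl_injective (g.symm_apply_apply _)
      right_inv := fun y => hN.incl_injective (g.apply_symm_apply _)
      continuous_toFun := (continuous_subtype_val.comp
        (g.continuous.comp hN.continuous_incl)).subtype_mk _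
      continuous_invFun := (continuous_subtype_val.comp
        ((g⁻¹ : c.V ≃ₜ c.V).continuous.comp hN.continuous_incl)).subtype_mk _ }
  exact ⟨k, ⟨g, hg, fun y => rfl⟩, fun y => rfl⟩

/-- The restriction of a uniformizing system to a stable set. -/
def restr : UChart E X where
  V := hN.opens
  connected := hN.connected.image _ continuous_subtype_val.continuousOn
  G := hN.group
  finite := by
    have := c.finite
    refine Finite.of_injective
      (fun k : hN.group => (⟨k.2.choose, k.2.choose_spec.1⟩ : c.G)) fun k k' h => ?_
    have h' : k.2.choose = k'.2.choose := congrArg Subtype.val h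
    refine Subtype.ext (Homeomorph.ext fun y => hN.incl_injective ?_)
    rw [k.2.choose_spec.2 y, k'.2.choose_spec.2 y, h']
  smooth := by
    rintro k ⟨g, hg, h⟩
    rw [← ContMDiff.subtypeVal_comp_iff]
    have e : (Subtype.val ∘ k : hN.opens → E) = Subtype.val ∘ g ∘ hN.incl :=
      funext fun y => congrArg Subtype.val (h y)
    rw [e]
    exact contMDiff_subtype_val.comp ((c.smooth g hg).comp hN.isLocalDiffeomorph_incl.contMDiff)
  π := c.π ∘ hN.incl
  continuous := c.continuous.comp hN.continuous_incl
  isOpenMap := c.isOpenMap.comp hN.isOpenMap_incl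
  fibre := by
    intro x y
    constructor
    · intro h
      obtain ⟨g, hg, hgx⟩ := (c.fibre _ _).1 h
      obtain ⟨k, hk, hkg⟩ := hN.exists_group hg (hN.incl_mem x) (by
        rw [hgx]; exact hN.incl_mem y)
      exact ⟨k, hk, hN.incl_injective ((hkg x).trans hgx)⟩
    · rintro ⟨k, ⟨g, hg, h⟩, rfl⟩
      exact (c.fibre _ _).2 ⟨g, hg, (h x).symm⟩

/-- The inclusion of the restricted system as an injection. -/
def inj : Injection hN.restr c where
  toFun := hN.incl
  injective := hN.incl_injective
  isLocalDiffeomorph := hN.isLocalDiffeomorph_incl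
  comm := fun _ => rfl

end UChart.Stable

/-- Every point of a chart has arbitrarily small stable neighbourhoods. -/
lemma UChart.exists_stable (c : UChart E X) (x : c.V) {W : Set c.V} (hW : W ∈ 𝓝 x) :
    ∃ N, c.Stable N ∧ x ∈ N ∧ N ⊆ W := by
  have := c.finite
  have : LocallyConnectedSpace c.V := c.V.2.locallyConnectedSpace
  have hsep : ∀ g : c.G, ∃ U : Set c.V, IsOpen U ∧ x ∈ U ∧
      (g.1 x ≠ x → ∀ y ∈ U, g.1 y ∉ U) := by
    intro g
    by_cases h : g.1 x = x
    · exact ⟨univ, isOpen_univ, mem_univ _, fun h' => (h' h).elim⟩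
    · obtain ⟨U₁, U₂, h1, h2, hx1, hx2, hd⟩ := t2_separation h
      exact ⟨U₂ ∩ g.1 ⁻¹' U₁, h2.inter (h1.preimage g.1.continuous), ⟨hx2, hx1⟩,
        fun _ y hy hy' => hd.le_bot ⟨hy.2, hy'.1⟩⟩
  choose U hUo hxU hU using hsep
  obtain ⟨W', hW'W, hW'o, hxW'⟩ := mem_nhds_iff.1 hW
  let N₁ : Set c.V := W' ∩ ⋂ g : c.G, U g
  have hN₁o : IsOpen N₁ := hW'o.inter (isOpen_iInter_of_finite hUo)
  have hxN₁ : x ∈ N₁ := ⟨hxW', mem_iInter.2 hxU⟩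
  -- By the choice of `U`, only elements fixing `x` can map a point of `N₁` into `N₁`. The set `N₂`
  -- is invariant under the elements fixing `x`, hence so is its component containing `x`.
  let N₂ : Set c.V := {y | ∀ g : c.G, g.1 x = x → g.1 y ∈ N₁}
  have hN₂o : IsOpen N₂ := by
    have : N₂ = ⋂ g : c.G, {y | g.1 x = x → g.1 y ∈ N₁} := by
      ext y; simp [N₂]
    rw [this]
    refine isOpen_iInter_of_finite fun g => ?_
    by_cases h : g.1 x = x
    · simp only [h, forall_const]
      exact hN₁o.preimage g.1.continuous
    · simp [h]
  have hxN₂ : x ∈ N₂ := fun g hg => by rw [hg]; exact hxN₁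
  have hN₂N₁ : N₂ ⊆ N₁ := fun y hy => hy 1 rfl
  refine ⟨connectedComponentIn N₂ x, ⟨hN₂o.connectedComponentIn,
    isConnected_connectedComponentIn_iff.2 hxN₂, ?_⟩, mem_connectedComponentIn hxN₂,
    (connectedComponentIn_subset _ _).trans (hN₂N₁.trans (inter_subset_left.trans hW'W))⟩
  intro g hg z hz hgz
  have hgx : g x = x := by
    by_contra h
    have h1 := (hN₂N₁ (connectedComponentIn_subset _ _ hz)).2
    have h2 := (hN₂N₁ (connectedComponentIn_subset _ _ hgz)).2
    exact hU ⟨g, hg⟩ h z (mem_iInter.1 h1 _) (mem_iInter.1 h2 _)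
  have himg : g '' connectedComponentIn N₂ x ⊆ connectedComponentIn N₂ x := by
    refine (isPreconnected_connectedComponentIn.image g
      g.continuous.continuousOn).subset_connectedComponentIn
      ⟨x, mem_connectedComponentIn hxN₂, hgx⟩ ?_
    rintro _ ⟨y, hy, rfl⟩ k hk
    have h1 := connectedComponentIn_subset _ _ hy (k * ⟨g, hg⟩) (by
      rw [Subgroup.coe_mul, Homeomorph.mul_apply]
      simpa [hgx] using hk)
    exact h1
  exact fun y hy => himg ⟨y, hy, rfl⟩

variable [FiniteDimensional ℝ E] {O : Orbifold E X}

/-- Local changes from `c` restrict to local changes from the smaller system; maximality of the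
atlas does the rest. -/
lemma UChart.Stable.mem_charts {N : Set c.V} (hN : c.Stable N) (hc : c ∈ O.charts) :
    hN.restr ∈ O.charts := by
  refine O.maximal _ fun d hd x y hxy => ?_
  obtain ⟨φ, hφ, hφx⟩ := (O.compatible c hc d hd).exists_loc (x := hN.inj x) hxy
  obtain ⟨k, hk, hkφ⟩ := (Loc.comp hφ (hN.inj.loc x)).exists_change
  exact ⟨k, hk, (hkφ x hk).trans hφx⟩

/-- Small charts around a point of a chart. -/
lemma Orbifold.exists_small (O : Orbifold E X) (hc : c ∈ O.charts) (x : c.V) {W : Set c.V}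
    (hW : W ∈ 𝓝 x) :
    ∃ e ∈ O.charts, ∃ (a : Injection e c) (w : e.V), a w = x ∧ range a ⊆ W := by
  obtain ⟨N, hN, hx, hNW⟩ := c.exists_stable x hW
  refine ⟨hN.restr, hN.mem_charts hc, hN.inj, hN.pt x hx, rfl, ?_⟩
  rintro _ ⟨y, rfl⟩
  exact hNW (hN.incl_mem y)

/-- A map that is an injective local change near the range of an injection gives an injection. -/
def Injection.ofLoc {e c d : UChart E X} (a : Injection e c) (φ : c.V → d.V)
    (h : ∀ x, Loc c d φ (a x)) (hi : InjOn φ (range a)) : Injection e d where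
  toFun := φ ∘ a
  injective := fun _ _ hxy => a.injective (hi ⟨_, rfl⟩ ⟨_, rfl⟩ hxy)
  isLocalDiffeomorph := fun x => ((h x).comp (a.loc x)).1
  comm := fun x => ((h x).comp (a.loc x)).comm

lemma Loc.exists_injOn {φ : c.V → d.V} {x : c.V} (h : Loc c d φ x) :
    ∃ U ∈ 𝓝 x, InjOn φ U ∧ ∀ w ∈ U, Loc c d φ w := by
  obtain ⟨ψ, hψ, h0, h1, h2⟩ := h.exists_inv
  obtain ⟨U, hU, hU'⟩ := (h1.and h.eventually).exists_mem
  refine ⟨U, hU, fun y hy z hz hyz => ?_, fun w hw => (hU' w hw).2⟩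
  rw [← (hU' y hy).1, ← (hU' z hz).1, hyz]

/-- A local change is, near a point, of the form `b ∘ a⁻¹` with injections of a third chart. -/
lemma Loc.exists_span (O : Orbifold E X) (hc : c ∈ O.charts) {φ : c.V → d.V} {x : c.V}
    (h : Loc c d φ x) {W : Set c.V} (hW : W ∈ 𝓝 x) :
    ∃ e ∈ O.charts, ∃ (a : Injection e c) (b : Injection e d) (w : e.V), a w = x ∧
      range a ⊆ W ∧ ∀ v, φ (a v) = b v := by
  obtain ⟨U, hU, hi, hL⟩ := h.exists_injOn
  obtain ⟨e, he, a, w, hw, hr⟩ := O.exists_small hc x (Filter.inter_mem hU hW)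
  exact ⟨e, he, a, a.ofLoc φ (fun y => hL _ (hr ⟨y, rfl⟩).1)
    (hi.mono (hr.trans inter_subset_left)), w, hw, hr.trans inter_subset_right, fun _ => rfl⟩

/-- An almost complex structure is preserved by local changes. -/
lemma AlmostComplex.invariant_loc (J : AlmostComplex O) (c d : O.charts) {φ : c.1.V → d.1.V}
    {x : c.1.V} (h : Loc c.1 d.1 φ x) (v : E) :
    dv φ x (J.J c x v) = J.J d (φ x) (dv φ x v) := by
  -- Invariance is only assumed for injections, so `φ` is written as `b ∘ a⁻¹` near the point.
  obtain ⟨e, he, a, b, w, rfl, -, hab⟩ := h.exists_span O c.2 Filter.univ_mem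
  have ha := fun v => J.invariant ⟨e, he⟩ c a w v
  have hb := fun v => J.invariant ⟨e, he⟩ d b w v
  have ea : (mfderiv 𝓘(ℝ, E) 𝓘(ℝ, E) a w : E →L[ℝ] E) = dv a w := mfderiv_eq_dv (a.loc w).contMDiffAt
  have eb : (mfderiv 𝓘(ℝ, E) 𝓘(ℝ, E) b w : E →L[ℝ] E) = dv b w := mfderiv_eq_dv (b.loc w).contMDiffAt
  simp only [ea] at ha
  simp only [eb] at hb
  have hc : dv b w = (dv φ (a w)).comp (dv a w) := by
    rw [← dv_comp (a.loc w).contMDiffAt h.contMDiffAt]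
    exact dv_congr (Filter.Eventually.of_forall fun v => (hab v).symm)
  obtain ⟨ε, hε⟩ := (a.loc w).exists_equiv
  obtain ⟨u, rfl⟩ := ε.surjective v
  have hu : ε u = dv a w u := DFunLike.congr_fun hε u
  have h1 := hb u
  rw [hc, ← hab w] at h1
  rw [hu]
  exact (congrArg (dv φ (a w)) (ha u).symm).trans h1

end SmallCharts

/-! ### Isotropy groups and their bound over a compact set -/

section Isotropy

variable {E : Type*} [NormedAddCommGroup E] [NormedSpace ℝ E] [FiniteDimensional ℝ E]
  {X : Type*} [TopologicalSpace X] {c d : UChart E X}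

/-- The isotropy group of a point of a chart. -/
def UChart.stab (c : UChart E X) (x : c.V) : Set (c.V ≃ₜ c.V) := {g | g ∈ c.G ∧ g x = x}

lemma UChart.finite_stab (c : UChart E X) (x : c.V) : (c.stab x).Finite := by
  have := c.finite
  exact (toFinite (c.G : Set (c.V ≃ₜ c.V))).subset fun g hg => hg.1

/-- Corresponding points have isotropy groups of the same order. -/
lemma Loc.ncard_stab_le {φ : c.V → d.V} {x : c.V} (h : Loc c d φ x) :
    (c.stab x).ncard ≤ (d.stab (φ x)).ncard := by
  -- Conjugation by `φ` sends isotropy elements to isotropy elements; it is injective because a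
  -- group element is determined by its germ.
  have key : ∀ g ∈ c.stab x, ∃ g' ∈ d.stab (φ x), ∀ᶠ w in 𝓝 x, φ (g w) = g' (φ w) := by
    intro g hg
    have h1 : Loc c d φ (g x) := by rwa [hg.2]
    obtain ⟨g', hg', h2⟩ := h.exists_group (h1.comp (loc_of_group hg.1 x))
    refine ⟨g', ⟨hg', ?_⟩, h2⟩
    rw [← h2.self_of_nhds, Function.comp_apply, hg.2]
  choose! ρ hρ hρ' using key
  refine Set.ncard_le_ncard_of_injOn ρ hρ (fun g hg g' hg' he => ?_) (d.finite_stab _)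
  obtain ⟨U, hU, hi, hL⟩ := h.exists_injOn
  refine eq_of_eventually_eq (x := x) hg.1 hg'.1 ?_
  have t1 : ∀ᶠ w in 𝓝 x, g w ∈ U := (g.continuous.tendsto x).eventually (by rwa [hg.2])
  have t2 : ∀ᶠ w in 𝓝 x, g' w ∈ U := (g'.continuous.tendsto x).eventually (by rwa [hg'.2])
  filter_upwards [hρ' g hg, hρ' g' hg', t1, t2] with w h1 h2 h3 h4
  exact hi h3 h4 (by rw [h1, h2, he])

/-- The orders of the isotropy groups over a compact set are bounded. -/
lemma Orbifold.exists_isotropy_bound (O : Orbifold E X) {K : Set X} (hK : IsCompact K) :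
    ∃ M : ℕ, ∀ c ∈ O.charts, ∀ x : c.V, c.π x ∈ K → (c.stab x).ncard ≤ M := by
  choose ch hch hp using O.cover
  obtain ⟨t, -, ht⟩ := hK.elim_nhds_subcover (fun p => (ch p).U) fun p _ =>
    ((ch p).isOpenMap.isOpen_range).mem_nhds (hp p)
  -- An isotropy group is no larger than the whole group of any chart through the point. The sum
  -- over the finitely many covering charts bounds each of these orders.
  refine ⟨∑ p ∈ t, ((ch p).G : Set ((ch p).V ≃ₜ (ch p).V)).ncard, fun c hc x hx => ?_⟩
  obtain ⟨p, hpt, y, hy⟩ := mem_iUnion₂.1 (ht hx)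
  obtain ⟨φ, hφ, rfl⟩ := (O.compatible c hc _ (hch p)).exists_loc hy.symm
  have := (ch p).finite
  calc (c.stab x).ncard ≤ ((ch p).stab (φ x)).ncard := hφ.ncard_stab_le
    _ ≤ ((ch p).G : Set ((ch p).V ≃ₜ (ch p).V)).ncard :=
        Set.ncard_le_ncard (fun g hg => hg.1) (toFinite _)
    _ ≤ _ := Finset.single_le_sum (f := fun p => ((ch p).G : Set ((ch p).V ≃ₜ (ch p).V)).ncard)
        (fun _ _ => Nat.zero_le _) hpt

end Isotropy

end Orb

namespace Orb

/-! ### The `L²` estimate for the Cauchy-Riemann operator -/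

section Carleman

open MeasureTheory

/-- The operator `∂_s + i ∂_t` (twice the Cauchy-Riemann operator). -/
noncomputable def dbar (v : ℂ → ℂ) (z : ℂ) : ℂ :=
  fderiv ℝ v z 1 + Complex.I * fderiv ℝ v z Complex.I

lemma integrable_of_compact {f : ℂ → ℝ} (hf : Continuous f) (hs : HasCompactSupport f) :
    Integrable f := hf.integrable_of_hasCompactSupport hs

/-- Poincaré's inequality: integrating by parts against `re z`, whose derivative in the direction
`1` is `1`, turns `∫ a²` into `-∫ 2 a (∂_s a) re z`. The bound `|re z| ≤ R` on the support and `-2xy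
≤ x² / 2 + 2y²` let half of `∫ a²` be absorbed. -/
lemma integral_sq_le_of_compact {a : ℂ → ℝ} (ha : ContDiff ℝ 2 a) (hs : HasCompactSupport a)
    {R : ℝ} (hR : ∀ z, a z ≠ 0 → ‖z‖ ≤ R) :
    ∫ z, a z ^ 2 ≤ 4 * R ^ 2 * ∫ z, fderiv ℝ a z 1 ^ 2 := by
  have hd : Differentiable ℝ a := ha.differentiable (by simp)
  have hdc : Continuous fun z => fderiv ℝ a z 1 := (ha.continuous_fderiv (by simp)).clm_apply
    continuous_const
  have hds : HasCompactSupport fun z => fderiv ℝ a z 1 := hs.fderiv_apply ℝ 1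
  have hsq : HasCompactSupport fun z => a z ^ 2 := hs.comp_left (g := fun x : ℝ => x ^ 2) (by simp)
  have hd2 : ∀ z, fderiv ℝ (fun z => a z ^ 2) z 1 = 2 * a z * fderiv ℝ a z 1 := by
    intro z
    rw [((hd z).hasFDerivAt.pow 2).fderiv]
    simp
  have i1 : Integrable fun z => a z ^ 2 := integrable_of_compact (ha.continuous.pow 2) hsq
  have i2 : Integrable fun z => fderiv ℝ a z 1 ^ 2 :=
    integrable_of_compact (hdc.pow 2) (hds.comp_left (g := fun x : ℝ => x ^ 2) (by simp))
  have i3 : Integrable fun z : ℂ => 2 * a z * fderiv ℝ a z 1 * z.re :=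
    integrable_of_compact (((continuous_const.mul ha.continuous).mul hdc).mul
      Complex.continuous_re) ((hds.mul_left (f := fun z => 2 * a z)).mul_right)
  have hre : ∀ z, fderiv ℝ Complex.re z 1 = 1 := by
    intro z
    have : fderiv ℝ Complex.re z = Complex.reCLM := Complex.reCLM.hasFDerivAt.fderiv
    rw [this]; simp
  have key := integral_mul_fderiv_eq_neg_fderiv_mul_of_integrable (μ := (volume : Measure ℂ))
    (f := fun z => a z ^ 2) (g := Complex.re) (v := (1 : ℂ)) (by simpa only [hd2] using i3)
    (by simpa only [hre, mul_one] using i1)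
    (integrable_of_compact ((ha.continuous.pow 2).mul Complex.continuous_re) hsq.mul_right)
    (fun z _ => (hd z).pow 2) (fun z _ => Complex.reCLM.differentiableAt)
  simp only [hre, mul_one, hd2] at key
  have h1 : ∫ z, a z ^ 2 ≤ ∫ z, ((1 / 2) * a z ^ 2 + 2 * R ^ 2 * fderiv ℝ a z 1 ^ 2) := by
    rw [key, ← integral_neg]
    refine integral_mono i3.neg ((i1.const_mul _).add (i2.const_mul _)) fun z => ?_
    by_cases hz : a z = 0
    · simp [hz]; positivity
    · have h2 := (Complex.abs_re_le_norm z).trans (hR z hz)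
      have h3 : z.re ^ 2 ≤ R ^ 2 := by
        rw [← sq_abs]; exact pow_le_pow_left₀ (abs_nonneg _) h2 2
      have h4 : (fderiv ℝ a z 1) ^ 2 * z.re ^ 2 ≤ (fderiv ℝ a z 1) ^ 2 * R ^ 2 :=
        mul_le_mul_of_nonneg_left h3 (sq_nonneg _)
      show -(2 * a z * fderiv ℝ a z 1 * z.re) ≤ 1 / 2 * a z ^ 2 + 2 * R ^ 2 * fderiv ℝ a z 1 ^ 2
      nlinarith [sq_nonneg (a z + 2 * (fderiv ℝ a z 1 * z.re))]
  rw [integral_add (i1.const_mul _) (i2.const_mul _), integral_const_mul, integral_const_mul] at h1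
  linarith

/-- The Jacobian is a divergence: after integrating each side by parts, the difference is governed
by the mixed second derivatives of `a`, which are symmetric. -/
lemma integral_jacobian {a b : ℂ → ℝ} (ha : ContDiff ℝ 2 a) (hb : ContDiff ℝ 2 b)
    (hsa : HasCompactSupport a) (hsb : HasCompactSupport b) :
    ∫ z, fderiv ℝ a z 1 * fderiv ℝ b z Complex.I = ∫ z, fderiv ℝ a z Complex.I * fderiv ℝ b z 1 := by
  have hdb : Differentiable ℝ b := hb.differentiable (by simp)
  have h1 : ∀ v : ℂ, ContDiff ℝ 1 fun z => fderiv ℝ a z v := fun v =>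
    (ha.fderiv_right (by norm_num)).clm_apply contDiff_const
  have h1' : ∀ v : ℂ, Continuous fun z => fderiv ℝ b z v := fun v =>
    (hb.continuous_fderiv (by simp)).clm_apply continuous_const
  have h2 : ∀ v u : ℂ, Continuous fun z => fderiv ℝ (fun z => fderiv ℝ a z v) z u := fun v u =>
    ((h1 v).continuous_fderiv (by simp)).clm_apply continuous_const
  have key : ∀ v u : ℂ, ∫ z, fderiv ℝ a z v * fderiv ℝ b z u =
      - ∫ z, fderiv ℝ (fun z => fderiv ℝ a z v) z u * b z := fun v u =>
    integral_mul_fderiv_eq_neg_fderiv_mul_of_integrable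
      (integrable_of_compact ((h2 v u).mul hb.continuous) hsb.mul_left)
      (integrable_of_compact ((h1 v).continuous.mul (h1' u)) (hsa.fderiv_apply ℝ v).mul_right)
      (integrable_of_compact ((h1 v).continuous.mul hb.continuous) hsb.mul_left)
      (fun z _ => (h1 v).differentiable (by simp) z) (fun z _ => hdb z)
  rw [key, key]
  congr 2
  ext z
  congr 1
  have hsym := (ha.contDiffAt (x := z)).isSymmSndFDerivAt (by simp)
  have hdd : DifferentiableAt ℝ (fderiv ℝ a) z :=
    ((ha.fderiv_right (m := 1) (by norm_num)).differentiable (by simp)) z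
  have e : ∀ v u : ℂ, fderiv ℝ (fun z => fderiv ℝ a z v) z u = fderiv ℝ (fderiv ℝ a) z u v := by
    intro v u
    rw [(hdd.hasFDerivAt.clm_apply (hasFDerivAt_const v z)).fderiv]
    simp
  rw [e, e]
  exact hsym _ _

/-- The `L²` estimate for the Cauchy-Riemann operator on functions with compact support. -/
lemma integral_norm_sq_le_dbar {v : ℂ → ℂ} (hv : ContDiff ℝ 2 v) (hs : HasCompactSupport v)
    {R : ℝ} (hR : ∀ z, v z ≠ 0 → ‖z‖ ≤ R) :
    ∫ z, ‖v z‖ ^ 2 ≤ 4 * R ^ 2 * ∫ z, ‖dbar v z‖ ^ 2 := by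
  let a : ℂ → ℝ := fun z => (v z).re
  let b : ℂ → ℝ := fun z => (v z).im
  have ha : ContDiff ℝ 2 a := Complex.reCLM.contDiff.comp hv
  have hb : ContDiff ℝ 2 b := Complex.imCLM.contDiff.comp hv
  have hsa : HasCompactSupport a := hs.comp_left (g := Complex.re) rfl
  have hsb : HasCompactSupport b := hs.comp_left (g := Complex.im) rfl
  have hda : ∀ z u, fderiv ℝ a z u = (fderiv ℝ v z u).re := by
    intro z u
    have h := (Complex.reCLM.hasFDerivAt (x := v z)).comp z (hv.differentiable (by simp) z).hasFDerivAt
    have h' : fderiv ℝ a z = _ := h.fderiv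
    rw [h']; rfl
  have hdb : ∀ z u, fderiv ℝ b z u = (fderiv ℝ v z u).im := by
    intro z u
    have h := (Complex.imCLM.hasFDerivAt (x := v z)).comp z (hv.differentiable (by simp) z).hasFDerivAt
    have h' : fderiv ℝ b z = _ := h.fderiv
    rw [h']; rfl
  have ca : ∀ u : ℂ, Continuous fun z => fderiv ℝ a z u := fun u =>
    (ha.continuous_fderiv (by simp)).clm_apply continuous_const
  have cb : ∀ u : ℂ, Continuous fun z => fderiv ℝ b z u := fun u =>
    (hb.continuous_fderiv (by simp)).clm_apply continuous_const
  have sa : ∀ u : ℂ, HasCompactSupport fun z => fderiv ℝ a z u := fun u => hsa.fderiv_apply ℝ u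
  have sb : ∀ u : ℂ, HasCompactSupport fun z => fderiv ℝ b z u := fun u => hsb.fderiv_apply ℝ u
  have isq : ∀ {f : ℂ → ℝ}, Continuous f → HasCompactSupport f → Integrable fun z => f z ^ 2 := by
    intro f hf hfs
    exact integrable_of_compact (hf.pow 2) (hfs.comp_left (g := fun x : ℝ => x ^ 2) (by simp))
  have h1 := integral_sq_le_of_compact ha hsa (R := R) fun z hz => hR z fun h => hz (by simp [a, h])
  have h2 := integral_sq_le_of_compact hb hsb (R := R) fun z hz => hR z fun h => hz (by simp [b, h])
  have h3 := integral_jacobian ha hb hsa hsb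
  have e1 : ∀ z, ‖v z‖ ^ 2 = a z ^ 2 + b z ^ 2 := fun z => by
    rw [Complex.sq_norm, Complex.normSq_apply]; ring
  -- The squared norm is the full energy of `a` and `b` minus twice the Jacobian of `(a, b)`, and
  -- the latter integrates to zero.
  have e2 : ∀ z, ‖dbar v z‖ ^ 2 = (fderiv ℝ a z 1 ^ 2 + fderiv ℝ b z 1 ^ 2) +
      (fderiv ℝ a z Complex.I ^ 2 + fderiv ℝ b z Complex.I ^ 2) +
      (2 * (fderiv ℝ a z Complex.I * fderiv ℝ b z 1) -
        2 * (fderiv ℝ a z 1 * fderiv ℝ b z Complex.I)) := fun z => by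
    rw [Complex.sq_norm, Complex.normSq_apply, dbar, hda, hda, hdb, hdb]
    simp
    ring
  have iA1 := isq (ca 1) (sa 1)
  have iAI := isq (ca Complex.I) (sa Complex.I)
  have iB1 := isq (cb 1) (sb 1)
  have iBI := isq (cb Complex.I) (sb Complex.I)
  have iX : Integrable fun z => fderiv ℝ a z Complex.I * fderiv ℝ b z 1 :=
    integrable_of_compact ((ca _).mul (cb _)) (sa _).mul_right
  have iY : Integrable fun z => fderiv ℝ a z 1 * fderiv ℝ b z Complex.I :=
    integrable_of_compact ((ca _).mul (cb _)) (sa _).mul_right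
  have l1 : ∫ z, ‖v z‖ ^ 2 = (∫ z, a z ^ 2) + ∫ z, b z ^ 2 := by
    simp_rw [e1]
    exact integral_add (isq ha.continuous hsa) (isq hb.continuous hsb)
  have l2 : ∫ z, ‖dbar v z‖ ^ 2 = ((∫ z, fderiv ℝ a z 1 ^ 2) + ∫ z, fderiv ℝ b z 1 ^ 2) +
      ((∫ z, fderiv ℝ a z Complex.I ^ 2) + ∫ z, fderiv ℝ b z Complex.I ^ 2) := by
    simp_rw [e2]
    have j1 : Integrable fun z => fderiv ℝ a z 1 ^ 2 + fderiv ℝ b z 1 ^ 2 := iA1.add iB1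
    have j2 : Integrable fun z => fderiv ℝ a z Complex.I ^ 2 + fderiv ℝ b z Complex.I ^ 2 :=
      iAI.add iBI
    have j3 : Integrable fun z => (fderiv ℝ a z 1 ^ 2 + fderiv ℝ b z 1 ^ 2) +
      (fderiv ℝ a z Complex.I ^ 2 + fderiv ℝ b z Complex.I ^ 2) := j1.add j2
    have j4 : Integrable fun z => 2 * (fderiv ℝ a z Complex.I * fderiv ℝ b z 1) -
        2 * (fderiv ℝ a z 1 * fderiv ℝ b z Complex.I) := (iX.const_mul 2).sub (iY.const_mul 2)
    rw [integral_add j3 j4, integral_add j1 j2, integral_add iA1 iB1, integral_add iAI iBI,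
      integral_sub (iX.const_mul 2) (iY.const_mul 2), integral_const_mul, integral_const_mul, h3]
    ring
  have p1 : 0 ≤ ∫ z, fderiv ℝ a z Complex.I ^ 2 := integral_nonneg fun z => sq_nonneg _
  have p2 : 0 ≤ ∫ z, fderiv ℝ b z Complex.I ^ 2 := integral_nonneg fun z => sq_nonneg _
  rw [l1, l2]
  nlinarith [mul_nonneg (sq_nonneg R) p1, mul_nonneg (sq_nonneg R) p2]

end Carleman

end Orb

namespace Orb

/-! ### Unique continuation for Cauchy-Riemann differential inequalities -/

section UniqueContinuation

open MeasureTheory Metric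

lemma dbar_congr {v u : ℂ → ℂ} {z : ℂ} (h : v =ᶠ[𝓝 z] u) : dbar v z = dbar u z := by
  rw [dbar, dbar, h.fderiv_eq]

lemma dbar_of_eventually_zero {v : ℂ → ℂ} {z : ℂ} (h : ∀ᶠ y in 𝓝 z, v y = 0) : dbar v z = 0 := by
  rw [dbar_congr (u := fun _ => 0) h]
  simp [dbar]

/-- Multiplication by a holomorphic function commutes with the Cauchy-Riemann operator. -/
lemma dbar_mul_holomorphic {h v : ℂ → ℂ} {z : ℂ} (hh : DifferentiableAt ℂ h z)
    (hv : DifferentiableAt ℝ v z) : dbar (fun y => h y * v y) z = h z * dbar v z := by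
  have h1 : HasFDerivAt h ((fderiv ℂ h z).restrictScalars ℝ) z :=
    hh.hasFDerivAt.restrictScalars ℝ
  have h2 := (h1.mul hv.hasFDerivAt).fderiv
  have h3 : fderiv ℝ (fun y => h y * v y) z = _ := h2
  rw [dbar, dbar, h3]
  have h4 : fderiv ℂ h z Complex.I = Complex.I * fderiv ℂ h z 1 := by
    rw [← smul_eq_mul, ← map_smul]; simp
  simp only [add_apply, smul_apply, smul_eq_mul,
    ContinuousLinearMap.coe_restrictScalars', h4]
  linear_combination (v z * fderiv ℂ h z 1) * Complex.I_mul_I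

/-- Carleman's argument: a family of functions satisfying a differential inequality for the
Cauchy-Riemann operator on a small disc vanishes if it vanishes near the centre. -/
lemma eq_zero_of_dbar_le {ι : Type*} [Fintype ι] {w : ι → ℂ → ℂ} {R K : ℝ}
    (hw : ∀ a, ContDiffOn ℝ 2 (w a) (ball 0 R)) (h0 : ∀ a, ∀ᶠ z in 𝓝 0, w a z = 0)
    (hK : ∀ z ∈ ball (0 : ℂ) R, ∑ a, ‖dbar (w a) z‖ ^ 2 ≤ K ^ 2 * ∑ a, ‖w a z‖ ^ 2)
    (hKR : 8 * R ^ 2 * K ^ 2 ≤ 1) : ∀ z ∈ ball (0 : ℂ) R, ∀ a, w a z = 0 := by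
  intro z hz
  rw [mem_ball_zero_iff] at hz
  have hR : 0 < R := (norm_nonneg z).trans_lt hz
  obtain ⟨r, hzr, hrR⟩ := exists_between hz
  obtain ⟨r₁, hr1, hr1R⟩ := exists_between hrR
  obtain ⟨r₂, hr2, hr2R⟩ := exists_between hr1R
  have hr0 : 0 < r := (norm_nonneg z).trans_lt hzr
  have hr10 : 0 < r₁ := hr0.trans hr1
  -- Cutting off creates an error only where `‖z‖ ≥ r₁`, while vanishing is tested on `‖z‖ < r`.
  -- With the weight `z ^ (-n)` the error loses by the factor `(r / r₁) ^ n`, in norm.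
  let χ : ContDiffBump (0 : ℂ) := ⟨r₁, r₂, hr10, hr2⟩
  let u : ι → ℂ → ℂ := fun a z => (χ z : ℂ) * w a z
  have hχ : ContDiff ℝ 2 fun z => (χ z : ℂ) := Complex.ofRealCLM.contDiff.comp χ.contDiff
  have hχ0 : ∀ z, r₂ ≤ ‖z‖ → χ z = 0 := fun z hz => by
    have := χ.support_eq
    by_contra h
    have h2 : z ∈ Function.support χ := h
    rw [this, mem_ball_zero_iff] at h2
    exact absurd h2 (not_lt.2 hz)
  have hu : ∀ a, ContDiff ℝ 2 (u a) := by
    intro a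
    rw [contDiff_iff_contDiffAt]
    intro z
    by_cases hz : z ∈ ball (0 : ℂ) R
    · exact hχ.contDiffAt.mul ((hw a).contDiffAt (isOpen_ball.mem_nhds hz))
    · have : ∀ᶠ y in 𝓝 z, u a y = 0 := by
        have : ∀ᶠ y : ℂ in 𝓝 z, r₂ < ‖y‖ := by
          refine (continuous_norm.tendsto z).eventually (lt_mem_nhds ?_)
          rw [mem_ball_zero_iff, not_lt] at hz
          exact hr2R.trans_le hz
        filter_upwards [this] with y hy
        simp [u, hχ0 y hy.le]
      exact contDiffAt_const.congr_of_eventuallyEq this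
  have huR : ∀ a z, u a z ≠ 0 → ‖z‖ < R := fun a z h => by
    by_contra h2
    exact h (by simp [u, hχ0 z (hr2R.le.trans (not_lt.1 h2))])
  have hus : ∀ a, HasCompactSupport (u a) := fun a =>
    HasCompactSupport.intro (isCompact_closedBall 0 R) fun z hz => by
      by_contra h
      exact hz (mem_closedBall_zero_iff.2 (huR a z h).le)
  have hu1 : ∀ a, ∀ z, ‖z‖ < r₁ → ∀ᶠ y in 𝓝 z, u a y = w a y := by
    intro a z hz
    filter_upwards [isOpen_ball.mem_nhds (mem_ball_zero_iff.2 hz)] with y hy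
    have : χ y = 1 := χ.one_of_mem_closedBall (ball_subset_closedBall hy)
    simp [u, this]
  have hu0 : ∀ a, ∀ᶠ z in 𝓝 0, u a z = 0 := fun a => (h0 a).mono fun z hz => by simp [u, hz]
  have hdbc : ∀ {v : ℂ → ℂ}, ContDiff ℝ 2 v → Continuous (dbar v) := by
    intro v hv
    exact ((hv.continuous_fderiv (by simp)).clm_apply continuous_const).add
      (continuous_const.mul ((hv.continuous_fderiv (by simp)).clm_apply continuous_const))
  -- a bound for the error term
  obtain ⟨C, hC⟩ : ∃ C, ∀ z, ∑ a, ‖dbar (u a) z‖ ^ 2 ≤ C := by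
    have hc : Continuous fun z => ∑ a, ‖dbar (u a) z‖ ^ 2 :=
      continuous_finsetSum _ fun a _ => (hdbc (hu a)).norm.pow 2
    obtain ⟨C, hC⟩ := (isCompact_closedBall (0 : ℂ) R).exists_bound_of_continuousOn hc.continuousOn
    refine ⟨max C 0, fun z => ?_⟩
    by_cases hz : z ∈ closedBall (0 : ℂ) R
    · exact (le_abs_self _).trans ((hC z hz).trans (le_max_left _ _))
    · have : ∀ a, dbar (u a) z = 0 := fun a => dbar_of_eventually_zero <| by
        filter_upwards [isClosed_closedBall.isOpen_compl.mem_nhds hz] with y hy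
        by_contra h
        exact hy (mem_closedBall_zero_iff.2 (huR a y h).le)
      simp [this]
  have hC0 : 0 ≤ C := le_trans (Finset.sum_nonneg fun a _ => sq_nonneg _) (hC 0)
  -- the weighted functions
  let v : ℕ → ι → ℂ → ℂ := fun n a z => (z ^ n)⁻¹ * u a z
  -- The pole of the weight is harmless because `u a` vanishes near `0`.
  have hv : ∀ n a, ContDiff ℝ 2 (v n a) := by
    intro n a
    rw [contDiff_iff_contDiffAt]
    intro z
    by_cases hz : z = 0
    · rw [hz]
      exact contDiffAt_const (c := (0 : ℂ)) |>.congr_of_eventuallyEq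
        ((hu0 a).mono fun y hy => by simp [v, hy])
    · exact ((contDiffAt_id.pow n).inv (pow_ne_zero n hz)).mul (hu a).contDiffAt
  have hvs : ∀ n a, HasCompactSupport (v n a) := fun n a => (hus a).mul_left
  have hdv : ∀ n a z, dbar (v n a) z = (z ^ n)⁻¹ * dbar (u a) z := by
    intro n a z
    by_cases hz : z = 0
    · rw [hz, dbar_of_eventually_zero ((hu0 a).mono fun y hy => by simp [v, hy]),
        dbar_of_eventually_zero (hu0 a), mul_zero]
    · exact dbar_mul_holomorphic ((differentiableAt_id.pow n).inv (pow_ne_zero n hz))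
        ((hu a).differentiable (by simp) z)
  have iv : ∀ n a, Integrable fun z => ‖v n a z‖ ^ 2 := fun n a =>
    integrable_of_compact ((hv n a).continuous.norm.pow 2)
      ((hvs n a).comp_left (g := fun x : ℂ => ‖x‖ ^ 2) (by simp))
  have hdvs : ∀ n a, HasCompactSupport (dbar (v n a)) := fun n a =>
    (((hvs n a).fderiv_apply ℝ 1).add ((hvs n a).fderiv_apply ℝ Complex.I).mul_left)
  have idv : ∀ n a, Integrable fun z => ‖dbar (v n a) z‖ ^ 2 := fun n a =>
    integrable_of_compact ((hdbc (hv n a)).norm.pow 2)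
      ((hdvs n a).comp_left (g := fun x : ℂ => ‖x‖ ^ 2) (by simp))
  let S : ℕ → ℝ := fun n => ∫ z, ∑ a, ‖v n a z‖ ^ 2
  have iS : ∀ n, Integrable fun z => ∑ a, ‖v n a z‖ ^ 2 := fun n =>
    integrable_finsetSum _ fun a _ => iv n a
  have ind : Integrable ((ball (0 : ℂ) R).indicator fun _ => (1 : ℝ)) :=
    (integrable_indicator_iff measurableSet_ball).2 (integrableOn_const (measure_ball_lt_top.ne))
  let B : ℝ := ∫ z, (ball (0 : ℂ) R).indicator (fun _ => (1 : ℝ)) z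
  -- For `‖z‖ < r₁` the cut-off is invisible and the differential inequality applies; for `r₁ ≤ ‖z‖
  -- < R` the weight is at most `r₁⁻¹ ^ n`; for `‖z‖ ≥ R` everything vanishes.
  have hpt : ∀ n z, ∑ a, ‖dbar (v n a) z‖ ^ 2 ≤ K ^ 2 * ∑ a, ‖v n a z‖ ^ 2 +
      C * (r₁⁻¹ ^ n) ^ 2 * (ball (0 : ℂ) R).indicator (fun _ => (1 : ℝ)) z := by
    intro n z
    simp only [hdv, v, norm_mul, mul_pow, ← Finset.mul_sum]
    have hnn : 0 ≤ C * (r₁⁻¹ ^ n) ^ 2 * (ball (0 : ℂ) R).indicator (fun _ => (1 : ℝ)) z :=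
      mul_nonneg (mul_nonneg hC0 (sq_nonneg _)) (indicator_nonneg (fun _ _ => zero_le_one) _)
    by_cases h1 : ‖z‖ < r₁
    · have e1 : ∀ a, dbar (u a) z = dbar (w a) z := fun a => dbar_congr (hu1 a z h1)
      have e2 : ∀ a, u a z = w a z := fun a => (hu1 a z h1).self_of_nhds
      simp only [e1, e2]
      have := hK z (mem_ball_zero_iff.2 (h1.trans hr1R))
      have h3 := mul_le_mul_of_nonneg_left this (sq_nonneg ‖(z ^ n)⁻¹‖)
      linarith
    · by_cases h2 : ‖z‖ < R
      · rw [indicator_of_mem (mem_ball_zero_iff.2 h2), mul_one]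
        have h3 : ‖(z ^ n)⁻¹‖ ≤ r₁⁻¹ ^ n := by
          rw [norm_inv, norm_pow, inv_pow]
          exact inv_anti₀ (by positivity) (pow_le_pow_left₀ hr10.le (not_lt.1 h1) n)
        have h4 : ‖(z ^ n)⁻¹‖ ^ 2 ≤ (r₁⁻¹ ^ n) ^ 2 := pow_le_pow_left₀ (norm_nonneg _) h3 2
        have h5 := mul_le_mul h4 (hC z) (Finset.sum_nonneg fun a _ => sq_nonneg _) (sq_nonneg _)
        have h6 : 0 ≤ K ^ 2 * (‖(z ^ n)⁻¹‖ ^ 2 * ∑ i, ‖u i z‖ ^ 2) :=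
          mul_nonneg (sq_nonneg _) (mul_nonneg (sq_nonneg _)
            (Finset.sum_nonneg fun a _ => sq_nonneg _))
        linarith
      · have : ∀ a, dbar (u a) z = 0 := fun a => dbar_of_eventually_zero <| by
          have : ∀ᶠ y : ℂ in 𝓝 z, r₂ < ‖y‖ :=
            (continuous_norm.tendsto z).eventually (lt_mem_nhds (hr2R.trans_le (not_lt.1 h2)))
          filter_upwards [this] with y hy
          simp [u, hχ0 y hy.le]
        have h6 : 0 ≤ K ^ 2 * (‖(z ^ n)⁻¹‖ ^ 2 * ∑ i, ‖u i z‖ ^ 2) :=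
          mul_nonneg (sq_nonneg _) (mul_nonneg (sq_nonneg _)
            (Finset.sum_nonneg fun a _ => sq_nonneg _))
        simp only [this, norm_zero]
        simp
        simp at h6 hnn
        linarith
  have hS : ∀ n, S n ≤ 8 * R ^ 2 * C * B * (r₁⁻¹ ^ n) ^ 2 := by
    intro n
    have e1 : S n = ∑ a, ∫ z, ‖v n a z‖ ^ 2 := integral_finsetSum _ fun a _ => iv n a
    have e2 : S n ≤ 4 * R ^ 2 * ∫ z, ∑ a, ‖dbar (v n a) z‖ ^ 2 := by
      rw [e1, integral_finsetSum _ fun a _ => idv n a, Finset.mul_sum]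
      refine Finset.sum_le_sum fun a _ => integral_norm_sq_le_dbar (hv n a) (hvs n a) fun z hz => ?_
      exact (huR a z fun h => hz (by simp [v, h])).le
    have e3 : ∫ z, ∑ a, ‖dbar (v n a) z‖ ^ 2 ≤ K ^ 2 * S n + C * (r₁⁻¹ ^ n) ^ 2 * B := by
      have := integral_mono (integrable_finsetSum _ fun a _ => idv n a)
        (((iS n).const_mul (K ^ 2)).add (ind.const_mul (C * (r₁⁻¹ ^ n) ^ 2))) (hpt n)
      refine this.trans_eq ?_
      rw [integral_add' ((iS n).const_mul (K ^ 2)) (ind.const_mul (C * (r₁⁻¹ ^ n) ^ 2)),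
        integral_const_mul, integral_const_mul]
    have e4 : 0 ≤ S n := integral_nonneg fun z => Finset.sum_nonneg fun a _ => sq_nonneg _
    -- Smallness of `R` allows half of `S n` to be absorbed on the left.
    have e5 : 4 * R ^ 2 * K ^ 2 * S n ≤ 1 / 2 * S n :=
      mul_le_mul_of_nonneg_right (by linarith) e4
    have e6 := mul_le_mul_of_nonneg_left e3 (by positivity : (0 : ℝ) ≤ 4 * R ^ 2)
    nlinarith
  -- the weights blow up inside
  let T : ℝ := ∫ z in ball (0 : ℂ) r, ∑ a, ‖u a z‖ ^ 2
  have icT : Continuous fun z => ∑ a, ‖u a z‖ ^ 2 :=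
    continuous_finsetSum _ fun a _ => ((hu a).continuous.norm.pow 2)
  have iT : IntegrableOn (fun z => ∑ a, ‖u a z‖ ^ 2) (ball (0 : ℂ) r) :=
    (icT.continuousOn.integrableOn_compact (isCompact_closedBall 0 r)).mono_set ball_subset_closedBall
  have hT : ∀ n, T ≤ 8 * R ^ 2 * C * B * ((r / r₁) ^ n) ^ 2 := by
    intro n
    have e1 : T ≤ ∫ z in ball (0 : ℂ) r, (r ^ n) ^ 2 * ∑ a, ‖v n a z‖ ^ 2 := by
      refine setIntegral_mono_on iT ((iS n).integrableOn.const_mul _) measurableSet_ball ?_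
      intro z hz
      rw [Finset.mul_sum]
      refine Finset.sum_le_sum fun a _ => ?_
      by_cases hz0 : z = 0
      · have h1 : (0 : ℝ) ≤ (r ^ n) ^ 2 * ‖v n a z‖ ^ 2 := by positivity
        have h2 : u a z = 0 := by rw [hz0]; exact (hu0 a).self_of_nhds
        rw [h2]
        simpa using h1
      · have : u a z = z ^ n * v n a z := by
          simp only [v]
          rw [mul_inv_cancel_left₀ (pow_ne_zero n hz0)]
        rw [this, norm_mul, mul_pow, norm_pow]
        refine mul_le_mul_of_nonneg_right ?_ (sq_nonneg _)
        exact pow_le_pow_left₀ (by positivity) (pow_le_pow_left₀ (norm_nonneg _)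
          (mem_ball_zero_iff.1 hz).le n) 2
    have e2 : ∫ z in ball (0 : ℂ) r, (r ^ n) ^ 2 * ∑ a, ‖v n a z‖ ^ 2 ≤ (r ^ n) ^ 2 * S n := by
      rw [integral_const_mul]
      refine mul_le_mul_of_nonneg_left ?_ (sq_nonneg _)
      exact setIntegral_le_integral (iS n) (Filter.Eventually.of_forall fun z =>
        Finset.sum_nonneg fun a _ => sq_nonneg _)
    have e3 := mul_le_mul_of_nonneg_left (hS n) (sq_nonneg (r ^ n))
    have e4 : (r ^ n) ^ 2 * (8 * R ^ 2 * C * B * (r₁⁻¹ ^ n) ^ 2) =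
        8 * R ^ 2 * C * B * ((r / r₁) ^ n) ^ 2 := by
      rw [div_eq_mul_inv, mul_pow, mul_pow]; ring
    linarith
  have hlim : Filter.Tendsto (fun n : ℕ => 8 * R ^ 2 * C * B * ((r / r₁) ^ n) ^ 2)
      Filter.atTop (𝓝 0) := by
    have h1 : Filter.Tendsto (fun n : ℕ => (r / r₁) ^ n) Filter.atTop (𝓝 0) :=
      tendsto_pow_atTop_nhds_zero_of_lt_one (by positivity) ((div_lt_one hr10).2 hr1)
    simpa using (h1.pow 2).const_mul (8 * R ^ 2 * C * B)
  have hT0 : T ≤ 0 := ge_of_tendsto' hlim hT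
  have hT1 : T = 0 := le_antisymm hT0 (setIntegral_nonneg measurableSet_ball fun z _ =>
    Finset.sum_nonneg fun a _ => sq_nonneg _)
  have hae := (setIntegral_eq_zero_iff_of_nonneg_ae (Filter.Eventually.of_forall fun z =>
    Finset.sum_nonneg fun a _ => sq_nonneg _) iT).1 hT1
  have hz1 : ∑ a, ‖u a z‖ ^ 2 = 0 := by
    have := Measure.eqOn_open_of_ae_eq hae isOpen_ball icT.continuousOn continuousOn_const
    exact this (mem_ball_zero_iff.2 hzr)
  intro a
  have := (Finset.sum_eq_zero_iff_of_nonneg (fun a _ => sq_nonneg _)).1 hz1 a (Finset.mem_univ a)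
  have h2 : u a z = 0 := by simpa using this
  rw [← (hu1 a z (hzr.trans hr1)).self_of_nhds, h2]

/-- Local unique continuation for differential inequalities of Cauchy-Riemann type. -/
lemma eventually_zero_of_dbar_le {ι : Type*} [Fintype ι] {w : ι → ℂ → ℂ} {ρ K : ℝ} {p : ℂ}
    (hρ : 0 < ρ) (hw : ∀ a, ContDiffOn ℝ 2 (w a) (ball p ρ))
    (hK : ∀ z ∈ ball p ρ, ∑ a, ‖dbar (w a) z‖ ^ 2 ≤ K ^ 2 * ∑ a, ‖w a z‖ ^ 2)
    (h0 : ∃ᶠ z in 𝓝 p, ∀ a, ∀ᶠ y in 𝓝 z, w a y = 0) : ∀ᶠ z in 𝓝 p, ∀ a, w a z = 0 := by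
  -- The disc of radius `R` is recentred at a point `z₀` within `R` of `p` near which all functions
  -- vanish: it contains `p`, and `2 * R ≤ ρ` keeps it inside the original disc.
  obtain ⟨R, hR0, hRρ, hRK⟩ : ∃ R : ℝ, 0 < R ∧ 2 * R ≤ ρ ∧ 8 * R ^ 2 * K ^ 2 ≤ 1 := by
    refine ⟨min (ρ / 2) (1 / (4 * (|K| + 1))), by positivity, ?_, ?_⟩
    · linarith [min_le_left (ρ / 2) (1 / (4 * (|K| + 1)))]
    · have h1 : 0 ≤ min (ρ / 2) (1 / (4 * (|K| + 1))) := by positivity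
      have h2 := min_le_right (ρ / 2) (1 / (4 * (|K| + 1)))
      generalize min (ρ / 2) (1 / (4 * (|K| + 1))) = R at h1 h2
      have h3 : R * (4 * (|K| + 1)) ≤ 1 := by
        rwa [le_div_iff₀ (by positivity)] at h2
      have h4 : R * |K| ≤ 1 / 4 := by nlinarith [abs_nonneg K]
      have h5 : (R * |K|) ^ 2 ≤ (1 / 4) ^ 2 := pow_le_pow_left₀ (by positivity) h4 2
      rw [mul_pow, sq_abs] at h5
      nlinarith
  obtain ⟨z₀, hz₀, hz₀p⟩ := (h0.and_eventually (ball_mem_nhds p hR0)).exists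
  have hsub : ∀ z ∈ ball (0 : ℂ) R, z₀ + z ∈ ball p ρ := by
    intro z hz
    rw [dist_eq_norm] at hz₀p
    rw [mem_ball, dist_eq_norm]
    rw [mem_ball_zero_iff] at hz
    calc ‖z₀ + z - p‖ = ‖(z₀ - p) + z‖ := by ring_nf
      _ ≤ ‖z₀ - p‖ + ‖z‖ := norm_add_le _ _
      _ < ρ := by linarith
  have hd : ∀ a z, dbar (fun y => w a (z₀ + y)) z = dbar (w a) (z₀ + z) := by
    intro a z
    rw [dbar, dbar, fderiv_comp_add_left]
  have key := eq_zero_of_dbar_le (w := fun a z => w a (z₀ + z)) (R := R) (K := K)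
    (fun a => (hw a).comp (contDiff_const.add contDiff_id).contDiffOn hsub)
    (fun a => by
      have h1 : Filter.Tendsto (fun z : ℂ => z₀ + z) (𝓝 0) (𝓝 z₀) := by
        have := (continuous_const_add z₀).tendsto (0 : ℂ)
        rwa [add_zero] at this
      exact h1.eventually (hz₀ a))
    (fun z hz => by simpa only [hd] using hK _ (hsub z hz)) hRK
  filter_upwards [isOpen_ball.mem_nhds (mem_ball'.2 hz₀p : p ∈ ball z₀ R)] with z hz a
  have := key (z - z₀) (by rwa [mem_ball_zero_iff, ← dist_eq_norm]) a
  simpa using this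

end UniqueContinuation

end Orb

namespace Orb

/-! ### Unique continuation for pseudo-holomorphic curves -/

section JHolomorphic

open Metric

variable {E : Type*} [NormedAddCommGroup E] [NormedSpace ℝ E] [FiniteDimensional ℝ E]

/-- Complex valued functionals that are complex linear with respect to `J₀` and separate points. -/
lemma exists_complex_functionals (J₀ : E →L[ℝ] E) (hJ : ∀ v, J₀ (J₀ v) = -v) :
    ∃ (n : ℕ) (l : Fin n → E →L[ℝ] ℂ) (C : ℝ), (∀ a v, l a (J₀ v) = Complex.I * l a v) ∧
      ∀ v, ‖v‖ ^ 2 ≤ C ^ 2 * ∑ a, ‖l a v‖ ^ 2 := by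
  let b := Module.finBasis ℝ E
  let e : Fin (Module.finrank ℝ E) → E →L[ℝ] ℝ := fun a => LinearMap.toContinuousLinearMap (b.coord a)
  -- The complex linear functional for `J₀` whose real part is the coordinate `e a`.
  let l : Fin (Module.finrank ℝ E) → E →L[ℝ] ℂ := fun a =>
    Complex.ofRealCLM.comp (e a) - Complex.I • (Complex.ofRealCLM.comp ((e a).comp J₀))
  have hl : ∀ a v, l a v = (e a v : ℂ) - Complex.I * (e a (J₀ v) : ℂ) := fun a v => rfl
  let Φ : E →L[ℝ] (Fin (Module.finrank ℝ E) → ℂ) := ContinuousLinearMap.pi l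
  have hinj : Function.Injective Φ := by
    rw [injective_iff_map_eq_zero]
    intro v hv
    refine b.ext_elem fun a => ?_
    have h1 : l a v = 0 := congrFun hv a
    rw [hl] at h1
    have h2 := congrArg Complex.re h1
    simpa [e] using h2
  obtain ⟨K, -, hK⟩ := Φ.toLinearMap.exists_antilipschitzWith (LinearMap.ker_eq_bot.2 hinj)
  refine ⟨_, l, K, fun a v => ?_, fun v => ?_⟩
  · rw [hl, hl, hJ, map_neg]
    push_cast
    linear_combination (e a (J₀ v) : ℂ) * Complex.I_mul_I
  · have h1 : ‖v‖ ≤ K * ‖Φ v‖ := by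
      have := hK.le_mul_dist v 0
      simpa using this
    have h2 : ‖Φ v‖ ^ 2 ≤ ∑ a, ‖l a v‖ ^ 2 := by
      have h3 : ‖Φ v‖ ≤ Real.sqrt (∑ a, ‖l a v‖ ^ 2) := by
        rw [pi_norm_le_iff_of_nonneg (Real.sqrt_nonneg _)]
        intro a
        refine Real.le_sqrt_of_sq_le ?_
        exact Finset.single_le_sum (f := fun a => ‖l a v‖ ^ 2) (fun _ _ => sq_nonneg _)
          (Finset.mem_univ a)
      calc ‖Φ v‖ ^ 2 ≤ Real.sqrt (∑ a, ‖l a v‖ ^ 2) ^ 2 :=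
            pow_le_pow_left₀ (norm_nonneg _) h3 2
        _ = _ := Real.sq_sqrt (Finset.sum_nonneg fun _ _ => sq_nonneg _)
    calc ‖v‖ ^ 2 ≤ (K * ‖Φ v‖) ^ 2 := pow_le_pow_left₀ (norm_nonneg _) h1 2
      _ = (K : ℝ) ^ 2 * ‖Φ v‖ ^ 2 := by ring
      _ ≤ _ := mul_le_mul_of_nonneg_left h2 (sq_nonneg _)

/-- Local unique continuation for pseudo-holomorphic curves. -/
lemma eventually_eq_of_jholomorphic {J : E → E →L[ℝ] E} {v₁ v₂ : ℂ → E} {p : ℂ}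
    (hJ : ContDiffAt ℝ 2 J (v₁ p)) (hJ2 : ∀ᶠ x in 𝓝 (v₁ p), ∀ v, J x (J x v) = -v)
    (h₁ : ContDiffAt ℝ 2 v₁ p) (h₂ : ContDiffAt ℝ 2 v₂ p)
    (e₁ : ∀ᶠ z in 𝓝 p, fderiv ℝ v₁ z Complex.I = J (v₁ z) (fderiv ℝ v₁ z 1))
    (e₂ : ∀ᶠ z in 𝓝 p, fderiv ℝ v₂ z Complex.I = J (v₂ z) (fderiv ℝ v₂ z 1))
    (h0 : ∃ᶠ z in 𝓝 p, ∀ᶠ y in 𝓝 z, v₁ y = v₂ y) : ∀ᶠ z in 𝓝 p, v₁ z = v₂ z := by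
  have hp : v₁ p = v₂ p := eq_of_frequently_eq h₁.continuousAt h₂.continuousAt
    (h0.mono fun z hz => hz.self_of_nhds)
  set J₀ := J (v₁ p) with hJ₀
  have hJ₀2 : ∀ v, J₀ (J₀ v) = -v := hJ2.self_of_nhds
  obtain ⟨n, l, C, hl, hC⟩ := exists_complex_functionals J₀ hJ₀2
  -- `A z` intertwines the varying structure `J (v₁ z)` with the constant `J₀` and is the identity
  -- at `p`. Replacing `v₁ - v₂` by its image under `A` makes the leading part the standard
  -- Cauchy-Riemann operator.
  let A : ℂ → E →L[ℝ] E := fun z =>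
    (1 / 2 : ℝ) • (ContinuousLinearMap.id ℝ E - J₀.comp (J (v₁ z)))
  have hA : ContDiffAt ℝ 2 A p :=
    (contDiffAt_const.sub (contDiffAt_const.clm_comp (hJ.comp p h₁))).const_smul _
  have hAp : A p = ContinuousLinearMap.id ℝ E := by
    ext v
    simp only [A, ← hJ₀]
    simp only [_root_.smul_apply, _root_.sub_apply, ContinuousLinearMap.id_apply,
      ContinuousLinearMap.comp_apply, hJ₀2]
    rw [sub_neg_eq_add, ← two_smul ℝ v, smul_smul]; norm_num
  let w : ℂ → E := fun z => A z (v₁ z - v₂ z)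
  have hw : ContDiffAt ℝ 2 w p := hA.clm_apply (h₁.sub h₂)
  obtain ⟨L, U, hU, hL⟩ := (hJ.of_le one_le_two).exists_lipschitzOnWith
  -- constants near `p`
  have b1 : ∀ᶠ z in 𝓝 p, ‖A z - ContinuousLinearMap.id ℝ E‖ < 1 / 2 := by
    have : Filter.Tendsto (fun z => ‖A z - ContinuousLinearMap.id ℝ E‖) (𝓝 p) (𝓝 0) := by
      have h : ContinuousAt (fun z => ‖A z - ContinuousLinearMap.id ℝ E‖) p :=
        (hA.continuousAt.sub continuousAt_const).norm
      have h' := h.tendsto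
      rwa [hAp, sub_self, norm_zero] at h'
    exact this.eventually (gt_mem_nhds (by norm_num))
  have hAc : ∀ u, ContinuousAt (fun z => fderiv ℝ A z u) p := fun u =>
    (hA.fderiv_right (m := 0) (by norm_num)).continuousAt.clm_apply continuousAt_const
  obtain ⟨K₁, b2⟩ : ∃ K₁, ∀ᶠ z in 𝓝 p,
      ‖fderiv ℝ A z Complex.I - J₀.comp (fderiv ℝ A z 1)‖ < K₁ := by
    have hc : ContinuousAt (fun z => ‖fderiv ℝ A z Complex.I - J₀.comp (fderiv ℝ A z 1)‖) p :=
      ((hAc _).sub (continuousAt_const.clm_comp (hAc _))).norm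
    exact ⟨_, hc.eventually (gt_mem_nhds (lt_add_one _))⟩
  obtain ⟨K₂, b3⟩ : ∃ K₂, ∀ᶠ z in 𝓝 p, ‖fderiv ℝ v₂ z 1‖ < K₂ := by
    have hc : ContinuousAt (fun z => ‖fderiv ℝ v₂ z 1‖) p :=
      ((h₂.fderiv_right (m := 0) (by norm_num)).continuousAt.clm_apply continuousAt_const).norm
    exact ⟨_, hc.eventually (gt_mem_nhds (lt_add_one _))⟩
  have c1 : ∀ᶠ z in 𝓝 p, v₁ z ∈ U ∧ v₂ z ∈ U :=
    (h₁.continuousAt.eventually (p := fun x => x ∈ U) hU).and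
      (h₂.continuousAt.eventually (p := fun x => x ∈ U) (by rw [← hp]; exact hU))
  have d1 := h₁.eventually (by simp)
  have d2 := h₂.eventually (by simp)
  have dA := hA.eventually (by simp)
  have dw := hw.eventually (by simp)
  obtain ⟨ρ, hρ, hball⟩ := Metric.eventually_nhds_iff_ball.1
    (((b1.and b2).and (b3.and c1)).and (((d1.and d2).and (dA.and dw)).and
      ((e₁.and e₂).and (h₁.continuousAt.eventually hJ2))))
  let N : ℝ := K₁ + 2 * L * K₂
  have hJA : ∀ z ∈ ball p ρ, ∀ v, A z (J (v₁ z) v) = J₀ (A z v) := by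
    intro z hz v
    obtain ⟨-, -, -, hz2⟩ := hball z hz
    simp only [A, _root_.smul_apply, _root_.sub_apply, ContinuousLinearMap.id_apply,
      ContinuousLinearMap.comp_apply, map_smul, map_sub, hJ₀2, hz2, map_neg]
    congr 1
    abel
  have hmain : ∀ z ∈ ball p ρ, ‖fderiv ℝ w z Complex.I - J₀ (fderiv ℝ w z 1)‖ ≤
      N * ‖v₁ z - v₂ z‖ ∧ ‖v₁ z - v₂ z‖ ≤ 2 * ‖w z‖ := by
    intro z hz
    obtain ⟨⟨⟨q1, q2⟩, q3, q4, q5⟩, ⟨⟨r1, r2⟩, r3, r4⟩, ⟨s1, s2⟩, s3⟩ := hball z hz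
    have D1 := (r1.differentiableAt (by simp)).hasFDerivAt
    have D2 := (r2.differentiableAt (by simp)).hasFDerivAt
    have DA := (r3.differentiableAt (by simp)).hasFDerivAt
    have hwd : ∀ u, fderiv ℝ w z u =
        fderiv ℝ A z u (v₁ z - v₂ z) + A z (fderiv ℝ v₁ z u - fderiv ℝ v₂ z u) := by
      intro u
      have h := (DA.clm_apply (D1.sub D2)).fderiv
      have h' : fderiv ℝ w z = _ := h
      rw [h']
      simp [add_comm]
    have hA2 : ‖A z‖ ≤ 2 := by
      calc ‖A z‖ = ‖(A z - ContinuousLinearMap.id ℝ E) + ContinuousLinearMap.id ℝ E‖ := by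
            rw [sub_add_cancel]
        _ ≤ ‖A z - ContinuousLinearMap.id ℝ E‖ + ‖ContinuousLinearMap.id ℝ E‖ := norm_add_le _ _
        _ ≤ 1 / 2 + 1 := add_le_add q1.le ContinuousLinearMap.norm_id_le
        _ ≤ 2 := by norm_num
    constructor
    -- The terms with derivatives of `v₁ - v₂` cancel up to `J (v₁ z) - J (v₂ z)`, and only terms
    -- bounded by `‖v₁ z - v₂ z‖` remain, by the Lipschitz bound for `J`.
    · have e : fderiv ℝ w z Complex.I - J₀ (fderiv ℝ w z 1) =
          (fderiv ℝ A z Complex.I - J₀.comp (fderiv ℝ A z 1)) (v₁ z - v₂ z) +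
            A z ((J (v₁ z) - J (v₂ z)) (fderiv ℝ v₂ z 1)) := by
        rw [hwd, hwd, s1, s2, map_add, ← hJA z hz]
        simp only [_root_.sub_apply, ContinuousLinearMap.comp_apply, map_sub]
        abel
      rw [e]
      have f1 : ‖(J (v₁ z) - J (v₂ z)) (fderiv ℝ v₂ z 1)‖ ≤ (L * ‖v₁ z - v₂ z‖) * K₂ := by
        refine (ContinuousLinearMap.le_opNorm _ _).trans (mul_le_mul ?_ q3.le (norm_nonneg _)
          (by positivity))
        have := hL.dist_le_mul _ q4 _ q5
        simpa only [dist_eq_norm] using this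
      calc _ ≤ ‖(fderiv ℝ A z Complex.I - J₀.comp (fderiv ℝ A z 1)) (v₁ z - v₂ z)‖ +
            ‖A z ((J (v₁ z) - J (v₂ z)) (fderiv ℝ v₂ z 1))‖ := norm_add_le _ _
        _ ≤ K₁ * ‖v₁ z - v₂ z‖ + 2 * ((L * ‖v₁ z - v₂ z‖) * K₂) := by
            refine add_le_add (ContinuousLinearMap.le_of_opNorm_le _ q2.le _) ?_
            exact (ContinuousLinearMap.le_of_opNorm_le _ hA2 _).trans
              (mul_le_mul_of_nonneg_left f1 (by norm_num))
        _ = N * ‖v₁ z - v₂ z‖ := by simp only [N]; ring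
    · have f1 : ‖(A z - ContinuousLinearMap.id ℝ E) (v₁ z - v₂ z)‖ ≤ 1 / 2 * ‖v₁ z - v₂ z‖ :=
        ContinuousLinearMap.le_of_opNorm_le _ q1.le _
      have f2 : v₁ z - v₂ z = w z - (A z - ContinuousLinearMap.id ℝ E) (v₁ z - v₂ z) := by
        simp [w]
      have f3 : ‖v₁ z - v₂ z‖ ≤ ‖w z‖ + 1 / 2 * ‖v₁ z - v₂ z‖ := by
        calc ‖v₁ z - v₂ z‖ = ‖w z - (A z - ContinuousLinearMap.id ℝ E) (v₁ z - v₂ z)‖ :=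
              congrArg _ f2
          _ ≤ ‖w z‖ + ‖(A z - ContinuousLinearMap.id ℝ E) (v₁ z - v₂ z)‖ := norm_sub_le _ _
          _ ≤ _ := by linarith
      linarith
  -- the components satisfy a differential inequality
  have hdb : ∀ a, ∀ z ∈ ball p ρ, dbar (fun z => l a (w z)) z =
      Complex.I * l a (fderiv ℝ w z Complex.I - J₀ (fderiv ℝ w z 1)) := by
    intro a z hz
    obtain ⟨-, ⟨-, -, r4⟩, -⟩ := hball z hz
    have h := ((l a).hasFDerivAt (x := w z)).comp z (r4.differentiableAt (by simp)).hasFDerivAt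
    have h' : fderiv ℝ (fun z => l a (w z)) z = _ := h.fderiv
    rw [dbar, h', map_sub, hl]
    simp only [ContinuousLinearMap.comp_apply]
    linear_combination (l a (fderiv ℝ w z 1)) * Complex.I_mul_I
  let M : ℝ := ∑ a, ‖l a‖ ^ 2
  have hM : 0 ≤ M := Finset.sum_nonneg fun _ _ => sq_nonneg _
  have hineq : ∀ z ∈ ball p ρ, ∑ a, ‖dbar (fun z => l a (w z)) z‖ ^ 2 ≤
      (Real.sqrt (M * (2 * N) ^ 2 * C ^ 2)) ^ 2 * ∑ a, ‖l a (w z)‖ ^ 2 := by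
    intro z hz
    obtain ⟨m1, m2⟩ := hmain z hz
    rw [Real.sq_sqrt (by positivity)]
    -- A negative `N` would force `v₁ z = v₂ z` by the estimate `m1`.
    have hN : 0 ≤ N ∨ ‖v₁ z - v₂ z‖ = 0 := by
      by_contra! h
      have h1 : 0 < ‖v₁ z - v₂ z‖ := lt_of_le_of_ne (norm_nonneg _) (Ne.symm h.2)
      have := (norm_nonneg _).trans m1
      nlinarith
    have m3 : ‖fderiv ℝ w z Complex.I - J₀ (fderiv ℝ w z 1)‖ ^ 2 ≤ (2 * N) ^ 2 * ‖w z‖ ^ 2 := by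
      have : ‖fderiv ℝ w z Complex.I - J₀ (fderiv ℝ w z 1)‖ ≤ |2 * N| * ‖w z‖ := by
        rcases hN with hN | hN
        · rw [abs_of_nonneg (by linarith)]
          nlinarith
        · rw [hN, mul_zero] at m1
          exact m1.trans (by positivity)
      calc _ ≤ (|2 * N| * ‖w z‖) ^ 2 := pow_le_pow_left₀ (norm_nonneg _) this 2
        _ = _ := by rw [mul_pow, sq_abs]
    calc ∑ a, ‖dbar (fun z => l a (w z)) z‖ ^ 2
        ≤ ∑ a, ‖l a‖ ^ 2 * ‖fderiv ℝ w z Complex.I - J₀ (fderiv ℝ w z 1)‖ ^ 2 := by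
          refine Finset.sum_le_sum fun a _ => ?_
          rw [hdb a z hz, norm_mul, Complex.norm_I, one_mul, ← mul_pow]
          exact pow_le_pow_left₀ (norm_nonneg _) ((l a).le_opNorm _) 2
      _ = M * ‖fderiv ℝ w z Complex.I - J₀ (fderiv ℝ w z 1)‖ ^ 2 := (Finset.sum_mul _ _ _).symm
      _ ≤ M * ((2 * N) ^ 2 * ‖w z‖ ^ 2) := mul_le_mul_of_nonneg_left m3 hM
      _ ≤ M * ((2 * N) ^ 2 * (C ^ 2 * ∑ a, ‖l a (w z)‖ ^ 2)) :=
          mul_le_mul_of_nonneg_left (mul_le_mul_of_nonneg_left (hC _) (sq_nonneg _)) hM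
      _ = _ := by ring
  have hfinal := eventually_zero_of_dbar_le (w := fun a z => l a (w z)) hρ
    (fun a z hz => by
      obtain ⟨-, ⟨-, -, r4⟩, -⟩ := hball z hz
      exact ((l a).contDiff.contDiffAt.comp z r4).contDiffWithinAt) hineq
    (h0.mono fun z hz a => hz.mono fun y hy => by simp [w, hy])
  filter_upwards [hfinal, ball_mem_nhds p hρ] with z hz hzb
  have h1 := hC (w z)
  simp only [hz, norm_zero] at h1
  have h2 : ‖w z‖ = 0 := by
    have : ‖w z‖ ^ 2 ≤ 0 := by simpa using h1
    nlinarith [norm_nonneg (w z)]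
  have h3 := (hmain z hzb).2
  rw [h2, mul_zero] at h3
  exact sub_eq_zero.1 (norm_le_zero_iff.1 h3)

end JHolomorphic

end Orb

namespace Orb

/-! ### Holomorphic coordinates and roots -/

section HolomorphicCharts

variable {S : Type*} [TopologicalSpace S] [ChartedSpace ℂ S] [IsManifold 𝓘(ℂ) ω S]

/-- Coordinate changes of a Riemann surface are analytic. -/
lemma analyticAt_transition {ψ ψ' : OpenPartialHomeomorph S ℂ}
    (hψ : ψ ∈ IsManifold.maximalAtlas 𝓘(ℂ) ω S) (hψ' : ψ' ∈ IsManifold.maximalAtlas 𝓘(ℂ) ω S)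
    {ζ : ℂ} (h : ζ ∈ ψ.target) (h' : ψ.symm ζ ∈ ψ'.source) :
    AnalyticAt ℂ (fun z => ψ' (ψ.symm z)) ζ := by
  have h1 := contMDiffAt_symm_of_mem_maximalAtlas (I := 𝓘(ℂ)) hψ h
  have h2 := contMDiffAt_of_mem_maximalAtlas (I := 𝓘(ℂ)) hψ' h'
  have h3 := (h2.comp ζ h1).contDiffAt
  exact h3.analyticAt

/-- Local branches of roots of a nonvanishing analytic function. -/
lemma exists_analytic_root {τ : ℂ → ℂ} {ζ₀ : ℂ} (hτ : AnalyticAt ℂ τ ζ₀) (h0 : τ ζ₀ ≠ 0) {m : ℕ}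
    (hm : 1 ≤ m) : ∃ r : ℂ → ℂ, AnalyticAt ℂ r ζ₀ ∧ ∀ᶠ ζ in 𝓝 ζ₀, r ζ ^ m = τ ζ := by
  obtain ⟨r₀, hr₀⟩ := IsAlgClosed.exists_pow_nat_eq (τ ζ₀) hm
  have hq : AnalyticAt ℂ (fun ζ => τ ζ / τ ζ₀) ζ₀ := hτ.div analyticAt_const h0
  have hm0 : (m : ℂ) ≠ 0 := by exact_mod_cast (by omega : m ≠ 0)
  -- Dividing by the value at `ζ₀` brings the argument of the logarithm close to `1`, away from the
  -- branch cut.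
  refine ⟨fun ζ => r₀ * Complex.exp (Complex.log (τ ζ / τ ζ₀) / m), ?_, ?_⟩
  · refine analyticAt_const.mul (AnalyticAt.cexp' ?_)
    refine (hq.clog ?_).div analyticAt_const hm0
    simp [div_self h0]
  · filter_upwards [hτ.continuousAt.eventually_ne h0] with ζ hζ
    rw [mul_pow, ← Complex.exp_nat_mul, mul_div_cancel₀ _ hm0, Complex.exp_log (div_ne_zero hζ h0),
      hr₀, mul_div_cancel₀ _ h0]

end HolomorphicCharts

/-! ### The Cauchy-Riemann equation for lifts to charts -/

section Lifts

variable {E : Type*} [NormedAddCommGroup E] [NormedSpace ℝ E] [FiniteDimensional ℝ E]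
  {X : Type*} [TopologicalSpace X] {O : Orbifold E X}

/-- `v` satisfies the Cauchy-Riemann equation at `ζ` with respect to the almost complex structure
in the chart `d`. -/
def JHolAt (J : AlmostComplex O) (d : O.charts) (v : ℂ → E) (ζ : ℂ) : Prop :=
  fderiv ℝ v ζ Complex.I = ext0 (J.J d) (v ζ) (fderiv ℝ v ζ 1)

lemma JHolAt.congr {J : AlmostComplex O} {d : O.charts} {v u : ℂ → E} {ζ : ℂ}
    (h : JHolAt J d v ζ) (e : v =ᶠ[𝓝 ζ] u) : JHolAt J d u ζ := by
  rw [JHolAt, ← e.fderiv_eq, ← e.self_of_nhds]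
  exact h

/-- Local changes intertwine the almost complex structures, so the equation does not depend on the
chart. -/
lemma JHolAt.comp_loc {J : AlmostComplex O} {c d : O.charts} {v : ℂ → E} {ζ : ℂ}
    (h : JHolAt J c v ζ) (hv : ContDiffAt ℝ 2 v ζ) (hc : v ζ ∈ c.1.V) {k : c.1.V → d.1.V}
    (hk : Loc c.1 d.1 k ⟨v ζ, hc⟩) :
    JHolAt J d (fun z => ext0 (Subtype.val ∘ k) (v z)) ζ := by
  have h1 : HasFDerivAt (ext0 (Subtype.val ∘ k)) (dv k ⟨v ζ, hc⟩) (v ζ) :=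
    ((contMDiffAt_iff_ext0'.1 hk.contMDiffAt).differentiableAt (by simp)).hasFDerivAt
  have h2 := (h1.comp ζ (hv.differentiableAt (by simp)).hasFDerivAt).fderiv
  have h3 : fderiv ℝ (fun z => ext0 (Subtype.val ∘ k) (v z)) ζ = _ := h2
  have h4 : ext0 (Subtype.val ∘ k) (v ζ) = k ⟨v ζ, hc⟩ := ext0_coe (Subtype.val ∘ k) ⟨v ζ, hc⟩
  have h5 : ext0 (J.J c) (v ζ) = J.J c ⟨v ζ, hc⟩ := ext0_coe (J.J c) ⟨v ζ, hc⟩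
  rw [JHolAt, h3, h4, ext0_coe, ContinuousLinearMap.comp_apply, ContinuousLinearMap.comp_apply, h,
    h5]
  exact J.invariant_loc c d hk _

/-- Two lifts of the same map to charts, one of which is pseudo-holomorphic: the other one
satisfies the Cauchy-Riemann equation at points arbitrarily close to a given one. -/
lemma frequently_jHolAt {J : AlmostComplex O} {c d : O.charts} {u v : ℂ → E} {ζ₀ : ℂ}
    (hv : ∀ᶠ ζ in 𝓝 ζ₀, ContinuousAt v ζ)
    (hu : ∀ᶠ ζ in 𝓝 ζ₀, ContDiffAt ℝ 2 u ζ) (huJ : ∀ᶠ ζ in 𝓝 ζ₀, JHolAt J c u ζ)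
    (hπ : ∀ᶠ ζ in 𝓝 ζ₀, ∃ (h : u ζ ∈ c.1.V) (h' : v ζ ∈ d.1.V), c.1.π ⟨u ζ, h⟩ = d.1.π ⟨v ζ, h'⟩) :
    ∃ᶠ ζ in 𝓝 ζ₀, JHolAt J d v ζ := by
  have := d.1.finite
  obtain ⟨hc₀, hd₀, hπ₀⟩ := hπ.self_of_nhds
  obtain ⟨k, hk, hk0⟩ := (O.compatible c.1 c.2 d.1 d.2).exists_loc hπ₀
  have hkl : ∀ᶠ ζ in 𝓝 ζ₀, ∀ h : u ζ ∈ c.1.V, Loc c.1 d.1 k ⟨u ζ, h⟩ := by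
    have h1 := hk.eventually
    have h2 : ∀ᶠ y in 𝓝 (u ζ₀), ∀ h : y ∈ c.1.V, Loc c.1 d.1 k ⟨y, h⟩ := by
      rw [show u ζ₀ = ((⟨u ζ₀, hc₀⟩ : c.1.V) : E) from rfl, ← map_val_nhds, Filter.eventually_map]
      filter_upwards [h1] with y hy _ using hy
    exact hu.self_of_nhds.continuousAt.eventually h2
  rw [Filter.frequently_iff]
  intro U hU
  obtain ⟨W, hW, hWo, hW0⟩ := eventually_nhds_iff.1
    (((hv.and hu).and (huJ.and hπ)).and (hkl.and (Filter.eventually_mem_set.2 hU)))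
  -- At each point `v` equals `g ∘ k ∘ u` for some `g` of the finite group depending on the point.
  -- One `g` works near some point of `W`, and there `v` inherits the equation from `u`.
  obtain ⟨g, ζ, hζ, hg⟩ := exists_eventually_mem_of_finite_cover (ι := d.1.G) hWo ⟨ζ₀, hW0⟩
    (A := fun g => {ζ | ext0 (Subtype.val ∘ (g.1 ∘ k)) (u ζ) = v ζ})
    (fun ζ hζ => by
      obtain ⟨⟨-, -, hc, hd, h1⟩, h2, -⟩ := hW ζ hζ
      obtain ⟨g, hg, h3⟩ := (d.1.fibre (k ⟨u ζ, hc⟩) ⟨v ζ, hd⟩).1 ((h2 hc).comm.trans h1)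
      exact ⟨⟨g, hg⟩, (ext0_coe (Subtype.val ∘ (g ∘ k)) ⟨u ζ, hc⟩).trans (congrArg Subtype.val h3)⟩)
    (fun g ζ hζ hf => by
      obtain ⟨⟨⟨a1, a2⟩, -, hc, hd, h1⟩, h2, -⟩ := hW ζ hζ
      refine eq_of_frequently_eq ?_ a1 hf
      have h3 := (loc_of_group g.2 _).comp (h2 hc)
      exact ((contMDiffAt_iff_ext0'.1 h3.contMDiffAt).continuousAt).comp_of_eq a2.continuousAt rfl)
  obtain ⟨⟨⟨a1, a2⟩, a3, hc, hd, h1⟩, h2, hU⟩ := hW ζ hζ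
  exact ⟨ζ, hU, (a3.comp_loc a2 hc ((loc_of_group g.2 _).comp (h2 hc))).congr hg⟩

/-- The derivative of `r` is complex linear, so it commutes with `i`. -/
lemma JHolAt.comp_analytic {J : AlmostComplex O} {c : O.charts} {u : ℂ → E} {r : ℂ → ℂ} {ζ : ℂ}
    (hu : ∀ v : ℂ, fderiv ℝ u (r ζ) (Complex.I * v) = ext0 (J.J c) (u (r ζ)) (fderiv ℝ u (r ζ) v))
    (hud : DifferentiableAt ℝ u (r ζ)) (hr : AnalyticAt ℂ r ζ) :
    JHolAt J c (u ∘ r) ζ := by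
  have h1 : HasFDerivAt r ((fderiv ℂ r ζ).restrictScalars ℝ) ζ :=
    hr.differentiableAt.hasFDerivAt.restrictScalars ℝ
  have h2 := (hud.hasFDerivAt.comp ζ h1).fderiv
  have h4 : fderiv ℂ r ζ Complex.I = Complex.I * fderiv ℂ r ζ 1 := by
    rw [← smul_eq_mul, ← map_smul]; simp
  rw [JHolAt, h2, ContinuousLinearMap.comp_apply, ContinuousLinearMap.comp_apply,
    ContinuousLinearMap.coe_restrictScalars', h4, hu]
  rfl

end Lifts

end Orb

namespace Orb

open Metric

lemma two_le_infty : (2 : WithTop ℕ∞) ≤ ∞ := by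
  have : ((2 : ℕ∞) : WithTop ℕ∞) ≤ ((⊤ : ℕ∞) : WithTop ℕ∞) := WithTop.coe_le_coe.2 le_top
  exact this

/-- The punctured disc is the image under `exp` of a half-plane. -/
lemma isPreconnected_puncturedBall {ρ : ℝ} (hρ : 0 < ρ) :
    IsPreconnected (ball (0 : ℂ) ρ \ {0}) := by
  have : ball (0 : ℂ) ρ \ {0} = Complex.exp '' {z | z.re < Real.log ρ} := by
    ext z
    simp only [mem_sdiff, mem_ball_zero_iff, mem_singleton_iff, mem_image, mem_ofPred_eq]
    constructor
    · rintro ⟨h1, h2⟩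
      refine ⟨Complex.log z, ?_, Complex.exp_log h2⟩
      rw [Complex.log_re]
      exact Real.log_lt_log (norm_pos_iff.2 h2) h1
    · rintro ⟨y, hy, rfl⟩
      refine ⟨?_, Complex.exp_ne_zero y⟩
      rw [Complex.norm_exp, ← Real.exp_log hρ]
      exact Real.exp_lt_exp.2 hy
  rw [this]
  exact (convex_halfSpace_re_lt _).isPreconnected.image _ Complex.continuous_exp.continuousOn

/-! ### Local normal forms of charts of the orbifold surface -/

section Surface

variable {S : Type*} [TopologicalSpace S] [ChartedSpace ℂ S]

/-- A local normal form `w ↦ w ^ m` of a uniformizing system at a point. -/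
structure LocalForm (c : UChart ℂ S) (x : c.V) (m : ℕ) where
  ψ : OpenPartialHomeomorph S ℂ
  h : PartialDiffeomorph 𝓘(ℝ, ℂ) 𝓘(ℝ, ℂ) c.V ℂ ∞
  one_le : 1 ≤ m
  mem_atlas : ψ ∈ IsManifold.maximalAtlas 𝓘(ℂ) ω S
  π_mem : c.π x ∈ ψ.source
  ψ_π : ψ (c.π x) = 0
  mem_source : x ∈ h.source
  h_x : h x = 0
  form : ∀ w ∈ h.source, c.π w ∈ ψ.source ∧ ψ (c.π w) = h w ^ m

lemma IsOrbifoldSurface.exists_localForm {k : ℕ} {z : Fin k → S} {OS : Orbifold ℂ S}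
    (hOS : IsOrbifoldSurface z OS) {c : UChart ℂ S} (hc : c ∈ OS.charts) (x : c.V) :
    ∃ m, (m ≠ 1 → c.π x ∈ range z) ∧ Nonempty (LocalForm c x m) := by
  obtain ⟨m, h1, h2, ψ, h3, h4, h5, h, h6, h7, h8⟩ := hOS c hc x
  exact ⟨m, h2, ⟨⟨ψ, h, h1, h3, h4, h5, h6, h7, h8⟩⟩⟩

namespace LocalForm

variable {c : UChart ℂ S} {x : c.V} {m : ℕ} (F : LocalForm c x m)

/-- The local parameter of the uniformizing system. -/
noncomputable def s : ℂ → c.V := F.h.symm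

lemma s_zero : F.s 0 = x := by
  rw [← F.h_x]
  exact F.h.left_inv F.mem_source

lemma zero_mem : (0 : ℂ) ∈ F.h.target := by
  rw [← F.h_x]
  exact F.h.map_source F.mem_source

lemma contMDiffAt_s {ζ : ℂ} (hζ : ζ ∈ F.h.target) :
    ContMDiffAt 𝓘(ℝ, ℂ) 𝓘(ℝ, ℂ) ∞ F.s ζ :=
  F.h.contMDiffOn_invFun.contMDiffAt (F.h.open_target.mem_nhds hζ)

lemma s_mem {ζ : ℂ} (hζ : ζ ∈ F.h.target) : F.s ζ ∈ F.h.source := F.h.map_target hζ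

lemma h_s {ζ : ℂ} (hζ : ζ ∈ F.h.target) : F.h (F.s ζ) = ζ := F.h.right_inv hζ

lemma s_h {w : c.V} (hw : w ∈ F.h.source) : F.s (F.h w) = w := F.h.left_inv hw

lemma ψ_π_s {ζ : ℂ} (hζ : ζ ∈ F.h.target) : ψ F (c.π (F.s ζ)) = ζ ^ m := by
  rw [(F.form _ (F.s_mem hζ)).2, F.h_s hζ]

lemma π_s {ζ : ℂ} (hζ : ζ ∈ F.h.target) : c.π (F.s ζ) = (ψ F).symm (ζ ^ m) := by
  rw [← F.ψ_π_s hζ, (ψ F).left_inv (F.form _ (F.s_mem hζ)).1]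

lemma s_injOn : InjOn F.s F.h.target := fun a ha b hb hab => by
  rw [← F.h_s ha, ← F.h_s hb, hab]

/-- Small discs in the local parameter. -/
lemma exists_ball {p : ℂ → Prop} (hp : ∀ᶠ ζ in 𝓝 0, p ζ) :
    ∃ ρ > 0, ball (0 : ℂ) ρ ⊆ F.h.target ∧ ∀ ζ ∈ ball (0 : ℂ) ρ, p ζ := by
  obtain ⟨ρ, hρ, h⟩ := Metric.eventually_nhds_iff_ball.1
    (hp.and (F.h.open_target.mem_nhds F.zero_mem))
  exact ⟨ρ, hρ, fun ζ hζ => (h ζ hζ).2, fun ζ hζ => (h ζ hζ).1⟩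

lemma isOpen_image {ρ : ℝ} (h : ball (0 : ℂ) ρ ⊆ F.h.target) : IsOpen (F.s '' ball 0 ρ) := by
  have : F.s '' ball 0 ρ = F.h.source ∩ F.h ⁻¹' ball 0 ρ := by
    ext w
    constructor
    · rintro ⟨ζ, hζ, rfl⟩
      exact ⟨F.s_mem (h hζ), by rw [mem_preimage, F.h_s (h hζ)]; exact hζ⟩
    · rintro ⟨h1, h2⟩
      exact ⟨F.h w, h2, F.s_h h1⟩
  rw [this]
  exact F.h.contMDiffOn_toFun.continuousOn.isOpen_inter_preimage F.h.open_source isOpen_ball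

lemma continuousOn_s {ρ : ℝ} (h : ball (0 : ℂ) ρ ⊆ F.h.target) : ContinuousOn F.s (ball 0 ρ) :=
  fun _ hζ => (F.contMDiffAt_s (h hζ)).continuousAt.continuousWithinAt

end LocalForm

end Surface

/-! ### Good neighbourhoods for unique continuation -/

section Lifts

variable {E : Type*} [NormedAddCommGroup E] [NormedSpace ℝ E] [FiniteDimensional ℝ E]
  {X : Type*} [TopologicalSpace X] {O : Orbifold E X}
  {S : Type*} [TopologicalSpace S] [T1Space S] [ChartedSpace ℂ S] [IsManifold 𝓘(ℂ) ω S]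

/-- On a small disc, all smooth lifts of a pseudo-holomorphic map are pseudo-holomorphic. -/
lemma LocalForm.eventually_jHolAt {J : AlmostComplex O} {f : C(S, X)}
    (hf : IsPseudoHolomorphic J f) {c : UChart ℂ S} {x : c.V} {m : ℕ} (F : LocalForm c x m) :
    ∃ ρ > 0, ball (0 : ℂ) ρ ⊆ F.h.target ∧ ∀ ρ' ≤ ρ, ∀ (d : O.charts) (u : c.V → d.1.V),
      (∀ ζ ∈ ball (0 : ℂ) ρ', ContMDiffAt 𝓘(ℝ, ℂ) 𝓘(ℝ, E) ∞ u (F.s ζ) ∧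
        d.1.π (u (F.s ζ)) = f (c.π (F.s ζ))) →
      ∀ ζ ∈ ball (0 : ℂ) ρ', ContDiffAt ℝ ∞ (fun z => (u (F.s z) : E)) ζ ∧
        JHolAt J d (fun z => (u (F.s z) : E)) ζ := by
  obtain ⟨m', hm', ρ', hρ', ψ', hψ', hp, hp0, hball, c', uJ, huJ, hJ⟩ := hf (c.π x)
  have hev : ∀ᶠ ζ in 𝓝 (0 : ℂ), c.π (F.s ζ) ∈ ψ'.source ∧ ψ' (c.π (F.s ζ)) ∈ ball (0 : ℂ) (ρ' ^ m') := by
    have h1 : ContinuousAt (fun ζ => c.π (F.s ζ)) 0 :=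
      c.continuous.continuousAt.comp (F.contMDiffAt_s F.zero_mem).continuousAt
    have h2 : c.π (F.s 0) = c.π x := by rw [F.s_zero]
    refine (h1.eventually (p := fun q => q ∈ ψ'.source) (ψ'.open_source.mem_nhds (by change c.π (F.s 0) ∈ _; rwa [h2]))).and
      (h1.eventually (p := fun q => ψ' q ∈ ball (0 : ℂ) (ρ' ^ m')) ?_)
    have h3 : ContinuousAt ψ' (c.π (F.s 0)) := ψ'.continuousAt (by rwa [h2])
    exact h3.eventually (p := fun q => q ∈ ball (0 : ℂ) (ρ' ^ m'))
      (isOpen_ball.mem_nhds (by rw [h2, hp0]; exact mem_ball_self (by positivity)))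
  obtain ⟨ρ, hρ, hρt, hρp⟩ := F.exists_ball hev
  refine ⟨ρ, hρ, hρt, fun ρ₁ hρ₁ d u hu => ?_⟩
  have hsub : ball (0 : ℂ) ρ₁ ⊆ ball 0 ρ := ball_subset_ball hρ₁
  have hsm : ∀ ζ ∈ ball (0 : ℂ) ρ₁, ContDiffAt ℝ ∞ (fun z => (u (F.s z) : E)) ζ := by
    intro ζ hζ
    rw [← contMDiffAt_iff_contDiffAt]
    exact (contMDiff_subtype_val _).comp ζ ((hu ζ hζ).1.comp ζ (F.contMDiffAt_s (hρt (hsub hζ))))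
  refine fun ζ₁ hζ₁ => ⟨hsm ζ₁ hζ₁, ?_⟩
  have hJc : ContinuousAt (ext0 (J.J d)) (u (F.s ζ₁) : E) :=
    (contMDiffAt_iff_ext0.1 (J.smooth d (u (F.s ζ₁)))).continuousAt
  have hfd : ∀ w : ℂ, ContinuousAt (fun ζ => fderiv ℝ (fun z => (u (F.s z) : E)) ζ w) ζ₁ := fun w =>
    (((hsm ζ₁ hζ₁).fderiv_right (m := 0) (by simp)).continuousAt).clm_apply continuousAt_const
  -- Both sides of the equation are continuous in `ζ`, so points arbitrarily close to `ζ₁` suffice.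
  refine eq_of_frequently_eq (f := fun ζ => fderiv ℝ (fun z => (u (F.s z) : E)) ζ Complex.I)
    (g := fun ζ => ext0 (J.J d) (u (F.s ζ)) (fderiv ℝ (fun z => (u (F.s z) : E)) ζ 1))
    (hfd _) (ContinuousAt.clm_apply (hJc.comp_of_eq (hsm ζ₁ hζ₁).continuousAt rfl) (hfd 1)) ?_
  rw [Filter.frequently_iff]
  intro U hU
  obtain ⟨U', hU'U, hU'o, hU'ζ⟩ := _root_.mem_nhds_iff.1 hU
  -- Away from `0` the coordinate `ψ'` is nonzero, so the branched covering `w ↦ w ^ m'` has a local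
  -- inverse branch.
  obtain ⟨ζ₀, ⟨hζ₀U, hζ₀⟩, hζ₀0⟩ : ((U' ∩ ball (0 : ℂ) ρ₁) ∩ {0}ᶜ).Nonempty := by
    have h1 : U' ∩ ball (0 : ℂ) ρ₁ ∈ 𝓝 ζ₁ := (hU'o.inter isOpen_ball).mem_nhds ⟨hU'ζ, hζ₁⟩
    exact (dense_compl_singleton (0 : ℂ)).inter_open_nonempty _ (hU'o.inter isOpen_ball)
      ⟨ζ₁, hU'ζ, hζ₁⟩
  -- the pseudo-holomorphic lift near `ζ₀`
  have hζt := hρt (hsub hζ₀)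
  obtain ⟨hq1, hq2⟩ := hρp ζ₀ (hsub hζ₀)
  have hψt : ζ₀ ^ m ∈ F.ψ.target := by
    rw [← F.ψ_π_s hζt]
    exact F.ψ.map_source (F.form _ (F.s_mem hζt)).1
  have hτ : AnalyticAt ℂ (fun ζ : ℂ => ψ' (F.ψ.symm (ζ ^ m))) ζ₀ := by
    have h1 := analyticAt_transition F.mem_atlas hψ' hψt (by rwa [← F.π_s hζt])
    exact h1.comp_of_eq (analyticAt_id.pow m) rfl
  have hτ0 : ψ' (F.ψ.symm (ζ₀ ^ m)) ≠ 0 := by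
    rw [← F.π_s hζt, ← hp0]
    intro h
    have h1 := ψ'.injOn hq1 hp h
    have h2 := F.ψ_π_s hζt
    rw [h1, F.ψ_π] at h2
    exact hζ₀0 (pow_eq_zero_iff (by have := F.one_le; omega) |>.1 h2.symm)
  -- Composed with this branch, the given pseudo-holomorphic lift becomes a lift over the parameter
  -- `ζ`, to be compared with `u ∘ s`.
  obtain ⟨r, hr, hrm⟩ := exists_analytic_root hτ hτ0 hm'
  have hr0 : r ζ₀ ∈ ball (0 : ℂ) ρ' := by
    rw [mem_ball_zero_iff]
    have h1 : ‖r ζ₀‖ ^ m' < ρ' ^ m' := by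
      rw [← norm_pow, hrm.self_of_nhds, ← F.π_s hζt]
      exact mem_ball_zero_iff.1 hq2
    exact lt_of_pow_lt_pow_left₀ m' hρ'.le h1
  have hrb : ∀ᶠ ζ in 𝓝 ζ₀, r ζ ∈ ball (0 : ℂ) ρ' :=
    hr.continuousAt.eventually (isOpen_ball.mem_nhds hr0)
  have hζb : ∀ᶠ ζ in 𝓝 ζ₀, ζ ∈ ball (0 : ℂ) ρ₁ := isOpen_ball.mem_nhds hζ₀
  have hu2 : ∀ ζ, r ζ ∈ ball (0 : ℂ) ρ' → ContDiffAt ℝ ∞ uJ (r ζ) := fun ζ h =>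
    huJ.contDiffAt (isOpen_ball.mem_nhds h)
  have key := frequently_jHolAt (J := J) (c := c') (d := d) (u := uJ ∘ r)
    (v := fun z => (u (F.s z) : E)) (ζ₀ := ζ₀)
    (hζb.mono fun ζ hζ => (hsm ζ hζ).continuousAt)
    (by
      filter_upwards [hrb, hr.eventually_analyticAt] with ζ h1 h2
      exact ((hu2 ζ h1).of_le two_le_infty).comp ζ
        ((h2.contDiffAt (n := 2)).restrict_scalars ℝ))
    (by
      filter_upwards [hrb, hr.eventually_analyticAt] with ζ h1 h2
      obtain ⟨hw, -, h3⟩ := hJ (r ζ) h1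
      refine JHolAt.comp_analytic (fun v => ?_) ((hu2 ζ h1).differentiableAt (by simp)) h2
      rw [h3 v]
      exact congrArg (fun A : E →L[ℝ] E => A (fderiv ℝ uJ (r ζ) v))
        (ext0_coe (J.J c') ⟨uJ (r ζ), hw⟩).symm)
    (by
      filter_upwards [hrb, hζb, hrm] with ζ h1 h2 h3
      obtain ⟨hw, h4, -⟩ := hJ (r ζ) h1
      refine ⟨hw, (u (F.s ζ)).2, ?_⟩
      have h5 := hρt (hsub h2)
      rw [show (⟨(uJ ∘ r) ζ, hw⟩ : c'.1.V) = ⟨uJ (r ζ), hw⟩ from rfl, h4, h3, ← F.π_s h5,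
        ψ'.left_inv (hρp ζ (hsub h2)).1]
      exact (hu ζ h2).2.symm)
  obtain ⟨ζ, hζ, hζU⟩ := (key.and_eventually (hU'o.mem_nhds hζ₀U)).exists
  exact ⟨ζ, hU'U hζU, hζ⟩

/-- A neighbourhood on which lifts of `f` to charts satisfy unique continuation, and which contains
no point over `Z` except possibly its centre. -/
structure GoodNhd (O : Orbifold E X) (f : C(S, X)) (Z : Set S) (c : UChart ℂ S) (x : c.V)
    (N : Set c.V) : Prop where
  isOpen : IsOpen N
  mem : x ∈ N
  preconnected : IsPreconnected (N \ {x})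
  frequently : ∃ᶠ w in 𝓝 x, w ≠ x
  notMem : ∀ w ∈ N, w ≠ x → c.π w ∉ Z
  unique : ∀ d ∈ O.charts, ∀ u₁ u₂ : c.V → d.V,
    (∀ w ∈ N, ContMDiffAt 𝓘(ℝ, ℂ) 𝓘(ℝ, E) ∞ u₁ w ∧ d.π (u₁ w) = f (c.π w)) →
    (∀ w ∈ N, ContMDiffAt 𝓘(ℝ, ℂ) 𝓘(ℝ, E) ∞ u₂ w ∧ d.π (u₂ w) = f (c.π w)) →
    (∃ w ∈ N, ∀ᶠ y in 𝓝 w, u₁ y = u₂ y) → ∀ w ∈ N, u₁ w = u₂ w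

lemma LocalForm.exists_goodNhd {J : AlmostComplex O} {f : C(S, X)}
    (hf : IsPseudoHolomorphic J f) {c : UChart ℂ S} {x : c.V} {m : ℕ} (F : LocalForm c x m)
    {Z : Set S} (hZ : Z.Finite) {W : Set c.V} (hW : W ∈ 𝓝 x) :
    ∃ N ⊆ W, GoodNhd O f Z c x N := by
  obtain ⟨ρ₀, hρ₀, hρ₀t, hJ⟩ := F.eventually_jHolAt hf
  have hsc : ContinuousAt F.s 0 := (F.contMDiffAt_s F.zero_mem).continuousAt
  have hev : ∀ᶠ ζ in 𝓝 (0 : ℂ), F.s ζ ∈ W ∧ c.π (F.s ζ) ∉ Z \ {c.π x} := by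
    refine (hsc.eventually (p := fun y => y ∈ W) (by rwa [F.s_zero])).and ?_
    have h1 : ContinuousAt (fun ζ => c.π (F.s ζ)) 0 := c.continuous.continuousAt.comp hsc
    have h2 : IsClosed (Z \ {c.π x}) := (hZ.subset sdiff_subset).isClosed
    refine h1.eventually (p := fun q => q ∉ Z \ {c.π x}) (h2.isOpen_compl.mem_nhds ?_)
    change c.π (F.s 0) ∉ _
    rw [F.s_zero]
    simp
  obtain ⟨ρ₁, hρ₁, -, hp⟩ := F.exists_ball hev
  let ρ := min ρ₀ ρ₁
  have hρ : 0 < ρ := lt_min hρ₀ hρ₁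
  have hρt : ball (0 : ℂ) ρ ⊆ F.h.target := (ball_subset_ball (min_le_left _ _)).trans hρ₀t
  have hρp : ∀ ζ ∈ ball (0 : ℂ) ρ, F.s ζ ∈ W ∧ c.π (F.s ζ) ∉ Z \ {c.π x} := fun ζ hζ =>
    hp ζ (ball_subset_ball (min_le_right _ _) hζ)
  have hne : ∀ ζ ∈ ball (0 : ℂ) ρ, ζ ≠ 0 → F.s ζ ≠ x := by
    intro ζ hζ h0 h
    exact h0 (F.s_injOn (hρt hζ) F.zero_mem (h.trans F.s_zero.symm))
  refine ⟨F.s '' ball 0 ρ, ?_, F.isOpen_image hρt, ⟨0, mem_ball_self hρ, F.s_zero⟩,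
    ?_, ?_, ?_, ?_⟩
  · rintro _ ⟨ζ, hζ, rfl⟩
    exact (hρp ζ hζ).1
  · have : F.s '' ball 0 ρ \ {x} = F.s '' (ball 0 ρ \ {0}) := by
      ext w
      constructor
      · rintro ⟨⟨ζ, hζ, rfl⟩, h⟩
        refine ⟨ζ, ⟨hζ, fun h0 => h ?_⟩, rfl⟩
        rw [mem_singleton_iff.1 h0]
        exact F.s_zero
      · rintro ⟨ζ, ⟨hζ, h0⟩, rfl⟩
        exact ⟨⟨ζ, hζ, rfl⟩, hne ζ hζ h0⟩
    rw [this]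
    exact (isPreconnected_puncturedBall hρ).image _ ((F.continuousOn_s hρt).mono sdiff_subset)
  · have h1 : ∃ᶠ ζ in 𝓝 (0 : ℂ), ζ ≠ 0 := by
      rw [Filter.frequently_iff]
      intro U hU
      obtain ⟨U', hU', hU'o, h0⟩ := _root_.mem_nhds_iff.1 hU
      obtain ⟨ζ, hζ, h⟩ := (dense_compl_singleton (0 : ℂ)).inter_open_nonempty _ hU'o ⟨0, h0⟩
      exact ⟨ζ, hU' hζ, h⟩
    have hsc' : Filter.Tendsto F.s (𝓝 0) (𝓝 x) := by
      have h := hsc.tendsto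
      rwa [F.s_zero] at h
    refine hsc'.frequently ((h1.and_eventually (ball_mem_nhds 0 hρ)).mono ?_)
    rintro ζ ⟨h, hζ⟩
    exact hne ζ hζ h
  · rintro _ ⟨ζ, hζ, rfl⟩ h hZ'
    refine (hρp ζ hζ).2 ⟨hZ', fun h' => h ?_⟩
    have h2 := F.ψ_π_s (hρt hζ)
    rw [mem_singleton_iff.1 h', F.ψ_π] at h2
    have h3 : ζ = 0 := pow_eq_zero_iff (by have := F.one_le; omega) |>.1 h2.symm
    rw [h3, F.s_zero]
  · intro d hd u₁ u₂ h₁ h₂ h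
    have k₁ := hJ ρ (min_le_left _ _) ⟨d, hd⟩ u₁ fun ζ hζ => h₁ _ ⟨ζ, hζ, rfl⟩
    have k₂ := hJ ρ (min_le_left _ _) ⟨d, hd⟩ u₂ fun ζ hζ => h₂ _ ⟨ζ, hζ, rfl⟩
    -- The set where the germs agree is open by definition, relatively closed in the disc by unique
    -- continuation, and nonempty.
    let T : Set ℂ := {ζ | ∀ᶠ y in 𝓝 ζ, (u₁ (F.s y) : E) = u₂ (F.s y)}
    have hT : IsOpen T := isOpen_setOfPred_eventually_nhds
    have hsub : ball (0 : ℂ) ρ ⊆ T := by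
      refine (convex_ball (0 : ℂ) ρ).isPreconnected.subset_of_closure_inter_subset hT ?_ ?_
      · obtain ⟨_, ⟨ζ, hζ, rfl⟩, hw⟩ := h
        refine ⟨ζ, hζ, ?_⟩
        filter_upwards [(F.contMDiffAt_s (hρt hζ)).continuousAt.eventually hw] with y hy
        rw [hy]
      · rintro ζ ⟨hζT, hζ⟩
        obtain ⟨a1, a2⟩ := k₁ ζ hζ
        obtain ⟨b1, b2⟩ := k₂ ζ hζ
        have hn : ∀ᶠ y in 𝓝 ζ, y ∈ ball (0 : ℂ) ρ := isOpen_ball.mem_nhds hζ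
        refine eventually_eq_of_jholomorphic (J := ext0 (J.J ⟨d, hd⟩)) ?_ ?_
          (a1.of_le two_le_infty) (b1.of_le two_le_infty)
          (hn.mono fun y hy => (k₁ y hy).2) (hn.mono fun y hy => (k₂ y hy).2)
          (mem_closure_iff_frequently.1 hζT)
        · exact (contMDiffAt_iff_ext0.1 (J.smooth ⟨d, hd⟩ (u₁ (F.s ζ)))).of_le
            two_le_infty
        · rw [← map_val_nhds, Filter.eventually_map]
          refine Filter.Eventually.of_forall fun y v => ?_
          rw [ext0_coe]
          exact J.sq ⟨d, hd⟩ y v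
    rintro _ ⟨ζ, hζ, rfl⟩
    exact Subtype.ext (hsub hζ).self_of_nhds

end Lifts

end Orb

namespace Orb

/-! ### Uniqueness of the smooth map over a pseudo-holomorphic map -/

section LiftsUnique

variable {E : Type*} [NormedAddCommGroup E] [NormedSpace ℝ E] [FiniteDimensional ℝ E]
  {X : Type*} [TopologicalSpace X] {O : Orbifold E X}
  {S : Type*} [TopologicalSpace S] [T1Space S] [ChartedSpace ℂ S] [IsManifold 𝓘(ℂ) ω S]
  {f : C(S, X)}

lemma contMDiffAt_of_group {d : UChart E X} {g : d.V ≃ₜ d.V} (hg : g ∈ d.G) (y : d.V) :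
    ContMDiffAt 𝓘(ℝ, E) 𝓘(ℝ, E) ∞ g y := d.smooth g hg y

lemma π_group {d : UChart E X} {g : d.V ≃ₜ d.V} (hg : g ∈ d.G) (y : d.V) : d.π (g y) = d.π y :=
  ((d.fibre _ _).2 ⟨g, hg, rfl⟩).symm

/-- Two lifts on a good neighbourhood differ by a group element. -/
lemma GoodNhd.exists_group {Z : Set S} {c : UChart ℂ S} {x : c.V} {N : Set c.V}
    (hN : GoodNhd O f Z c x N) {d : UChart E X} (hd : d ∈ O.charts) {u₁ u₂ : c.V → d.V}
    (h₁ : ∀ w ∈ N, ContMDiffAt 𝓘(ℝ, ℂ) 𝓘(ℝ, E) ∞ u₁ w ∧ d.π (u₁ w) = f (c.π w))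
    (h₂ : ∀ w ∈ N, ContMDiffAt 𝓘(ℝ, ℂ) 𝓘(ℝ, E) ∞ u₂ w ∧ d.π (u₂ w) = f (c.π w)) :
    ∃ g ∈ d.G, ∀ w ∈ N, u₂ w = g (u₁ w) := by
  have := d.finite
  -- The lifts agree pointwise up to finitely many group elements, so one element works near some
  -- point; unique continuation then gives it on all of `N`.
  obtain ⟨g, w, hw, h⟩ := exists_eventually_mem_of_finite_cover (ι := d.G) hN.isOpen ⟨x, hN.mem⟩
    (A := fun g => {w | u₂ w = g.1 (u₁ w)})
    (fun w hw => by
      obtain ⟨g, hg, h⟩ := (d.fibre (u₁ w) (u₂ w)).1 ((h₁ w hw).2.trans (h₂ w hw).2.symm)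
      exact ⟨⟨g, hg⟩, h.symm⟩)
    (fun g w hw h => eq_of_frequently_eq (f := u₂) (g := fun w => g.1 (u₁ w))
      (h₂ w hw).1.continuousAt (g.1.continuous.continuousAt.comp (h₁ w hw).1.continuousAt) h)
  refine ⟨g.1, g.2, hN.unique d hd u₂ (fun w => g.1 (u₁ w)) h₂ (fun w hw => ?_) ⟨w, hw, h⟩⟩
  exact ⟨(contMDiffAt_of_group g.2 _).comp w (h₁ w hw).1, (π_group g.2 _).trans (h₁ w hw).2⟩

lemma LocalLift.contMDiffAt_comp_loc (m : LocalLift ℂ E f) {c : UChart ℂ S} {k : c.V → m.dom.V}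
    {w : c.V} (hk : Loc c m.dom k w) :
    ContMDiffAt 𝓘(ℝ, ℂ) 𝓘(ℝ, E) ∞ (fun w => m.toFun (k w)) w ∧
      m.cod.π (m.toFun (k w)) = f (c.π w) :=
  ⟨(m.smooth (k w)).comp w hk.contMDiffAt, by rw [m.comm, hk.comm]⟩

variable {J : AlmostComplex O} {k : ℕ} {z : Fin k → S} {OS : Orbifold ℂ S}

/-- Any two local lifts of a pseudo-holomorphic map correspond under a local change of the target,
along any given local change of the source. -/
lemma exists_loc_of_lifts (hf : IsPseudoHolomorphic J f) (hOS : IsOrbifoldSurface z OS)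
    {l m : LocalLift ℂ E f} (hl : l.dom ∈ OS.charts) (hlc : l.cod ∈ O.charts)
    (hmc : m.cod ∈ O.charts) {κ : l.dom.V → m.dom.V} {x : l.dom.V} (hκ : Loc l.dom m.dom κ x) :
    ∃ φ, Loc l.cod m.cod φ (l.toFun x) ∧ ∀ᶠ w in 𝓝 x, φ (l.toFun w) = m.toFun (κ w) := by
  have h0 : l.cod.π (l.toFun x) = m.cod.π (m.toFun (κ x)) := by
    rw [l.comm, m.comm, hκ.comm]
  obtain ⟨φ, hφ, -⟩ := (O.compatible _ hlc _ hmc).exists_loc h0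
  have hls : ContinuousAt l.toFun x := l.smooth.continuous.continuousAt
  have hW : ∀ᶠ w in 𝓝 x, Loc l.dom m.dom κ w ∧ Loc l.cod m.cod φ (l.toFun w) :=
    hκ.eventually.and (hls.eventually hφ.eventually)
  obtain ⟨n, -, ⟨F⟩⟩ := hOS.exists_localForm hl x
  obtain ⟨N, hNW, hN⟩ := F.exists_goodNhd hf (Z := ∅) finite_empty hW
  obtain ⟨g, hg, h⟩ := hN.exists_group hmc (u₁ := fun w => φ (l.toFun w))
    (u₂ := fun w => m.toFun (κ w))
    (fun w hw => ⟨(hNW hw).2.contMDiffAt.comp w (l.smooth w), by rw [(hNW hw).2.comm, l.comm]⟩)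
    (fun w hw => m.contMDiffAt_comp_loc (hNW hw).1)
  refine ⟨g ∘ φ, (loc_of_group hg _).comp hφ, ?_⟩
  filter_upwards [hN.isOpen.mem_nhds hN.mem] with w hw
  exact (h w hw).symm

lemma sameGerms_of_isPseudoHolomorphic (hf : IsPseudoHolomorphic J f)
    (hOS : IsOrbifoldSurface z OS) {l m : LocalLift ℂ E f} (hl : l.dom ∈ OS.charts)
    (hlc : l.cod ∈ O.charts) (hm : m.dom ∈ OS.charts) (hmc : m.cod ∈ O.charts) :
    l.SameGerms m := by
  intro x y hxy
  obtain ⟨h, hx, hxy'⟩ := OS.compatible _ hl _ hm x y hxy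
  obtain ⟨φ, hφ, hφ'⟩ := exists_loc_of_lifts hf hOS hl hlc hmc (h.loc hx)
  obtain ⟨h', hx', hh'⟩ := hφ.exists_change
  refine ⟨h, h', hx, hxy', hx', ?_⟩
  filter_upwards [hφ', l.smooth.continuous.continuousAt.eventually
    (h'.diffeo.open_source.mem_nhds hx')] with w h1 h2
  exact (hh' _ h2).trans h1

/-- A pseudo-holomorphic map underlies at most one smooth map of orbifolds. -/
lemma subsingleton_smoothMap (hf : IsPseudoHolomorphic J f) (hOS : IsOrbifoldSurface z OS) :
    Subsingleton (SmoothMap OS O f) := by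
  -- All local liftings between charts have the same germs, so a maximal collection must contain
  -- every one of them.
  have key : ∀ F : SmoothMap OS O f,
      F.lifts = {l | l.dom ∈ OS.charts ∧ l.cod ∈ O.charts} := fun F => by
    refine Subset.antisymm F.mem fun l hl => F.maximal l hl.1 hl.2 fun m hm => ?_
    exact sameGerms_of_isPseudoHolomorphic hf hOS hl.1 hl.2 (F.mem m hm).1 (F.mem m hm).2
  exact ⟨fun F F' => SmoothMap.ext ((key F).trans (key F').symm)⟩

end LiftsUnique

end Orb

/-! ### Multiplicities of charts on a surface -/

namespace Orb

open Metric

lemma AnalyticAt.contMDiffAt_real {R : ℂ → ℂ} {ζ : ℂ} (h : AnalyticAt ℂ R ζ) :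
    ContMDiffAt 𝓘(ℝ, ℂ) 𝓘(ℝ, ℂ) ∞ R ζ :=
  contMDiffAt_iff_contDiffAt.2 ((h.contDiffAt (n := ∞)).restrict_scalars ℝ)

lemma isLocalDiffeomorphAt_of_deriv_ne_zero {R : ℂ → ℂ} {ζ : ℂ} (h : AnalyticAt ℂ R ζ)
    (h' : deriv R ζ ≠ 0) : IsLocalDiffeomorphAt 𝓘(ℝ, ℂ) 𝓘(ℝ, ℂ) ∞ R ζ := by
  have hr := h.analyticAt_localInverse h'
  set r := h.hasStrictDerivAt.localInverse _ _ _ h' with hrdef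
  have h1 : ∀ᶠ w in 𝓝 ζ, r (R w) = w := HasStrictFDerivAt.eventually_left_inverse _
  have h2 : ∀ᶠ w in 𝓝 (R ζ), R (r w) = w := HasStrictFDerivAt.eventually_right_inverse _
  obtain ⟨U, hU, hUo, hζ⟩ := _root_.mem_nhds_iff.1 (h1.and h.eventually_analyticAt)
  obtain ⟨U', hU', hUo', hζ'⟩ := _root_.mem_nhds_iff.1 (h2.and hr.eventually_analyticAt)
  exact isLocalDiffeomorphAt_of_inv hUo hUo'
    (fun w hw => (AnalyticAt.contMDiffAt_real (hU hw).2).contMDiffWithinAt)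
    (fun w hw => (AnalyticAt.contMDiffAt_real (hU' hw).2).contMDiffWithinAt)
    (fun w hw => (hU hw).1) (fun w hw => (hU' hw).1) hζ hζ'

/-- A holomorphic change of coordinates fixing `0` lifts to the branched covering `w ↦ w ^ m`. -/
lemma exists_analytic_lift {θ : ℂ → ℂ} (hθ : AnalyticAt ℂ θ 0) (h0 : θ 0 = 0)
    (h1 : deriv θ 0 ≠ 0) {m : ℕ} (hm : 1 ≤ m) :
    ∃ R : ℂ → ℂ, AnalyticAt ℂ R 0 ∧ R 0 = 0 ∧ deriv R 0 ≠ 0 ∧ ∀ᶠ ζ in 𝓝 0, R ζ ^ m = θ (ζ ^ m) := by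
  -- As `θ z = z * u z` with `u 0 ≠ 0`, the lift is `ζ` times an `m`-th root of `u (ζ ^ m)`.
  have hu : AnalyticAt ℂ (dslope θ 0) 0 := by
    obtain ⟨p, hp⟩ := hθ
    exact ⟨_, hp.has_fpower_series_dslope_fslope⟩
  have hu' : AnalyticAt ℂ (fun ζ : ℂ => dslope θ 0 (ζ ^ m)) 0 :=
    hu.comp_of_eq (analyticAt_id.pow m) (by simp; omega)
  have hz : (0 : ℂ) ^ m = 0 := zero_pow (by omega)
  obtain ⟨r, hr, hrm⟩ := exists_analytic_root hu' (by simpa [hz] using h1) hm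
  have hr0 : r 0 ≠ 0 := fun h => by
    have h2 := hrm.self_of_nhds
    rw [h, hz, dslope_same] at h2
    exact h1 h2.symm
  refine ⟨fun ζ => ζ * r ζ, analyticAt_id.mul hr, by simp, ?_, ?_⟩
  · have : HasDerivAt (fun ζ => ζ * r ζ) (1 * r 0 + 0 * deriv r 0) 0 :=
      (hasDerivAt_id (0 : ℂ)).mul hr.differentiableAt.hasDerivAt
    rw [this.deriv]
    simpa using hr0
  · filter_upwards [hrm] with ζ hζ
    rw [mul_pow, hζ]
    have := sub_smul_dslope θ 0 (ζ ^ m)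
    simpa [h0] using this

section Multiplicity

variable {S : Type*} [TopologicalSpace S] [ChartedSpace ℂ S] [IsManifold 𝓘(ℂ) ω S]

/-- Uniformizing systems with the same multiplicity at a point are compatible there. -/
lemma LocalForm.exists_loc {c d : UChart ℂ S} {x : c.V} {y : d.V} {m : ℕ} (F : LocalForm c x m)
    (F' : LocalForm d y m) (hxy : c.π x = d.π y) : ∃ φ, Loc c d φ x ∧ φ x = y := by
  have hs : F.ψ.symm 0 = c.π x := by rw [← F.ψ_π, F.ψ.left_inv F.π_mem]
  have hs' : F'.ψ.symm 0 = d.π y := by rw [← F'.ψ_π, F'.ψ.left_inv F'.π_mem]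
  have ht : (0 : ℂ) ∈ F.ψ.target := by rw [← F.ψ_π]; exact F.ψ.map_source F.π_mem
  have ht' : (0 : ℂ) ∈ F'.ψ.target := by rw [← F'.ψ_π]; exact F'.ψ.map_source F'.π_mem
  have hm : F.ψ.symm 0 ∈ F'.ψ.source := by rw [hs, hxy]; exact F'.π_mem
  have hm' : F'.ψ.symm 0 ∈ F.ψ.source := by rw [hs', ← hxy]; exact F.π_mem
  have hθ := analyticAt_transition F.mem_atlas F'.mem_atlas ht hm
  have hθ' := analyticAt_transition F'.mem_atlas F.mem_atlas ht' hm'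
  set θ : ℂ → ℂ := fun z => F'.ψ (F.ψ.symm z) with hθd
  set θ' : ℂ → ℂ := fun z => F.ψ (F'.ψ.symm z) with hθ'd
  have hθ0 : θ 0 = 0 := by simp only [hθd]; rw [hs, hxy, F'.ψ_π]
  have hd : deriv θ 0 ≠ 0 := by
    have h1 : ∀ᶠ w in 𝓝 (0 : ℂ), θ' (θ w) = w := by
      have hc : ContinuousAt F.ψ.symm 0 := F.ψ.continuousAt_symm ht
      filter_upwards [F.ψ.open_target.mem_nhds ht,
        hc.eventually (F'.ψ.open_source.mem_nhds hm)] with w h2 h3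
      simp only [hθd, hθ'd]
      rw [F'.ψ.left_inv h3, F.ψ.right_inv h2]
    have h2 : HasDerivAt (θ' ∘ θ) (deriv θ' 0 * deriv θ 0) 0 := by
      have h3 : HasDerivAt θ' (deriv θ' 0) (θ 0) := by
        rw [hθ0]; exact hθ'.differentiableAt.hasDerivAt
      exact h3.comp 0 hθ.differentiableAt.hasDerivAt
    have h4 : HasDerivAt (θ' ∘ θ) 1 0 := (hasDerivAt_id (0 : ℂ)).congr_of_eventuallyEq h1
    intro h5
    have h6 := h2.unique h4
    rw [h5, mul_zero] at h6
    exact zero_ne_one h6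
  obtain ⟨R, hR, hR0, hRd, hRm⟩ := exists_analytic_lift hθ hθ0 hd F.one_le
  have hh : ContinuousAt F.h x := (F.h.mdifferentiableAt (by simp) F.mem_source).continuousAt
  have hh0 : Filter.Tendsto F.h (𝓝 x) (𝓝 0) := by
    have := hh.tendsto
    rwa [F.h_x] at this
  have hR0' : Filter.Tendsto R (𝓝 0) (𝓝 0) := by
    have := hR.continuousAt.tendsto
    rwa [hR0] at this
  -- In the two normal forms the change is the lift `R` of the holomorphic coordinate change `θ`.
  refine ⟨fun w => F'.s (R (F.h w)), ⟨?_, ?_⟩, by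
    change F'.s (R (F.h x)) = y
    rw [F.h_x, hR0, F'.s_zero]⟩
  · have d1 : IsLocalDiffeomorphAt 𝓘(ℝ, ℂ) 𝓘(ℝ, ℂ) ∞ F.h x := F.h.isLocalDiffeomorphAt _ _ _ F.mem_source
    have d2 : IsLocalDiffeomorphAt 𝓘(ℝ, ℂ) 𝓘(ℝ, ℂ) ∞ R (F.h x) := by
      rw [F.h_x]; exact isLocalDiffeomorphAt_of_deriv_ne_zero hR hRd
    have d3 : IsLocalDiffeomorphAt 𝓘(ℝ, ℂ) 𝓘(ℝ, ℂ) ∞ F'.s (R (F.h x)) := by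
      rw [F.h_x, hR0]
      exact F'.h.symm.isLocalDiffeomorphAt _ _ _ F'.zero_mem
    exact (d1.comp 𝓘(ℝ, ℂ) _ d2).comp 𝓘(ℝ, ℂ) _ d3
  · filter_upwards [F.h.open_source.mem_nhds F.mem_source, hh0.eventually hRm,
      (hR0'.comp hh0).eventually (F'.h.open_target.mem_nhds F'.zero_mem),
      c.continuous.continuousAt.eventually (F'.ψ.open_source.mem_nhds (by
        rw [hxy]; exact F'.π_mem : c.π x ∈ F'.ψ.source))] with w h1 h2 h3 h4
    change R (F.h w) ∈ F'.h.target at h3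
    change c.π w ∈ F'.ψ.source at h4
    rw [F'.π_s h3, h2]
    obtain ⟨h5, h6⟩ := F.form w h1
    simp only [hθd]
    rw [← h6, F.ψ.left_inv h5, F'.ψ.left_inv h4]

/-- Each of the finitely many elements that move `x` displaces a small neighbourhood of `x` from
itself. -/
lemma UChart.exists_nhds_stab {c : UChart ℂ S} (x : c.V) :
    ∃ W ∈ 𝓝 x, ∀ g ∈ c.G, ∀ w ∈ W, g w ∈ W → g x = x := by
  have := c.finite
  have h : ∀ g : c.G, ∃ W ∈ 𝓝 x, ∀ w ∈ W, g.1 w ∈ W → g.1 x = x := by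
    intro g
    by_cases hg : g.1 x = x
    · exact ⟨univ, Filter.univ_mem, fun _ _ _ => hg⟩
    · obtain ⟨U, U', hU, hU', hd⟩ := t2_separation_nhds hg
      refine ⟨U' ∩ g.1 ⁻¹' U, Filter.inter_mem hU' (g.1.continuous.continuousAt hU), ?_⟩
      rintro w ⟨-, h1⟩ ⟨h2, -⟩
      exact (disjoint_left.1 hd h1 h2).elim
  choose W hW hW' using h
  refine ⟨⋂ g, W g, Filter.iInter_mem.2 hW, fun g hg w hw hgw => ?_⟩
  exact hW' ⟨g, hg⟩ w (mem_iInter.1 hw _) (mem_iInter.1 hgw _)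

/-- The multiplicity is at most the order of the isotropy group. -/
lemma LocalForm.le_ncard_stab {c : UChart ℂ S} {x : c.V} {m : ℕ} (F : LocalForm c x m) :
    m ≤ (c.stab x).ncard := by
  obtain ⟨W, hW, hWs⟩ := c.exists_nhds_stab x
  have hsc : ContinuousAt F.s 0 := (F.contMDiffAt_s F.zero_mem).continuousAt
  obtain ⟨ρ, hρ, hρt, hρW⟩ := F.exists_ball
    (hsc.eventually (p := fun y => y ∈ W) (by rwa [F.s_zero]))
  have hm : m ≠ 0 := by have := F.one_le; omega
  have hη := Complex.isPrimitiveRoot_exp m hm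
  set η := Complex.exp (2 * Real.pi * Complex.I / m)
  have hb : ∀ j : Fin m, (ρ / 2 : ℂ) * η ^ (j : ℕ) ∈ ball (0 : ℂ) ρ := by
    intro j
    have h1 : ‖η‖ = 1 := hη.norm'_eq_one hm
    rw [mem_ball_zero_iff, norm_mul, norm_pow, h1, one_pow, mul_one, norm_div, Complex.norm_real,
      Real.norm_eq_abs, abs_of_pos hρ]
    simpa using hρ
  have hb0 : (ρ / 2 : ℂ) ∈ ball (0 : ℂ) ρ := by
    have := hb ⟨0, F.one_le⟩
    simpa using this
  -- The points `ρ / 2 * η ^ j` have the same `m`-th power, so they lie in one orbit. Group elements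
  -- carrying one to the others return to `W`, hence fix `x`, and they are distinct.
  have hex : ∀ j : Fin m, ∃ g ∈ c.G, g (F.s (ρ / 2)) = F.s (ρ / 2 * η ^ (j : ℕ)) := fun j => by
    refine (c.fibre _ _).1 ?_
    rw [F.π_s (hρt hb0), F.π_s (hρt (hb j)), mul_pow, ← pow_mul, mul_comm (j : ℕ), pow_mul,
      hη.pow_eq_one, one_pow, mul_one]
  choose g hg hg' using hex
  have hst : ∀ j, g j ∈ c.stab x := fun j =>
    ⟨hg j, hWs _ (hg j) _ (hρW _ hb0) (by rw [hg' j]; exact hρW _ (hb j))⟩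
  have := (c.finite_stab x).to_subtype
  have hinj : Function.Injective fun j => (⟨g j, hst j⟩ : c.stab x) := by
    intro i j hij
    have h1 : g i = g j := congrArg Subtype.val hij
    have h2 := hg' i
    rw [h1, hg' j] at h2
    have h3 := F.s_injOn (hρt (hb j)) (hρt (hb i)) h2
    have h4 : (ρ / 2 : ℂ) ≠ 0 := by
      simpa using hρ.ne'
    exact Fin.ext (hη.pow_inj i.2 j.2 (mul_left_cancel₀ h4 h3).symm)
  have := Nat.card_le_card_of_injective _ hinj
  simpa [Nat.card_coe_set_eq] using this

end Multiplicity

/-! ### Isotropy of source and target, and the count of orbifold structures -/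

section Isotropy

variable {E : Type*} [NormedAddCommGroup E] [NormedSpace ℝ E] [FiniteDimensional ℝ E]
  {X : Type*} [TopologicalSpace X]

/-- An injection of a uniformizing system into itself is an element of its group. -/
lemma Injection.exists_group {d : UChart E X} (i : Injection d d) :
    ∃ g : d.G, i = Injection.ofGroup g := by
  obtain ⟨x⟩ : Nonempty d.V := d.connected.nonempty.to_subtype
  obtain ⟨g, hg, h⟩ := (loc_id x).exists_group (i.loc x)
  exact ⟨⟨g, hg⟩, Injection.eq_of_eventually_eq (x := x) h⟩

variable {E' : Type*} [NormedAddCommGroup E'] [NormedSpace ℝ E'] [FiniteDimensional ℝ E']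
  {X' : Type*} [TopologicalSpace X']
  {O : Orbifold E X} {O' : Orbifold E' X'} {f : C(X, X')} {F : SmoothMap O O' f}

/-- Equivariance makes the injective homomorphism carry the isotropy group of a point into that of
its lift. -/
lemma CompatibleSystem.ncard_stab_le {ξ : CompatibleSystem F} (hξ : ξ.Mono) {α : ξ.Λ}
    (x : (ξ.lift α).dom.V) :
    ((ξ.lift α).dom.stab x).ncard ≤ ((ξ.lift α).cod.stab ((ξ.lift α).toFun x)).ncard := by
  have h : ∀ g : (ξ.lift α).dom.G, ∃ g' : (ξ.lift α).cod.G,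
      ξ.lam (Injection.ofGroup g) = Injection.ofGroup g' := fun g =>
    (ξ.lam (Injection.ofGroup g)).exists_group
  choose γ hγ using h
  have hinj : Function.Injective γ := fun a b hab => hξ α (by simp only [hγ, hab])
  have := ((ξ.lift α).cod.finite_stab ((ξ.lift α).toFun x)).to_subtype
  have := Nat.card_le_card_of_injective
    (fun g : (ξ.lift α).dom.stab x => (⟨γ ⟨g.1, g.2.1⟩, (γ ⟨g.1, g.2.1⟩).2, by
      have h1 := ξ.lift_comm (Injection.ofGroup ⟨g.1, g.2.1⟩) x
      rw [hγ] at h1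
      have h2 : (Injection.ofGroup (⟨g.1, g.2.1⟩ : (ξ.lift α).dom.G)) x = x := g.2.2
      rw [h2] at h1
      exact h1.symm⟩ : (ξ.lift α).cod.stab ((ξ.lift α).toFun x)))
    (fun a b hab => by
      have h1 : γ ⟨a.1, a.2.1⟩ = γ ⟨b.1, b.2.1⟩ := by
        apply Subtype.ext
        exact congrArg (fun g : (ξ.lift α).cod.stab ((ξ.lift α).toFun x) => g.1) hab
      have h2 := congrArg Subtype.val (hinj h1)
      exact Subtype.ext h2)
  simpa [Nat.card_coe_set_eq] using this

end Isotropy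

section Count

variable {S : Type*} [TopologicalSpace S] [ChartedSpace ℂ S] [IsManifold 𝓘(ℂ) ω S]
  {k : ℕ} {z : Fin k → S}

/-- Each maximal atlas absorbs the charts of the other. -/
lemma Orbifold.eq_of_compatible {E : Type*} [NormedAddCommGroup E] [NormedSpace ℝ E]
    {X : Type*} [TopologicalSpace X] {O O' : Orbifold E X}
    (h : ∀ c ∈ O.charts, ∀ d ∈ O'.charts, Compatible c d ∧ Compatible d c) : O = O' :=
  Orbifold.ext (Subset.antisymm (fun c hc => O'.maximal c fun d hd => (h c hc d hd).1)
    fun d hd => O.maximal d fun c hc => (h c hc d hd).2)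

/-- Two orbifold structures with the same multiplicities agree. -/
lemma orbifold_eq_of_localForm {OS OS' : Orbifold ℂ S}
    (h : ∀ p : S, ∃ m, ∃ c ∈ OS.charts, ∃ d ∈ OS'.charts, ∃ (x : c.V) (y : d.V),
      c.π x = p ∧ d.π y = p ∧ Nonempty (LocalForm c x m) ∧ Nonempty (LocalForm d y m)) :
    OS = OS' := by
  have key : ∀ c ∈ OS.charts, ∀ d ∈ OS'.charts, ∀ (x : c.V) (y : d.V), c.π x = d.π y →
      (∃ φ, Loc c d φ x ∧ φ x = y) ∧ ∃ φ, Loc d c φ y ∧ φ y = x := by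
    intro c hc d hd x y hxy
    obtain ⟨m, c', hc', d', hd', x', y', hx', hy', ⟨F⟩, ⟨F'⟩⟩ := h (c.π x)
    obtain ⟨a, ha, rfl⟩ := (OS.compatible c hc c' hc').exists_loc hx'.symm
    obtain ⟨b, hb, rfl⟩ := (OS'.compatible d' hd' d hd).exists_loc (hy'.trans hxy)
    obtain ⟨φ, hφ, h1⟩ := F.exists_loc F' (hx'.trans hy'.symm)
    have h2 : Loc c d (b ∘ φ ∘ a) x := by
      refine Loc.comp ?_ (hφ.comp ha)
      change Loc d' d b (φ (a x))
      rwa [h1]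
    have h3 : (b ∘ φ ∘ a) x = b y' := congrArg b h1
    refine ⟨⟨_, h2, h3⟩, ?_⟩
    obtain ⟨ψ, hψ, h4, -⟩ := h2.exists_inv
    rw [h3] at hψ h4
    exact ⟨ψ, hψ, h4⟩
  refine Orbifold.eq_of_compatible fun c hc d hd => ⟨fun x y hxy => ?_, fun y x hxy => ?_⟩
  · obtain ⟨⟨φ, hφ, rfl⟩, -⟩ := key c hc d hd x y hxy
    obtain ⟨k, hk, hk'⟩ := hφ.exists_change
    exact ⟨k, hk, hk' x hk⟩
  · obtain ⟨-, φ, hφ, rfl⟩ := key c hc d hd x y hxy.symm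
    obtain ⟨k, hk, hk'⟩ := hφ.exists_change
    exact ⟨k, hk, hk' y hk⟩

variable {E : Type*} [NormedAddCommGroup E] [NormedSpace ℝ E] [FiniteDimensional ℝ E]
  {X : Type*} [TopologicalSpace X] {O : Orbifold E X} {f : C(S, X)}

/-- The multiplicity is bounded by the isotropy order in the source, which a compatible system
embeds in the isotropy of the target. -/
lemma exists_localForm_le {M : ℕ}
    (hM : ∀ c ∈ O.charts, ∀ x : c.V, c.π x ∈ range f → (c.stab x).ncard ≤ M) {OS : Orbifold ℂ S}
    (hOS : IsOrbifoldSurface z OS) (h : Nonempty (GoodLifts OS O f)) (p : S) :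
    ∃ m ≤ M, (m ≠ 1 → p ∈ range z) ∧ ∃ c ∈ OS.charts, ∃ x : c.V, c.π x = p ∧
      Nonempty (LocalForm c x m) := by
  obtain ⟨F, q⟩ := h
  obtain ⟨⟨ξ, hξ⟩, -⟩ := Quot.exists_rep q
  obtain ⟨α, x, rfl⟩ := ξ.cover p
  have hα := F.mem _ (ξ.lift_mem α)
  obtain ⟨m, hm, ⟨L⟩⟩ := hOS.exists_localForm hα.1 x
  refine ⟨m, ?_, hm, _, hα.1, x, rfl, ⟨L⟩⟩
  exact (L.le_ncard_stab.trans (CompatibleSystem.ncard_stab_le hξ x)).trans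
    (hM _ hα.2 _ ⟨_, ((ξ.lift α).comm x).symm⟩)

/-- The number of orbifold structures for which there is a good lift is bounded. -/
theorem finite_orbifold_of_isotropy_le {M : ℕ}
    (hM : ∀ c ∈ O.charts, ∀ x : c.V, c.π x ∈ range f → (c.stab x).ncard ≤ M) :
    ∃ ι : {OS : Orbifold ℂ S | IsOrbifoldSurface z OS ∧ Nonempty (GoodLifts OS O f)} →
      (Fin k → Fin (M + 1)), Function.Injective ι := by
  have h := fun (OS : {OS : Orbifold ℂ S | IsOrbifoldSurface z OS ∧ Nonempty (GoodLifts OS O f)}) =>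
    exists_localForm_le hM OS.2.1 OS.2.2
  choose m hm hz c hc x hx hF using h
  -- The structure is encoded by its multiplicities at the marked points; elsewhere they are `1`.
  -- The bound `m ≤ M` places them in `Fin (M + 1)`.
  refine ⟨fun OS i => ⟨m OS (z i), Nat.lt_succ_of_le (hm _ _)⟩, fun OS OS' hO => ?_⟩
  have h1 : ∀ p, m OS p = m OS' p := by
    intro p
    by_cases hp : p ∈ range z
    · obtain ⟨i, rfl⟩ := hp
      exact congrArg Fin.val (congrFun hO i)
    · rw [not_not.1 fun h => hp (hz OS p h), not_not.1 fun h => hp (hz OS' p h)]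
  refine Subtype.ext (orbifold_eq_of_localForm fun p => ⟨m OS p, c OS p, hc OS p, c OS' p,
    hc OS' p, x OS p, x OS' p, hx OS p, hx OS' p, hF OS p, ?_⟩)
  rw [h1]
  exact hF OS' p

end Count

end Orb

/-! ### Local systems of isomorphisms and gluing bounds -/

namespace Orb

/-- A family of covering spaces of isomorphisms between the objects of `Ξ`, the germs of whose
sections are represented by functions to a group `H`. -/
structure LocSys (B H Ξ : Type*) [TopologicalSpace B] [Group H] (M : ℕ) where
  germ : Ξ → Ξ → B → Set (B → H)
  eventually : ∀ {ξ η p τ}, τ ∈ germ ξ η p → ∀ᶠ q in 𝓝 p, τ ∈ germ ξ η q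
  even : ∀ ξ η p, ∃ U, IsOpen U ∧ p ∈ U ∧ ∃ 𝒯 : Set (B → H), (∀ τ ∈ 𝒯, ∀ q ∈ U, τ ∈ germ ξ η q) ∧
    ∀ q ∈ U, ∀ τ ∈ germ ξ η q, ∃! τ', τ' ∈ 𝒯 ∧ τ' q = τ q
  unique : ∀ {ξ η p τ τ'}, τ ∈ germ ξ η p → τ' ∈ germ ξ η p → τ p = τ' p →
    ∀ᶠ q in 𝓝 p, τ q = τ' q
  div : ∀ {ζ ξ η p τ τ'}, τ ∈ germ ζ ξ p → τ' ∈ germ ζ η p → τ' * τ⁻¹ ∈ germ ξ η p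
  one_le : 1 ≤ M
  fibre : ∀ ξ p, ∃ e : H → Fin M, InjOn e {h | ∃ τ ∈ germ ξ ξ p, τ p = h}
  nonempty : ∀ ξ η p, (germ ξ η p).Nonempty

namespace LocSys

variable {B H Ξ : Type*} [TopologicalSpace B] [Group H] {M : ℕ} (𝓛 : LocSys B H Ξ M)
  {T : Type*} [TopologicalSpace T] {T' : Type*} [TopologicalSpace T']

/-- Sections of the pull-back by `φ`. -/
def IsSec (ξ η : Ξ) (φ : T → B) (s : T → H) : Prop :=
  ∀ t, ∃ τ ∈ 𝓛.germ ξ η (φ t), ∀ᶠ t' in 𝓝 t, s t' = τ (φ t')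

variable {𝓛} {ζ ξ η : Ξ} {φ : T → B} {s s' : T → H}

lemma IsSec.mem (h : 𝓛.IsSec ξ η φ s) (t : T) : ∃ τ ∈ 𝓛.germ ξ η (φ t), τ (φ t) = s t := by
  obtain ⟨τ, h1, h2⟩ := h t
  exact ⟨τ, h1, h2.self_of_nhds.symm⟩

lemma IsSec.comp (h : 𝓛.IsSec ξ η φ s) {ψ : T' → T} (hψ : Continuous ψ) :
    𝓛.IsSec ξ η (φ ∘ ψ) (s ∘ ψ) := fun t => by
  obtain ⟨τ, h1, h2⟩ := h (ψ t)
  exact ⟨τ, h1, hψ.continuousAt.eventually h2⟩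

lemma IsSec.div (h : 𝓛.IsSec ζ ξ φ s) (h' : 𝓛.IsSec ζ η φ s') : 𝓛.IsSec ξ η φ (s' * s⁻¹) :=
  fun t => by
  obtain ⟨τ, h1, h2⟩ := h t
  obtain ⟨τ', h1', h2'⟩ := h' t
  refine ⟨_, 𝓛.div h1 h1', ?_⟩
  filter_upwards [h2, h2'] with t' h3 h4
  simp [h3, h4]

/-- The quotient of a germ by itself is the identity; inverses and composites likewise come from the
single axiom `div`. -/
lemma IsSec.one : 𝓛.IsSec ξ ξ φ 1 := fun t => by
  obtain ⟨τ, hτ⟩ := 𝓛.nonempty ξ ξ (φ t)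
  exact ⟨_, 𝓛.div hτ hτ, Filter.Eventually.of_forall fun _ => by simp⟩

lemma IsSec.inv (h : 𝓛.IsSec ξ η φ s) : 𝓛.IsSec η ξ φ s⁻¹ := by
  simpa using h.div IsSec.one

lemma IsSec.eventually_eq (h : 𝓛.IsSec ξ η φ s) (h' : 𝓛.IsSec ξ η φ s') (hφ : Continuous φ)
    {t : T} (ht : s t = s' t) : ∀ᶠ t' in 𝓝 t, s t' = s' t' := by
  obtain ⟨τ, h1, h2⟩ := h t
  obtain ⟨τ', h1', h2'⟩ := h' t
  have := 𝓛.unique h1 h1' (by rw [← h2.self_of_nhds, ← h2'.self_of_nhds, ht])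
  filter_upwards [h2, h2', hφ.continuousAt.eventually this] with t' h3 h4 h5
  rw [h3, h4, h5]

/-- Over an evenly covered set each section follows one sheet, and sheets that meet at one point
coincide. This is separatedness of the covering. -/
lemma IsSec.eventually_ne (h : 𝓛.IsSec ξ η φ s) (h' : 𝓛.IsSec ξ η φ s') (hφ : Continuous φ)
    {t : T} (ht : s t ≠ s' t) : ∀ᶠ t' in 𝓝 t, s t' ≠ s' t' := by
  obtain ⟨τ, h1, h2⟩ := h t
  obtain ⟨τ', h1', h2'⟩ := h' t
  obtain ⟨U, hU, htU, 𝒯, h𝒯, hu⟩ := 𝓛.even ξ η (φ t)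
  obtain ⟨σ, ⟨hσ, e⟩, -⟩ := hu _ htU τ h1
  obtain ⟨σ', ⟨hσ', e'⟩, -⟩ := hu _ htU τ' h1'
  have k := 𝓛.unique (h𝒯 σ hσ _ htU) h1 e
  have k' := 𝓛.unique (h𝒯 σ' hσ' _ htU) h1' e'
  filter_upwards [h2, h2', hφ.continuousAt.eventually k, hφ.continuousAt.eventually k',
    hφ.continuousAt.eventually (hU.mem_nhds htU)] with t' a a' b b' hU'
  intro hs
  have h5 : σ (φ t') = σ' (φ t') := by rw [b, b', ← a, ← a', hs]
  obtain ⟨σ'', -, h6⟩ := hu _ hU' σ (h𝒯 σ hσ _ hU')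
  have h7 : σ = σ' := (h6 σ ⟨hσ, rfl⟩).trans (h6 σ' ⟨hσ', h5.symm⟩).symm
  rw [h2.self_of_nhds, h2'.self_of_nhds, ← e, ← e', h7] at ht
  exact ht rfl

lemma IsSec.eq_of_preconnected [PreconnectedSpace T] (h : 𝓛.IsSec ξ η φ s)
    (h' : 𝓛.IsSec ξ η φ s') (hφ : Continuous φ) {t : T} (ht : s t = s' t) : s = s' := by
  have hc : IsClopen {t | s t = s' t} := by
    refine ⟨⟨isOpen_iff_mem_nhds.2 fun t ht => ?_⟩, isOpen_iff_mem_nhds.2 fun t ht => ?_⟩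
    · exact h.eventually_ne h' hφ ht
    · exact h.eventually_eq h' hφ ht
  have := hc.eq_univ ⟨t, ht⟩
  exact funext fun t => (this ▸ mem_univ t : t ∈ {t | s t = s' t})

/-! ### The covering space of isomorphisms -/

variable (𝓛) (ξ η)

/-- The space of all values of germs. -/
def Total : Type _ := {e : B × H // ∃ τ ∈ 𝓛.germ ξ η e.1, τ e.1 = e.2}

variable {ξ η}

/-- The étalé topology: with a value, an open set contains the nearby values of every germ through
it. -/
instance : TopologicalSpace (𝓛.Total ξ η) where
  IsOpen O := ∀ e ∈ O, ∀ τ ∈ 𝓛.germ ξ η e.1.1, τ e.1.1 = e.1.2 →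
    ∀ᶠ q in 𝓝 e.1.1, ∀ h, (⟨(q, τ q), h⟩ : 𝓛.Total ξ η) ∈ O
  isOpen_univ := fun _ _ _ _ _ => Filter.Eventually.of_forall fun _ _ => mem_univ _
  isOpen_inter := fun _ _ h h' e he τ hτ hτe =>
    ((h e he.1 τ hτ hτe).and (h' e he.2 τ hτ hτe)).mono fun _ hq hh => ⟨hq.1 hh, hq.2 hh⟩
  isOpen_sUnion := fun _ h e ⟨O, hO, he⟩ τ hτ hτe =>
    (h O hO e he τ hτ hτe).mono fun _ hq hh => ⟨O, hO, hq hh⟩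

variable {𝓛}

lemma Total.isOpen_iff {O : Set (𝓛.Total ξ η)} : IsOpen O ↔
    ∀ e ∈ O, ∀ τ ∈ 𝓛.germ ξ η e.1.1, τ e.1.1 = e.1.2 →
      ∀ᶠ q in 𝓝 e.1.1, ∀ h, (⟨(q, τ q), h⟩ : 𝓛.Total ξ η) ∈ O := Iff.rfl

/-- The projection to the base. -/
def Total.proj (e : 𝓛.Total ξ η) : B := e.1.1

lemma Total.continuous_proj : Continuous (Total.proj : 𝓛.Total ξ η → B) := by
  refine continuous_def.2 fun V hV => Total.isOpen_iff.2 fun e he τ _ _ => ?_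
  filter_upwards [hV.mem_nhds he] with q hq _ using hq

lemma Total.isOpen_sheet {W : Set B} (hW : IsOpen W) {τ : B → H}
    (hτ : ∀ q ∈ W, τ ∈ 𝓛.germ ξ η q) :
    IsOpen {e : 𝓛.Total ξ η | e.1.1 ∈ W ∧ e.1.2 = τ e.1.1} := by
  refine Total.isOpen_iff.2 fun e he τ' hτ' hτe => ?_
  filter_upwards [hW.mem_nhds he.1, 𝓛.unique hτ' (hτ _ he.1) (hτe.trans he.2)] with q h1 h2 _
  exact ⟨h1, h2⟩

/-- The sheets over an evenly covered `U` are indexed by the family `𝒯`, taken as a discrete space.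
-/
lemma Total.isCoveringMap : IsCoveringMap (Total.proj : 𝓛.Total ξ η → B) := by
  intro p
  obtain ⟨U, hU, hp, 𝒯, h𝒯, hu⟩ := 𝓛.even ξ η p
  let _ : TopologicalSpace 𝒯 := ⊥
  have : DiscreteTopology 𝒯 := ⟨rfl⟩
  have hex : ∀ e : (Total.proj : 𝓛.Total ξ η → B) ⁻¹' U, ∃ τ : 𝒯, τ.1 e.1.1.1 = e.1.1.2 := by
    intro e
    obtain ⟨τ, hτ, h⟩ := e.1.2
    obtain ⟨σ, ⟨hσ, h1⟩, -⟩ := hu _ e.2 τ hτ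
    exact ⟨⟨σ, hσ⟩, h1.trans h⟩
  choose σ hσ using hex
  have huniq : ∀ (q : B), q ∈ U → ∀ τ τ' : 𝒯, τ.1 q = τ'.1 q → τ = τ' := by
    intro q hq τ τ' h
    obtain ⟨σ, -, h1⟩ := hu q hq τ.1 (h𝒯 _ τ.2 q hq)
    exact Subtype.ext ((h1 τ.1 ⟨τ.2, rfl⟩).trans (h1 τ'.1 ⟨τ'.2, h.symm⟩).symm)
  have hev : IsEvenlyCovered (Total.proj : 𝓛.Total ξ η → B) p 𝒯 := by
    refine ⟨inferInstance, U, hp, hU, hU.preimage Total.continuous_proj,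
      { toFun := fun e => (⟨e.1.1.1, e.2⟩, σ e)
        invFun := fun x => ⟨⟨(x.1.1, x.2.1 x.1.1), x.2.1, h𝒯 _ x.2.2 _ x.1.2, rfl⟩, x.1.2⟩
        left_inv := ?_
        right_inv := ?_
        continuous_toFun := ?_
        continuous_invFun := ?_ }, fun _ => rfl⟩
    · intro e
      exact Subtype.ext (Subtype.ext (Prod.ext rfl (hσ e)))
    · intro x
      exact Prod.ext rfl (huniq x.1.1 x.1.2 _ _ (hσ _))
    · refine ((Total.continuous_proj.comp continuous_subtype_val).subtype_mk _).prodMk ?_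
      refine continuous_def.2 fun A _ => ?_
      have : σ ⁻¹' A = ⋃ τ ∈ A, Subtype.val ⁻¹'
          {e : 𝓛.Total ξ η | e.1.1 ∈ U ∧ e.1.2 = τ.1 e.1.1} := by
        ext e
        simp only [mem_preimage, mem_iUnion, exists_prop]
        constructor
        · exact fun h => ⟨_, h, e.2, (hσ e).symm⟩
        · rintro ⟨τ, hτ, -, h⟩
          rwa [huniq _ e.2 (σ e) τ ((hσ e).trans h)]
      rw [this]
      exact isOpen_biUnion fun τ _ =>
        (Total.isOpen_sheet hU (h𝒯 τ.1 τ.2)).preimage continuous_subtype_val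
    · rw [continuous_prod_of_discrete_right]
      intro τ
      refine Continuous.subtype_mk ?_ _
      refine continuous_def.2 fun O hO => isOpen_iff_mem_nhds.2 fun q hq => ?_
      have := Total.isOpen_iff.1 hO _ hq τ.1 (h𝒯 _ τ.2 _ q.2) rfl
      exact (continuous_subtype_val.continuousAt.eventually this).mono fun q' h => h _
  exact hev.to_isEvenlyCovered_preimage

/-! ### Bounds for the number of isomorphism classes -/

variable (𝓛)

/-- The objects, pulled back by `φ`, have at most `N` isomorphism classes. -/
def Bd (φ : T → B) (N : ℕ) : Prop :=
  ∃ (K : Type) (_ : Finite K) (I : Ξ → K), Nat.card K ≤ N ∧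
    ∀ ξ η, I ξ = I η → ∃ s, 𝓛.IsSec ξ η φ s

variable {𝓛}

lemma Bd.comp {N : ℕ} (h : 𝓛.Bd φ N) {ψ : T' → T} (hψ : Continuous ψ) : 𝓛.Bd (φ ∘ ψ) N := by
  obtain ⟨K, hK, I, h1, h2⟩ := h
  exact ⟨K, hK, I, h1, fun ξ η hI => (h2 ξ η hI).imp' _ fun _ hs => hs.comp hψ⟩

lemma Bd.of_forall (h : ∀ ξ η, ∃ s, 𝓛.IsSec ξ η φ s) : 𝓛.Bd φ 1 :=
  ⟨Unit, inferInstance, fun _ => (), by simp, fun ξ η _ => h ξ η⟩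

open unitInterval in
/-- The objects become isomorphic over a contractible space. -/
lemma exists_isSec_of_contraction (hφ : Continuous φ) (G : C(I × T, T)) (t₀ : T)
    (h0 : ∀ t, G (0, t) = t₀) (h1 : ∀ t, G (1, t) = t) (ξ η : Ξ) : ∃ s, 𝓛.IsSec ξ η φ s := by
  obtain ⟨τ₀, hτ₀⟩ := 𝓛.nonempty ξ η (φ t₀)
  let e₀ : 𝓛.Total ξ η := ⟨(φ t₀, τ₀ (φ t₀)), τ₀, hτ₀, rfl⟩
  have h0' : ∀ t, ((⟨φ, hφ⟩ : C(T, B)).comp G) (0, t) = Total.proj (ContinuousMap.const T e₀ t) :=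
    fun t => congrArg φ (h0 t)
  -- The contraction, started at a constant lift over `φ t₀`, lifts to the covering; its end at time
  -- `1` is a section along `φ`.
  let Γ := Total.isCoveringMap.liftHomotopy ((⟨φ, hφ⟩ : C(T, B)).comp G) (.const T e₀)
    h0'
  have hΓ : ∀ t, Total.proj (Γ (1, t)) = φ t := fun t => by
    have := congrFun (Total.isCoveringMap.liftHomotopy_lifts ((⟨φ, hφ⟩ : C(T, B)).comp G)
      (.const T e₀) h0') (1, t)
    exact this.trans (congrArg φ (h1 t))
  refine ⟨fun t => (Γ (1, t)).1.2, fun t => ?_⟩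
  obtain ⟨τ, hτ, hτe⟩ := (Γ (1, t)).2
  have e1 : (Γ (1, t)).1.1 = φ t := hΓ t
  rw [e1] at hτ
  obtain ⟨W, hW, hWo, htW⟩ := _root_.mem_nhds_iff.1 (𝓛.eventually hτ)
  have hO := Total.isOpen_sheet hWo hW
  have hc : Continuous fun t => Γ (1, t) := by fun_prop
  refine ⟨τ, hτ, ?_⟩
  filter_upwards [hc.continuousAt.eventually (hO.mem_nhds ⟨by rw [e1]; exact htW, hτe.symm⟩)]
    with t' ht'
  rw [ht'.2]
  exact congrArg τ (hΓ t')

lemma exists_isSec_sigma {ι : Type*} {Y : ι → Type*} [∀ i, TopologicalSpace (Y i)]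
    {φ : (Σ i, Y i) → B} (h : ∀ i, ∃ s, 𝓛.IsSec ξ η (fun y : Y i => φ ⟨i, y⟩) s) :
    ∃ s, 𝓛.IsSec ξ η φ s := by
  choose s hs using h
  refine ⟨fun x => s x.1 x.2, fun ⟨i, y⟩ => ?_⟩
  obtain ⟨τ, h1, h2⟩ := hs i y
  refine ⟨τ, h1, ?_⟩
  rw [Sigma.nhds_mk, Filter.eventually_map]
  exact h2

/-- Sections descend along closed surjections. -/
lemma IsSec.desc {Y : Type*} [TopologicalSpace Y] {q : T → Y} (hq : Continuous q)
    (hqs : Function.Surjective q) (hqc : IsClosedMap q) {φ : Y → B} (hφ : Continuous φ)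
    (h : 𝓛.IsSec ξ η (φ ∘ q) s) (hs : ∀ t t', q t = q t' → s t = s t') :
    ∃ s', 𝓛.IsSec ξ η φ s' := by
  choose r hr using hqs
  refine ⟨fun y => s (r y), fun y => ?_⟩
  obtain ⟨τ, h1, h2⟩ := h (r y)
  have h1' : τ ∈ 𝓛.germ ξ η (φ y) := by rwa [Function.comp_apply, hr] at h1
  refine ⟨τ, h1', ?_⟩
  have key : ∀ t, q t = y → ∀ᶠ t' in 𝓝 t, s t' = τ (φ (q t')) := by
    intro t ht
    obtain ⟨σ, h3, h4⟩ := h t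
    have h3' : σ ∈ 𝓛.germ ξ η (φ y) := by rwa [Function.comp_apply, ht] at h3
    have h5 : σ (φ y) = τ (φ y) := by
      have a := h4.self_of_nhds
      have b := h2.self_of_nhds
      simp only [Function.comp_apply, ht, hr] at a b
      rw [← a, ← b, hs t (r y) (by rw [ht, hr])]
    have h6 := 𝓛.unique h3' h1' h5
    rw [← ht] at h6
    filter_upwards [h4, (hφ.comp hq).continuousAt.eventually h6] with t' a b
    rw [a]
    exact b
  -- Near every point of the fibre over `y` the section equals `τ`, so `C` misses this fibre. As `q`
  -- is closed, `C` misses all nearby fibres as well.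
  let C : Set T := closure {t' | s t' ≠ τ (φ (q t'))}
  have hC : y ∉ q '' C := by
    rintro ⟨t, ht, hty⟩
    exact (mem_closure_iff_frequently.1 ht) ((key t hty).mono fun _ h h' => h' h)
  filter_upwards [(hqc C isClosed_closure).isOpen_compl.mem_nhds hC] with y' hy'
  by_contra hne
  refine hy' ⟨r y', subset_closure ?_, hr y'⟩
  change s (r y') ≠ τ (φ (q (r y')))
  rwa [hr]

/-- Gluing along finitely many connected identifications. -/
lemma Bd.glue {Y : Type*} [TopologicalSpace Y] {q : T → Y} (hq : Continuous q)
    (hqs : Function.Surjective q) (hqc : IsClosedMap q) {φ : Y → B} (hφ : Continuous φ)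
    {N : ℕ} (h : 𝓛.Bd (φ ∘ q) N) {ι : Type} [Finite ι] {L : ι → Type*}
    [∀ c, TopologicalSpace (L c)] [∀ c, PreconnectedSpace (L c)] (l r : ∀ c, L c → T)
    (hl : ∀ c, Continuous (l c)) (hr : ∀ c, Continuous (r c))
    (hlr : ∀ c x, q (l c x) = q (r c x))
    (hrel : ∀ t t', q t = q t' →
      Relation.EqvGen (fun a b => ∃ c x, l c x = a ∧ r c x = b) t t') :
    𝓛.Bd φ (N * M ^ Nat.card ι) := by
  classical
  obtain ⟨K, hK, I, hcard, hI⟩ := h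
  have hrep : ∃ ρ : Ξ → Ξ, (∀ ξ, I (ρ ξ) = I ξ) ∧ ∀ ξ η, I ξ = I η → ρ ξ = ρ η := by
    have : ∀ k : range I, ∃ ξ, I ξ = k := fun k => k.2
    choose ρ hρ using this
    exact ⟨fun ξ => ρ ⟨I ξ, ξ, rfl⟩, fun ξ => hρ _, fun ξ η h => by simp only [h]⟩
  obtain ⟨ρ, hρ, hρ'⟩ := hrep
  -- Every object is trivialised over `T` by an isomorphism from the representative `ρ ξ` of its
  -- class.
  choose σ hσ using fun ξ => hI (ρ ξ) ξ (hρ ξ)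
  choose e he using 𝓛.fibre
  have hlr' : ∀ c, (φ ∘ q) ∘ l c = (φ ∘ q) ∘ r c := fun c => funext fun x =>
    congrArg φ (hlr c x)
  -- The mismatch of the trivialisation along the gluing `c` is an automorphism of `ρ ξ`. One point
  -- of the connected set `L c` is enough to record it, and `M` labels suffice. For empty `L c` the
  -- label is irrelevant.
  let d : Ξ → ι → Fin M := fun ξ c => if h : Nonempty (L c) then
    e (ρ ξ) (φ (q (l c h.some))) ((σ ξ (r c h.some))⁻¹ * σ ξ (l c h.some)) else ⟨0, 𝓛.one_le⟩
  refine ⟨K × (ι → Fin M), inferInstance, fun ξ => (I ξ, d ξ), ?_, fun ξ η hd => ?_⟩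
  · rw [Nat.card_prod, Nat.card_fun, Nat.card_eq_fintype_card (α := Fin M), Fintype.card_fin]
    exact Nat.mul_le_mul_right _ hcard
  obtain ⟨hd1, hd2⟩ := Prod.mk.inj hd
  have hρe := hρ' ξ η hd1
  have hsec : 𝓛.IsSec ξ η (φ ∘ q) (σ η * (σ ξ)⁻¹) := by
    have h1 := hσ η
    rw [← hρe] at h1
    exact (hσ ξ).div h1
  have hD : ∀ ξ c, 𝓛.IsSec (ρ ξ) (ρ ξ) ((φ ∘ q) ∘ l c) ((σ ξ ∘ r c)⁻¹ * σ ξ ∘ l c) := by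
    intro ξ c
    have h1 := ((hσ ξ).comp (hl c)).inv
    have h2 := ((hσ ξ).comp (hr c)).inv
    rw [← hlr'] at h2
    simpa using h1.div h2
  -- Equal mismatches at one point make the two pulled-back sections agree there, hence on all of `L
  -- c` by connectedness.
  have heq : ∀ c x, (σ η * (σ ξ)⁻¹) (l c x) = (σ η * (σ ξ)⁻¹) (r c x) := by
    intro c x
    have hne : Nonempty (L c) := ⟨x⟩
    have h1 := congrFun hd2 c
    simp only [d, dif_pos hne, ← hρe] at h1
    have h2 := he (ρ ξ) (φ (q (l c hne.some))) ((hD ξ c).mem hne.some)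
      (by have := (hD η c).mem hne.some; rwa [← hρe] at this) h1
    have hsl := hsec.comp (hl c)
    have hsr := hsec.comp (hr c)
    rw [← hlr'] at hsr
    refine congrFun (hsl.eq_of_preconnected hsr ((hφ.comp hq).comp (hl c)) (t := hne.some) ?_) x
    simp only [Pi.mul_apply, Pi.inv_apply, Function.comp_apply] at h2 ⊢
    rw [mul_inv_eq_iff_eq_mul, mul_assoc, h2]
    simp
  refine IsSec.desc hq hqs hqc hφ hsec fun t t' htt' => ?_
  have hg := hrel t t' htt'
  clear htt'
  induction hg with
  | rel a b h =>
    obtain ⟨c, x, rfl, rfl⟩ := h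
    exact heq c x
  | refl a => rfl
  | symm a b h ih => exact ih.symm
  | trans a b c h1 h2 ih1 ih2 => exact ih1.trans ih2

end LocSys

end Orb

/-! ### The bound for a punctured disc -/

namespace Orb

open Metric

/-- The complement of a finite subset of the line splits into intervals, labelled by the number of
removed points to their left. The count jumps across each removed point. -/
lemma ordConnected_count (F : Finset ℝ) (j : ℕ) :
    OrdConnected {s : ℝ | s ∉ F ∧ (F.filter (· < s)).card = j} := by
  refine ⟨fun x hx y hy t ht => ?_⟩
  have h1 : F.filter (· < x) ⊆ F.filter (· < t) :=
    Finset.monotone_filter_right F fun a _ (h : a < x) => h.trans_le ht.1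
  have h2 : F.filter (· < t) ⊆ F.filter (· < y) :=
    Finset.monotone_filter_right F fun a _ (h : a < t) => h.trans_le ht.2
  have c1 := Finset.card_le_card h1
  have c2 := Finset.card_le_card h2
  refine ⟨fun htF => ?_, le_antisymm (c2.trans hy.2.le) (hx.2.symm.le.trans c1)⟩
  have hty : t < y := lt_of_le_of_ne ht.2 fun h => hy.1 (h ▸ htF)
  have h3 : F.filter (· < t) ⊂ F.filter (· < y) := by
    refine Finset.ssubset_iff_of_subset h2 |>.2 ⟨t, by simp [htF, hty], by simp⟩
  have := Finset.card_lt_card h3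
  have e1 := hx.2
  have e2 := hy.2
  omega

lemma count_le (F : Finset ℝ) (s : ℝ) : (F.filter (· < s)).card < F.card + 1 :=
  Nat.lt_succ_of_le (Finset.card_filter_le _ _)

namespace LocSys

variable {B H Ξ : Type*} [TopologicalSpace B] [Group H] {M : ℕ} {𝓛 : LocSys B H Ξ M}

lemma Bd.mono {T : Type*} [TopologicalSpace T] {φ : T → B} {N N' : ℕ} (h : 𝓛.Bd φ N)
    (hN : N ≤ N') : 𝓛.Bd φ N' := by
  obtain ⟨K, hK, I, h1, h2⟩ := h
  exact ⟨K, hK, I, h1.trans hN, h2⟩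

/-- A vertical strip of a punctured convex set is star-shaped. -/
lemma exists_isSec_strip {T : Set ℂ} {c : ℝ} (hc : (c : ℂ) ∈ T)
    (hstar : ∀ x ∈ T, ∀ t : ℝ, 0 ≤ t → t < 1 → ((1 - t) * c + t * x : ℂ) ∈ T)
    {φ : T → B} (hφ : Continuous φ) (ξ η : Ξ) : ∃ s, 𝓛.IsSec ξ η φ s := by
  have hmem : ∀ (t : unitInterval) (x : T), ((1 - (t : ℝ)) * c + (t : ℝ) * x : ℂ) ∈ T := by
    intro t x
    rcases t.2.2.lt_or_eq with h | h
    · exact hstar x x.2 t t.2.1 h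
    · rw [h]
      simp
  refine exists_isSec_of_contraction hφ
    ⟨fun x => ⟨((1 - (x.1 : ℝ)) * c + (x.1 : ℝ) * x.2 : ℂ), hmem x.1 x.2⟩, by fun_prop⟩
    ⟨c, hc⟩ (fun t => ?_) (fun t => ?_) ξ η
  · exact Subtype.ext (by simp)
  · exact Subtype.ext (by simp)

/-- The punctured disc has a bounded number of classes. -/
lemma bd_disc {Q : Set ℂ} (hQ : Convex ℝ Q) (hQ' : ∀ x : ℝ, x ∈ Ioo (-1) 1 → (x : ℂ) ∈ Q)
    (hQre : ∀ x ∈ Q, x.re ∈ Icc (-1) 1) (P : Finset ℂ)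
    {φ : {x : ℂ // x ∈ Q ∧ x ∉ P} → B} (hφ : Continuous φ) :
    𝓛.Bd φ (M ^ ((P.card + 1) * ((P.card + 1) * (P.card + 1)))) := by
  classical
  -- Cuts are made along the vertical lines through the punctures, so the interiors of the strips
  -- contain none. The value `-1` starts the leftmost strip.
  let A : Finset ℝ := insert (-1) ((P.image Complex.re).filter (· ∈ Ioo (-1 : ℝ) 1))
  have hA1 : (-1 : ℝ) ∈ A := Finset.mem_insert_self _ _
  have hA : ∀ a ∈ A, -1 ≤ a ∧ a < 1 := by
    intro a ha
    rcases Finset.mem_insert.1 ha with rfl | h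
    · norm_num
    · exact ⟨(Finset.mem_filter.1 h).2.1.le, (Finset.mem_filter.1 h).2.2⟩
  have hAP : ∀ p ∈ P, p.re ∈ Ioo (-1 : ℝ) 1 → p.re ∈ A := fun p hp h =>
    Finset.mem_insert_of_mem (Finset.mem_filter.2 ⟨Finset.mem_image_of_mem _ hp, h⟩)
  have hAcard : A.card ≤ P.card + 1 := (Finset.card_insert_le _ _).trans
    (Nat.succ_le_succ ((Finset.card_filter_le _ _).trans Finset.card_image_le))
  let cond : ℝ → ℝ → Prop := fun a r => a ≤ r ∧ ∀ b ∈ A, a < b → r ≤ b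
  let strip : A → Set ℂ := fun a => {x | (x ∈ Q ∧ x ∉ P) ∧ cond a x.re}
  let q : (Σ a, strip a) → {x : ℂ // x ∈ Q ∧ x ∉ P} := fun y => ⟨y.2.1, y.2.2.1⟩
  have hqc : Continuous q := continuous_sigma fun a => continuous_subtype_val.subtype_mk _
  have hcond : ∀ a, IsClosed {r | cond a r} := by
    intro a
    have : {r | cond a r} = Ici a ∩ ⋂ b ∈ A, ⋂ (_ : a < b), Iic b := by
      ext r
      simp [cond]
    rw [this]
    exact isClosed_Ici.inter (isClosed_biInter fun b _ => isClosed_iInter fun _ => isClosed_Iic)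
  have hqs : Function.Surjective q := by
    intro x
    have hne : (A.filter (· ≤ x.1.re)).Nonempty :=
      ⟨-1, Finset.mem_filter.2 ⟨hA1, (hQre _ x.2.1).1⟩⟩
    have hmax := Finset.max'_mem _ hne
    set a := (A.filter (· ≤ x.1.re)).max' hne
    rw [Finset.mem_filter] at hmax
    refine ⟨⟨⟨a, hmax.1⟩, x.1, x.2, hmax.2, fun b hb hab => ?_⟩, rfl⟩
    by_contra! h
    exact hab.not_ge (Finset.le_max' _ _ (Finset.mem_filter.2 ⟨hb, h.le⟩))
  have hqcl : IsClosedMap q := by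
    intro C hC
    have : q '' C = ⋃ a : A, (fun y : strip a => (⟨y.1, y.2.1⟩ : {x : ℂ // x ∈ Q ∧ x ∉ P})) ''
        ((fun y => ⟨a, y⟩ : strip a → Σ a, strip a) ⁻¹' C) := by
      ext x
      simp only [mem_image, mem_iUnion, mem_preimage]
      constructor
      · rintro ⟨⟨a, y⟩, h, rfl⟩
        exact ⟨a, y, h, rfl⟩
      · rintro ⟨a, y, h, rfl⟩
        exact ⟨⟨a, y⟩, h, rfl⟩
    rw [this]
    refine isClosed_iUnion_of_finite fun a => ?_
    have hemb : IsClosedEmbedding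
        (fun y : strip a => (⟨y.1, y.2.1⟩ : {x : ℂ // x ∈ Q ∧ x ∉ P})) := by
      refine ⟨?_, ?_⟩
      · refine IsEmbedding.of_comp (by fun_prop) continuous_subtype_val ?_
        exact IsEmbedding.subtypeVal
      · have : range (fun y : strip a => (⟨y.1, y.2.1⟩ : {x : ℂ // x ∈ Q ∧ x ∉ P})) =
            (fun x => x.1.re) ⁻¹' {r | cond a r} := by
          ext x
          constructor
          · rintro ⟨y, rfl⟩
            exact y.2.2
          · exact fun h => ⟨⟨x.1, x.2, h⟩, rfl⟩
        rw [this]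
        exact (hcond a).preimage (by fun_prop)
    exact hemb.isClosedMap _ (hC.preimage continuous_sigmaMk)
  have hbase : 𝓛.Bd (φ ∘ q) 1 := by
    refine Bd.of_forall fun ξ η => exists_isSec_sigma fun a => ?_
    -- The centre lies on the real axis strictly inside the strip. A segment from it meets the
    -- boundary of the strip at most at its other end, so it avoids the punctures.
    obtain ⟨c, hac, hc1, hcb⟩ : ∃ c : ℝ, a < c ∧ c < 1 ∧ ∀ b ∈ A, a < b → c < b := by
      have hne : (insert 1 (A.filter (a.1 < ·))).Nonempty := Finset.insert_nonempty _ _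
      have hmin := Finset.min'_mem _ hne
      have hle := fun b hb => Finset.min'_le (insert 1 (A.filter (a.1 < ·))) b hb
      set b := (insert 1 (A.filter (a.1 < ·))).min' hne
      have hab : a < b := by
        rcases Finset.mem_insert.1 hmin with h | h
        · rw [h]; exact (hA a a.2).2
        · exact (Finset.mem_filter.1 h).2
      refine ⟨(a + b) / 2, by linarith, ?_, fun b' hb' hab' => ?_⟩
      · have := hle 1 (Finset.mem_insert_self _ _)
        linarith
      · have := hle b' (Finset.mem_insert_of_mem (Finset.mem_filter.2 ⟨hb', hab'⟩))
        linarith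
    have hc0 : -1 < c := (hA a a.2).1.trans_lt hac
    have hcQ : (c : ℂ) ∈ Q := hQ' c ⟨hc0, hc1⟩
    have hint : ∀ x ∈ Q, a < x.re → x.re < 1 → (∀ b ∈ A, a < b → x.re < b) → x ∈ strip a := by
      intro x hx h1 h2 h3
      refine ⟨⟨hx, fun hp => ?_⟩, h1.le, fun b hb hab => (h3 b hb hab).le⟩
      have h4 := hAP x hp ⟨(hA a a.2).1.trans_lt h1, h2⟩
      exact lt_irrefl _ (h3 _ h4 h1)
    refine exists_isSec_strip (𝓛 := 𝓛) (c := c) (T := strip a)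
      (hint _ hcQ hac hc1 hcb) (fun x hx t ht0 ht1 => ?_)
      ((hφ.comp hqc).comp continuous_sigmaMk) ξ η
    have hre : ((1 - t) * c + t * x : ℂ).re = (1 - t) * c + t * x.re := by simp
    refine hint _ ?_ ?_ ?_ ?_
    · have := hQ hcQ hx.1.1 (a := 1 - t) (b := t) (by linarith) ht0 (by ring)
      simpa using this
    · rw [hre]
      nlinarith [hx.2.1]
    · rw [hre]
      nlinarith [(hQre _ hx.1.1).2]
    · intro b hb hab
      rw [hre]
      nlinarith [hx.2.2 b hb hab, hcb b hb hab]
  let F : ℝ → Finset ℝ := fun b => (P.filter (·.re = b)).image Complex.im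
  have hF : ∀ b, (F b).card ≤ P.card := fun b =>
    Finset.card_image_le.trans (Finset.card_filter_le _ _)
  -- The common boundary line of two strips, cut by its punctures into at most `P.card + 1` convex
  -- pieces labelled by the number of punctures below. Pairs of strips without a common line give
  -- empty pieces.
  let L : A × A × Fin (P.card + 1) → Set ℂ := fun c =>
    {x | x ∈ Q ∧ (x.re = c.2.1 ∧ cond c.1 c.2.1 ∧ cond c.2.1 c.2.1) ∧
      x.im ∉ F c.2.1 ∧ ((F c.2.1).filter (· < x.im)).card = c.2.2}
  have hLP : ∀ c, ∀ x ∈ L c, x ∉ P := fun c x hx hxP => hx.2.2.1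
    (Finset.mem_image_of_mem _ (Finset.mem_filter.2 ⟨hxP, hx.2.1.1⟩))
  have hLconv : ∀ c, Convex ℝ (L c) := by
    intro c
    have h1 : Convex ℝ {x : ℂ | x.re = c.2.1} := by
      have := (convex_singleton (𝕜 := ℝ) (c.2.1 : ℝ)).linear_preimage Complex.reLm
      exact this
    have h2 := ((ordConnected_count (F c.2.1) c.2.2).convex).linear_preimage Complex.imLm
    by_cases hc : cond c.1 c.2.1 ∧ cond c.2.1 c.2.1
    · have : L c = Q ∩ ({x : ℂ | x.re = c.2.1} ∩ Complex.imLm ⁻¹'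
          {s : ℝ | s ∉ F c.2.1 ∧ ((F c.2.1).filter (· < s)).card = c.2.2}) := by
        ext x
        simp only [L, hc, mem_inter_iff, mem_ofPred_eq, mem_preimage, Complex.imLm_coe]
        tauto
      rw [this]
      exact hQ.inter (h1.inter h2)
    · have : L c = ∅ := by
        ext x
        simp only [L, mem_ofPred_eq, mem_empty_iff_false, iff_false]
        exact fun h => hc h.2.1.2
      rw [this]
      exact convex_empty
  have : ∀ c, PreconnectedSpace (L c) := fun c =>
    isPreconnected_iff_preconnectedSpace.1 (hLconv c).isPreconnected
  have hglue := hbase.glue hqc hqs hqcl hφ (L := fun c => L c)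
    (fun c x => ⟨c.1, x.1, ⟨x.2.1, hLP c x x.2⟩, by rw [x.2.2.1.1]; exact x.2.2.1.2.1⟩)
    (fun c x => ⟨c.2.1, x.1, ⟨x.2.1, hLP c x x.2⟩, by rw [x.2.2.1.1]; exact x.2.2.1.2.2⟩)
    (fun c => continuous_sigmaMk.comp (by fun_prop))
    (fun c => continuous_sigmaMk.comp (by fun_prop)) (fun c x => rfl) ?_
  · refine hglue.mono ?_
    rw [one_mul]
    refine Nat.pow_le_pow_right 𝓛.one_le ?_
    have hcA : Nat.card A = A.card := by simp
    rw [Nat.card_prod, Nat.card_prod, Nat.card_fin, hcA]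
    gcongr
  · have key : ∀ (a b : A) (x : ℂ) (hx : x ∈ strip a) (hx' : x ∈ strip b), a < b →
        Relation.EqvGen (fun u v => ∃ c, ∃ y : L c,
          (⟨c.1, y.1, ⟨y.2.1, hLP c y y.2⟩, by rw [y.2.2.1.1]; exact y.2.2.1.2.1⟩ :
            Σ a, strip a) = u ∧
          (⟨c.2.1, y.1, ⟨y.2.1, hLP c y y.2⟩, by rw [y.2.2.1.1]; exact y.2.2.1.2.2⟩ :
            Σ a, strip a) = v) ⟨a, x, hx⟩ ⟨b, x, hx'⟩ := by
      intro a b x hx hx' hab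
      have hre : x.re = b := le_antisymm (hx.2.2 b b.2 hab) hx'.2.1
      have h1 : x.im ∉ F b := by
        intro h
        obtain ⟨p, hp, hpx⟩ := Finset.mem_image.1 h
        rw [Finset.mem_filter] at hp
        exact hx.1.2 ((Complex.ext (hp.2.trans hre.symm) hpx : p = x) ▸ hp.1)
      refine .rel _ _ ⟨(a, b, ⟨_, (count_le (F b) x.im).trans_le (Nat.succ_le_succ (hF b))⟩),
        ⟨x, hx.1.1, ⟨hre, ?_, ?_⟩, h1, rfl⟩, rfl, rfl⟩
      · rw [← hre]; exact hx.2
      · have := hx'.2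
        rwa [hre] at this
    rintro ⟨a, x, hx⟩ ⟨b, y, hy⟩ hxy
    obtain rfl : x = y := congrArg (fun z => z.1) hxy
    rcases lt_trichotomy a b with h | rfl | h
    · exact key a b x hx hy h
    · exact .refl _
    · exact .symm _ _ (key b a x hy hx h)

end LocSys

end Orb

namespace Orb

open Metric

/-! ### Side identifications of the polygon -/

section Polygon

/-- The points of the boundary arcs of the polygon. -/
noncomputable def arcPoint (g : ℕ) (x : ℂ) : ℂ :=
  Complex.exp (2 * Real.pi * Complex.I * (x / (4 * g)))

lemma norm_arcPoint (g : ℕ) (x : ℝ) : ‖arcPoint g x‖ = 1 := by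
  rw [arcPoint, show 2 * Real.pi * Complex.I * ((x : ℂ) / (4 * g)) =
    ((2 * Real.pi * (x / (4 * g)) : ℝ) : ℂ) * Complex.I by push_cast; ring]
  exact Complex.norm_exp_ofReal_mul_I _

/-- The `4g`-th power forgets the number of the arc and keeps only the parameter on it. -/
lemma arcPoint_pow {g : ℕ} (hg : 1 ≤ g) (n : ℕ) (s : ℝ) :
    arcPoint g (n + s) ^ (4 * g) = Complex.exp ((2 * Real.pi * s : ℝ) * Complex.I) := by
  have hg' : (g : ℂ) ≠ 0 := by exact_mod_cast (by omega : g ≠ 0)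
  rw [arcPoint, ← Complex.exp_nat_mul, Complex.exp_eq_exp_iff_exists_int]
  refine ⟨n, ?_⟩
  push_cast
  field_simp
  ring

lemma arcPoint_injOn {g : ℕ} (hg : 1 ≤ g) (n : ℕ) :
    InjOn (fun s : ℝ => arcPoint g (n + s)) (Icc 0 1) := by
  intro s hs t ht hst
  obtain ⟨j, hj⟩ := Complex.exp_eq_exp_iff_exists_int.1 hst
  have hg' : (g : ℂ) ≠ 0 := by exact_mod_cast (by omega : g ≠ 0)
  have hI := Complex.two_pi_I_ne_zero
  have h1 : (s : ℂ) = t + j * (4 * g) := by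
    have h2 : 2 * Real.pi * Complex.I * ((n + s : ℂ) / (4 * g)) =
        2 * Real.pi * Complex.I * ((n + t : ℂ) / (4 * g) + j) := by rw [hj]; ring
    have h3 := mul_left_cancel₀ hI h2
    field_simp at h3
    linear_combination h3
  have h4 : s = t + j * (4 * g) := by exact_mod_cast h1
  have hg1 : (1 : ℝ) ≤ g := by exact_mod_cast hg
  have h5 : j = 0 := by
    have h6 : ((j : ℝ)) < 1 := by
      by_contra! h
      nlinarith [hs.2, ht.1]
    have h7 : -1 < (j : ℝ) := by
      by_contra! h
      nlinarith [hs.1, ht.2]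
    have h8 : j < 1 := by exact_mod_cast h6
    have h9 : -1 < j := by exact_mod_cast h7
    omega
  rw [h4, h5]
  simp

/-- Both endpoints are put in the form integer plus parameter, with opposite parameters `s` and
`-s`; hence the shift from `2` to `3`. -/
lemma polygonRel_iff {g : ℕ} {p q : closedBall (0 : ℂ) 1} : PolygonRel g p q ↔
    ∃ b < g, ∃ ε < 2, ∃ s ∈ Icc (0 : ℝ) 1, (p : ℂ) = arcPoint g ((4 * b + ε : ℕ) + s) ∧
      (q : ℂ) = arcPoint g ((4 * b + ε + 3 : ℕ) + (-s : ℝ)) := by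
  have h : ∀ b ε : ℕ, ∀ s : ℝ, Complex.exp (2 * Real.pi * Complex.I *
      ((4 * b + ε + 2 + (1 - s)) / (4 * g))) =
      arcPoint g ((4 * b + ε + 3 : ℕ) + (-s : ℝ)) := by
    intro b ε s
    rw [arcPoint]
    push_cast
    ring_nf
  simp only [PolygonRel, h]
  simp only [arcPoint]
  push_cast
  rfl

/-- Identified points have parameters `s` and `-s`, whose cosines agree. This invariant of the
generated equivalence relation bounds its classes. -/
lemma PolygonRel.norm_re {g : ℕ} {p q : closedBall (0 : ℂ) 1} (h : PolygonRel g p q) :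
    ‖(p : ℂ)‖ = 1 ∧ ‖(q : ℂ)‖ = 1 ∧ ((p : ℂ) ^ (4 * g)).re = ((q : ℂ) ^ (4 * g)).re := by
  obtain ⟨b, hb, ε, -, s, -, hp, hq⟩ := polygonRel_iff.1 h
  refine ⟨?_, ?_, ?_⟩
  · rw [hp]
    exact_mod_cast norm_arcPoint g ((4 * b + ε : ℕ) + s)
  · rw [hq]
    exact_mod_cast norm_arcPoint g ((4 * b + ε + 3 : ℕ) + (-s : ℝ))
  · rw [hp, hq, arcPoint_pow (by omega), arcPoint_pow (by omega), Complex.exp_ofReal_mul_I_re,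
      Complex.exp_ofReal_mul_I_re, mul_neg, Real.cos_neg]

lemma eq_or_norm_re_of_eqvGen {g : ℕ} {p q : closedBall (0 : ℂ) 1}
    (h : Relation.EqvGen (PolygonRel g) p q) :
    p = q ∨ ‖(p : ℂ)‖ = 1 ∧ ‖(q : ℂ)‖ = 1 ∧ ((p : ℂ) ^ (4 * g)).re = ((q : ℂ) ^ (4 * g)).re := by
  induction h with
  | rel a b h => exact Or.inr h.norm_re
  | refl a => exact Or.inl rfl
  | symm a b _ ih =>
    rcases ih with rfl | ⟨h1, h2, h3⟩
    · exact Or.inl rfl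
    · exact Or.inr ⟨h2, h1, h3.symm⟩
  | trans a b c _ _ ih ih' =>
    rcases ih with rfl | ⟨h1, h2, h3⟩
    · exact ih'
    · rcases ih' with rfl | ⟨h1', h2', h3'⟩
      · exact Or.inr ⟨h1, h2, h3⟩
      · exact Or.inr ⟨h1, h2', h3.trans h3'⟩

open Polynomial in
-- On the unit circle `x ^ N` and its conjugate have product `1` and sum `2ρ`, so `x` is a root of
-- `x ^ (2N) - 2ρ x ^ N + 1`.
lemma exists_finset_norm_re (N : ℕ) (hN : 1 ≤ N) (ρ : ℝ) :
    ∃ R : Finset ℂ, R.card ≤ 2 * N ∧ ∀ x : ℂ, ‖x‖ = 1 → (x ^ N).re = ρ → x ∈ R := by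
  classical
  let Q : ℂ[X] := X ^ (2 * N) - C (2 * ρ : ℂ) * X ^ N + 1
  have hQ : Q ≠ 0 := fun h => by
    have h1 : Q.eval 0 = 1 := by
      simp [Q, zero_pow (by omega : N ≠ 0), zero_pow (by omega : 2 * N ≠ 0)]
    rw [h, eval_zero] at h1
    exact zero_ne_one h1
  have hd : Q.natDegree ≤ 2 * N := by
    refine (natDegree_add_le _ _).trans (max_le ((natDegree_sub_le _ _).trans (max_le ?_ ?_)) ?_)
    · simp
    · refine (natDegree_C_mul_X_pow_le _ _).trans (by omega)
    · simp
  refine ⟨Q.roots.toFinset, (Multiset.toFinset_card_le _).trans ((card_roots' Q).trans hd), ?_⟩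
  intro x hx hρ
  rw [Multiset.mem_toFinset, mem_roots hQ, IsRoot.def]
  have h1 : (x ^ N) * (starRingEnd ℂ) (x ^ N) = 1 := by
    rw [Complex.mul_conj, Complex.normSq_eq_norm_sq, norm_pow, hx]
    simp
  have h2 : (x ^ N) + (starRingEnd ℂ) (x ^ N) = 2 * ρ := by
    rw [Complex.add_conj, hρ]
    push_cast
    ring
  simp only [Q, eval_add, eval_sub, eval_mul, eval_pow, eval_X, eval_C, eval_one]
  rw [mul_comm 2 N, pow_mul]
  linear_combination (x ^ N) * h2 - h1

end Polygon

/-! ### The bound for punctured closed surfaces -/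

namespace LocSys

section Surface

variable {S : Type*} [TopologicalSpace S] [CompactSpace S] [T2Space S]

/-- The bound for a punctured surface of positive genus. -/
lemma bd_polygon {g : ℕ} (hg : 1 ≤ g) (e : S ≃ₜ Quot (PolygonRel g)) {Z : Set S} (hZ : Z.Finite)
    {n : ℕ} (hn : Z.ncard ≤ n) {H Ξ : Type*} [Group H] {M : ℕ}
    (𝓛 : LocSys (Zᶜ : Set S) H Ξ M) : ∃ m ≤ n * (8 * g + 1), 𝓛.Bd id
      (M ^ ((m + 1) * ((m + 1) * (m + 1))) * M ^ (g * (2 * (m + 1)))) := by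
  classical
  let π : closedBall (0 : ℂ) 1 → S := fun d => e.symm (Quot.mk _ d)
  have hπc : Continuous π := e.symm.continuous.comp continuous_quot_mk
  have hπs : Function.Surjective π := e.symm.surjective.comp Quot.mk_surjective
  have hπcl : IsClosedMap π := hπc.isClosedMap
  have hπe : ∀ {d d'}, π d = π d' → Relation.EqvGen (PolygonRel g) d d' := fun h =>
    Quot.eqvGen_exact (e.symm.injective h)
  have hπr : ∀ {d d'}, PolygonRel g d d' → π d = π d' := fun h =>
    congrArg e.symm (Quot.sound h)
  choose δ hδ using hπs
  choose R hRc hR using exists_finset_norm_re (4 * g) (by omega)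
  -- All preimages of `Z` in the disc: over each point a chosen one, and at most `8 * g` further
  -- boundary points with the same invariant.
  let P : Finset ℂ := (hZ.toFinset.biUnion fun z =>
    insert (δ z : ℂ) (R ((δ z : ℂ) ^ (4 * g)).re)).filter
      fun x => ∃ h : x ∈ closedBall (0 : ℂ) 1, π ⟨x, h⟩ ∈ Z
  have hP : ∀ d : closedBall (0 : ℂ) 1, (d : ℂ) ∈ P ↔ π d ∈ Z := by
    intro d
    constructor
    · intro h
      obtain ⟨h1, h2⟩ := (Finset.mem_filter.1 h).2
      exact h2
    · intro h
      refine Finset.mem_filter.2 ⟨Finset.mem_biUnion.2 ⟨π d, by simpa using h, ?_⟩, d.2, h⟩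
      rcases eq_or_norm_re_of_eqvGen (hπe (hδ (π d)).symm) with h | ⟨h1, h2, h3⟩
      · rw [← h]
        exact Finset.mem_insert_self _ _
      · exact Finset.mem_insert_of_mem (hR _ _ h1 h3)
  have hPcard : P.card ≤ n * (8 * g + 1) := by
    refine (Finset.card_filter_le _ _).trans ((Finset.card_biUnion_le_card_mul _ _ (8 * g + 1)
      fun z _ => (Finset.card_insert_le _ _).trans ?_).trans (Nat.mul_le_mul_right _ ?_))
    · have := hRc ((δ z : ℂ) ^ (4 * g)).re
      omega
    · rwa [← Set.ncard_eq_toFinset_card Z hZ]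
  refine ⟨P.card, hPcard, ?_⟩
  let T := {x : ℂ // x ∈ closedBall (0 : ℂ) 1 ∧ x ∉ P}
  let q : T → (Zᶜ : Set S) := fun x => ⟨π ⟨x.1, x.2.1⟩, fun h => x.2.2 ((hP _).2 h)⟩
  have hq : Continuous q := by
    refine Continuous.subtype_mk (hπc.comp ?_) _
    exact continuous_subtype_val.subtype_mk _
  have hqs : Function.Surjective q := fun y => by
    refine ⟨⟨δ y, (δ y).2, fun h => ?_⟩, Subtype.ext (hδ y)⟩
    have := (hP _).1 h
    rw [hδ] at this
    exact y.2 this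
  have hqc : IsClosedMap q := by
    intro C hC
    obtain ⟨K, hK, rfl⟩ := isClosed_induced_iff.1 hC
    have : q '' (Subtype.val ⁻¹' K) = Subtype.val ⁻¹' (π '' (Subtype.val ⁻¹' K)) := by
      ext y
      constructor
      · rintro ⟨x, hx, rfl⟩
        exact ⟨⟨x.1, x.2.1⟩, hx, rfl⟩
      · rintro ⟨d, hd, hdy⟩
        refine ⟨⟨d.1, d.2, fun h => y.2 ?_⟩, hd, Subtype.ext hdy⟩
        rw [← hdy]
        exact (hP d).1 h
    rw [this]
    exact (hπcl _ (hK.preimage continuous_subtype_val)).preimage continuous_subtype_val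
  have hbase : 𝓛.Bd (id ∘ q) (M ^ ((P.card + 1) * ((P.card + 1) * (P.card + 1)))) :=
    bd_disc (convex_closedBall 0 1)
      (fun x hx => by
        rw [mem_closedBall_zero_iff, Complex.norm_real, Real.norm_eq_abs]
        exact abs_le.2 ⟨hx.1.le, hx.2.le⟩)
      (fun x hx => abs_le.1 ((Complex.abs_re_le_norm x).trans (mem_closedBall_zero_iff.1 hx))) P hq
  have hpt : ∀ (b ε : ℕ) (s : ℝ), arcPoint g ((4 * b + ε : ℕ) + s) ∈ closedBall (0 : ℂ) 1 :=
    fun b ε s => mem_closedBall_zero_iff.2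
      (by exact_mod_cast (norm_arcPoint g ((4 * b + ε : ℕ) + s)).le)
  have hpt' : ∀ (b ε : ℕ) (s : ℝ),
      arcPoint g ((4 * b + ε + 3 : ℕ) + (-s : ℝ)) ∈ closedBall (0 : ℂ) 1 :=
    fun b ε s => mem_closedBall_zero_iff.2
      (by exact_mod_cast (norm_arcPoint g ((4 * b + ε + 3 : ℕ) + (-s : ℝ))).le)
  have hF : ∀ b ε : ℕ, ∃ F : Finset ℝ, F.card ≤ P.card ∧
      ∀ s ∈ Icc (0 : ℝ) 1, s ∈ F ↔ arcPoint g ((4 * b + ε : ℕ) + s) ∈ P := by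
    intro b ε
    have hfin : ({s : ℝ | s ∈ Icc (0 : ℝ) 1 ∧ arcPoint g ((4 * b + ε : ℕ) + s) ∈ P}).Finite := by
      refine Set.Finite.of_finite_image (P.finite_toSet.subset ?_)
        ((arcPoint_injOn hg (4 * b + ε)).mono fun s hs => hs.1)
      rintro _ ⟨s, hs, rfl⟩
      exact hs.2
    refine ⟨hfin.toFinset, Finset.card_le_card_of_injOn
      (fun s : ℝ => arcPoint g ((4 * b + ε : ℕ) + s)) (fun s hs => ?_) (fun s hs t ht h => ?_),
      fun s hs => by simp only [Set.Finite.mem_toFinset, mem_ofPred_eq, hs, true_and]⟩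
    · exact (hfin.mem_toFinset.1 hs).2
    · exact arcPoint_injOn hg (4 * b + ε) (hfin.mem_toFinset.1 hs).1 (hfin.mem_toFinset.1 ht).1 h
  choose F hFc hF using hF
  -- One index for each of the `2g` identified pairs of sides and each interval into which the
  -- punctures cut a side.
  let L : Fin g × Fin 2 × Fin (P.card + 1) → Set ℝ := fun c => Icc 0 1 ∩
    {s | s ∉ F c.1 c.2.1 ∧ ((F c.1 c.2.1).filter (· < s)).card = c.2.2}
  have : ∀ c, PreconnectedSpace (L c) := fun c => isPreconnected_iff_preconnectedSpace.1
    (ordConnected_Icc.inter (ordConnected_count _ _)).isPreconnected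
  have hLP : ∀ c, ∀ s : L c, arcPoint g ((4 * c.1 + c.2.1 : ℕ) + (s : ℝ)) ∉ P := fun c s h =>
    s.2.2.1 ((hF _ _ _ s.2.1).2 h)
  have hrel : ∀ c, ∀ s : L c, PolygonRel g ⟨_, hpt c.1 c.2.1 s⟩ ⟨_, hpt' c.1 c.2.1 s⟩ :=
    fun c s => polygonRel_iff.2 ⟨c.1, c.1.2, c.2.1, c.2.1.2, s, s.2.1, rfl, rfl⟩
  have hLP' : ∀ c, ∀ s : L c, arcPoint g ((4 * c.1 + c.2.1 + 3 : ℕ) + (-s : ℝ)) ∉ P :=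
    fun c s h => by
      have h1 := (hP ⟨_, hpt' c.1 c.2.1 s⟩).1 h
      rw [← hπr (hrel c s)] at h1
      exact hLP c s ((hP ⟨_, hpt c.1 c.2.1 s⟩).2 h1)
  have hac : Continuous (arcPoint g) := by
    unfold arcPoint
    fun_prop
  have hglue := hbase.glue hq hqs hqc continuous_id (L := fun c => L c)
    (fun c s => ⟨_, hpt c.1 c.2.1 s, hLP c s⟩) (fun c s => ⟨_, hpt' c.1 c.2.1 s, hLP' c s⟩)
    (fun c => Continuous.subtype_mk (hac.comp (by fun_prop)) _)
    (fun c => Continuous.subtype_mk (hac.comp (by fun_prop)) _)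
    (fun c s => Subtype.ext (hπr (hrel c s))) ?_
  · rwa [Nat.card_prod, Nat.card_prod, Nat.card_fin, Nat.card_fin, Nat.card_fin] at hglue
  · have key : ∀ d d' : closedBall (0 : ℂ) 1, Relation.EqvGen (PolygonRel g) d d' →
        ∀ (hd : (d : ℂ) ∉ P) (hd' : (d' : ℂ) ∉ P),
        Relation.EqvGen (fun u v : T => ∃ c, ∃ s : L c,
          (⟨_, hpt c.1 c.2.1 s, hLP c s⟩ : T) = u ∧ (⟨_, hpt' c.1 c.2.1 s, hLP' c s⟩ : T) = v)
          ⟨d, d.2, hd⟩ ⟨d', d'.2, hd'⟩ := by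
      intro d d' h
      induction h with
      | rel a b h =>
        intro hd hd'
        obtain ⟨i, hi, ε, hε, s, hs, h1, h2⟩ := polygonRel_iff.1 h
        have h3 : s ∉ F i ε := fun h => by
          have := (hF i ε s hs).1 h
          rw [← h1] at this
          exact hd this
        refine .rel _ _ ⟨(⟨i, hi⟩, ⟨ε, hε⟩, ⟨_, (count_le (F i ε) s).trans_le
          (Nat.succ_le_succ (hFc i ε))⟩), ⟨s, hs, h3, rfl⟩, Subtype.ext h1.symm,
          Subtype.ext h2.symm⟩
      | refl a => exact fun _ _ => .refl _
      | symm a b _ ih => exact fun hd hd' => .symm _ _ (ih hd' hd)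
      | trans a b c h1 _ ih ih' =>
        intro hd hd'
        have hab : π a = π b := congrArg e.symm (Quot.eqvGen_sound h1)
        -- `P` is a union of equivalence classes, so the intermediate points of a chain of
        -- identifications avoid it too.
        have hb : (b : ℂ) ∉ P := fun h => hd ((hP a).2 (hab ▸ (hP b).1 h))
        exact .trans _ _ _ (ih hd hb) (ih' hb hd')
    intro x x' hxx'
    exact key ⟨x.1, x.2.1⟩ ⟨x'.1, x'.2.1⟩ (hπe (congrArg Subtype.val hxx')) x.2.2 x'.2.2

/-- The bound for a punctured sphere. -/
lemma bd_sphere (e : S ≃ₜ sphere (0 : EuclideanSpace ℝ (Fin 3)) 1) {Z : Set S} (hZ : Z.Finite)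
    {n : ℕ} (hn : Z.ncard ≤ n) {v : sphere (0 : EuclideanSpace ℝ (Fin 3)) 1} (hv : e.symm v ∈ Z)
    {H Ξ : Type*} [Group H] {M : ℕ} (𝓛 : LocSys (Zᶜ : Set S) H Ξ M) :
    ∃ m ≤ n, 𝓛.Bd id (M ^ ((m + 1) * ((m + 1) * (m + 1)))) := by
  classical
  have : Fact (Module.finrank ℝ (EuclideanSpace ℝ (Fin 3)) = 2 + 1) := ⟨by simp⟩
  let st := stereographic' 2 v
  let iso : EuclideanSpace ℝ (Fin 2) ≃ₜ ℂ :=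
    Complex.orthonormalBasisOneI.repr.symm.toHomeomorph
  let G : ball (0 : ℂ) 1 → S := fun x => e.symm (st.symm (iso.symm (Homeomorph.unitBall.symm x)))
  let F : S → ball (0 : ℂ) 1 := fun p => Homeomorph.unitBall (iso (st (e p)))
  have hst : ∀ y, y ∈ st.target := fun y => by simp [st]
  have hG : Continuous G := by
    have h1 : Continuous st.symm := by
      rw [← continuousOn_univ]
      exact st.continuousOn_symm.mono fun y _ => hst y
    exact e.symm.continuous.comp (h1.comp (iso.symm.continuous.comp
      Homeomorph.unitBall.symm.continuous))
  have hFG : ∀ x, F (G x) = x := fun x => by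
    simp only [F, G, Homeomorph.apply_symm_apply]
    rw [st.right_inv (hst _)]
    simp
  have hGF : ∀ p, p ≠ e.symm v → G (F p) = p := fun p hp => by
    simp only [F, G, Homeomorph.symm_apply_apply]
    rw [st.left_inv]
    · simp
    · simp only [st, stereographic'_source]
      exact fun h => hp (by rw [← h, e.symm_apply_apply])
  have hFc : ContinuousOn F {e.symm v}ᶜ := by
    refine (Homeomorph.unitBall.continuous.comp iso.continuous).comp_continuousOn
      (st.continuousOn.comp e.continuous.continuousOn fun p hp => ?_)
    simp only [st, stereographic'_source]
    exact fun h => hp (by rw [mem_singleton_iff, ← h, e.symm_apply_apply])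
  let P : Finset ℂ := (hZ.toFinset.filter (· ≠ e.symm v)).image fun p => (F p : ℂ)
  have hGv : ∀ x, G x ≠ e.symm v := fun x h => by
    have h1 := st.map_target (hst (iso.symm (Homeomorph.unitBall.symm x)))
    rw [stereographic'_source] at h1
    exact h1 (e.symm.injective h)
  refine ⟨P.card, ?_, ?_⟩
  · refine (Finset.card_image_le.trans (Finset.card_filter_le _ _)).trans ?_
    rwa [← Set.ncard_eq_toFinset_card Z hZ]
  let φ : {x : ℂ // x ∈ ball (0 : ℂ) 1 ∧ x ∉ P} → (Zᶜ : Set S) := fun x =>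
    ⟨G ⟨x.1, x.2.1⟩, fun h => x.2.2 (Finset.mem_image.2 ⟨_, Finset.mem_filter.2
      ⟨by simpa using h, hGv _⟩, by rw [hFG]⟩)⟩
  have hφ : Continuous φ := Continuous.subtype_mk (hG.comp (continuous_subtype_val.subtype_mk _)) _
  have hne : ∀ y : (Zᶜ : Set S), y.1 ≠ e.symm v := fun y h => y.2 (h ▸ hv)
  let ψ : (Zᶜ : Set S) → {x : ℂ // x ∈ ball (0 : ℂ) 1 ∧ x ∉ P} := fun y =>
    ⟨F y, (F y).2, fun h => by
      obtain ⟨p, hp, hpy⟩ := Finset.mem_image.1 h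
      rw [Finset.mem_filter, hZ.mem_toFinset] at hp
      have h1 := congrArg G (Subtype.ext hpy)
      rw [hGF _ hp.2, hGF _ (hne y)] at h1
      exact y.2 (h1 ▸ hp.1)⟩
  have hψ : Continuous ψ := by
    refine Continuous.subtype_mk (continuous_subtype_val.comp ?_) _
    exact hFc.comp_continuous continuous_subtype_val hne
  have hbd : 𝓛.Bd φ (M ^ ((P.card + 1) * ((P.card + 1) * (P.card + 1)))) :=
    bd_disc (convex_ball 0 1)
      (fun x hx => by
        rw [mem_ball_zero_iff, Complex.norm_real, Real.norm_eq_abs]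
        exact abs_lt.2 ⟨hx.1, hx.2⟩)
      (fun x hx => abs_le.1 ((Complex.abs_re_le_norm x).trans (mem_ball_zero_iff.1 hx).le)) P hφ
  -- Since `v` is a puncture, stereographic projection followed by `Homeomorph.unitBall` identifies
  -- the punctured sphere with a punctured open disc.
  have hid : φ ∘ ψ = id := funext fun y => Subtype.ext (hGF _ (hne y))
  exact hid ▸ hbd.comp hψ

end Surface

/-- Local systems on a punctured surface of genus `g` have a number of isomorphism classes which is
bounded in terms of the genus, the number of punctures and the order of the automorphism groups. -/
theorem exists_bound : ∃ C : ℕ → ℕ → ℕ → ℕ, ∀ (g n M : ℕ) (S : Type*) [TopologicalSpace S]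
    [CompactSpace S] [T2Space S], HasGenus S g → ∀ Z : Set S, Z.Finite → Z.ncard ≤ n →
    ∃ Z' : Set S, Z'.Finite ∧ Z ⊆ Z' ∧ ∀ (H Ξ : Type*) [Group H]
      (𝓛 : LocSys (Z'ᶜ : Set S) H Ξ M), 𝓛.Bd id (C g n M) := by
  have hmono : ∀ {M m n : ℕ}, 1 ≤ M → m ≤ n →
      M ^ ((m + 1) * ((m + 1) * (m + 1))) ≤ M ^ ((n + 1) * ((n + 1) * (n + 1))) :=
    fun hM h => Nat.pow_le_pow_right hM (by gcongr)
  -- The first summand serves the sphere, with `n + 1` punctures; the second serves positive genus,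
  -- where `n` punctures have at most `n * (8 * g + 1)` preimages in the disc.
  refine ⟨fun g n M => M ^ ((n + 1 + 1) * ((n + 1 + 1) * (n + 1 + 1))) +
    M ^ ((n * (8 * g + 1) + 1) * ((n * (8 * g + 1) + 1) * (n * (8 * g + 1) + 1))) *
      M ^ (g * (2 * (n * (8 * g + 1) + 1))), fun g n M S _ _ _ hS Z hZ hn => ?_⟩
  cases g with
  | zero =>
    obtain ⟨e⟩ := hS
    let v : sphere (0 : EuclideanSpace ℝ (Fin 3)) 1 := ⟨EuclideanSpace.single 0 1, by simp⟩
    -- An extra puncture at the pole opens the sphere up to a disc.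
    refine ⟨insert (e.symm v) Z, hZ.insert _, subset_insert _ _, fun H Ξ _ 𝓛 => ?_⟩
    obtain ⟨m, hm, h⟩ := bd_sphere e (hZ.insert (e.symm v))
      ((Set.ncard_insert_le _ _).trans (Nat.succ_le_succ hn)) (mem_insert _ _) 𝓛
    exact h.mono ((hmono 𝓛.one_le hm).trans (Nat.le_add_right _ _))
  | succ g =>
    obtain ⟨e⟩ := hS
    refine ⟨Z, hZ, Subset.rfl, fun H Ξ _ 𝓛 => ?_⟩
    obtain ⟨m, hm, h⟩ := bd_polygon (Nat.succ_le_succ (Nat.zero_le g)) e hZ hn 𝓛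
    refine h.mono (le_trans (Nat.mul_le_mul (hmono 𝓛.one_le hm) ?_) (Nat.le_add_left _ _))
    exact Nat.pow_le_pow_right 𝓛.one_le (by gcongr)

end LocSys

end Orb

namespace Orb

/-! ### Extension of `λ` to germs of local changes -/

section Transition

variable {E : Type*} [NormedAddCommGroup E] [NormedSpace ℝ E] [FiniteDimensional ℝ E]
  {X : Type*} [TopologicalSpace X]
  {E' : Type*} [NormedAddCommGroup E'] [NormedSpace ℝ E'] [FiniteDimensional ℝ E']
  {X' : Type*} [TopologicalSpace X']
  {O : Orbifold E X} {O' : Orbifold E' X'} {f : C(X, X')} {F : SmoothMap O O' f}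

namespace CompatibleSystem

variable (ξ : CompatibleSystem F)

/-- The source systems. -/
abbrev sys (α : ξ.Λ) : UChart E X := (ξ.lift α).dom

/-- The target systems. -/
abbrev sys' (α : ξ.Λ) : UChart E' X' := (ξ.lift α).cod

/-- The lifts. -/
abbrev l (α : ξ.Λ) : (ξ.sys α).V → (ξ.sys' α).V := (ξ.lift α).toFun

lemma sys_mem (α : ξ.Λ) : ξ.sys α ∈ O.charts := (F.mem _ (ξ.lift_mem α)).1

lemma sys'_mem (α : ξ.Λ) : ξ.sys' α ∈ O'.charts := (F.mem _ (ξ.lift_mem α)).2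

lemma continuousAt_l {α : ξ.Λ} (x : (ξ.sys α).V) : ContinuousAt (ξ.l α) x :=
  (ξ.lift α).smooth.continuous.continuousAt

/-- Local changes between source systems are represented by injections of the system. -/
lemma exists_span {α β : ξ.Λ} {κ : (ξ.sys α).V → (ξ.sys β).V} {x : (ξ.sys α).V}
    (hκ : Loc _ _ κ x) : ∃ (γ : ξ.Λ) (a : Injection (ξ.sys γ) (ξ.sys α))
      (b : Injection (ξ.sys γ) (ξ.sys β)) (w : (ξ.sys γ).V), a w = x ∧
        ∀ᶠ v in 𝓝 w, κ (a v) = b v := by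
  obtain ⟨γ, ⟨w, hw⟩, hγ⟩ := ξ.basis α β ((ξ.sys α).π x) ⟨⟨x, rfl⟩, ⟨κ x, hκ.comm⟩⟩
  obtain ⟨a₀⟩ := ξ.exists_injection γ α (hγ.trans inter_subset_left)
  obtain ⟨b₀⟩ := ξ.exists_injection γ β (hγ.trans inter_subset_right)
  -- An arbitrary injection may hit another point over the same image; the group element corrects
  -- this.
  obtain ⟨g, hg, hgx⟩ := ((ξ.sys α).fibre (a₀ w) x).1 (by rw [a₀.comm, hw])
  let a : Injection (ξ.sys γ) (ξ.sys α) :=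
    (Injection.ofGroup ⟨g, hg⟩ : Injection (ξ.sys α) (ξ.sys α)).comp a₀
  have ha : a w = x := hgx
  have h1 : Loc _ _ (κ ∘ a) w := Loc.comp (by rwa [ha]) (a.loc w)
  obtain ⟨g', hg', h⟩ := (b₀.loc w).exists_group h1
  exact ⟨γ, a, (Injection.ofGroup ⟨g', hg'⟩ : Injection (ξ.sys β) (ξ.sys β)).comp b₀, w, ha, h⟩

/-- `Λ` represents the germ of local changes between target systems which the compatible
system associates to the germ of `κ` at `x`. -/
def Trans {α β : ξ.Λ} (κ : (ξ.sys α).V → (ξ.sys β).V) (x : (ξ.sys α).V)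
    (Λ : (ξ.sys' α).V → (ξ.sys' β).V) : Prop :=
  ∃ (γ : ξ.Λ) (a : Injection (ξ.sys γ) (ξ.sys α)) (b : Injection (ξ.sys γ) (ξ.sys β))
    (w : (ξ.sys γ).V), a w = x ∧ (∀ᶠ v in 𝓝 w, κ (a v) = b v) ∧
      ∀ᶠ y in 𝓝 (ξ.l γ w), Λ (ξ.lam a y) = ξ.lam b y

variable {ξ} {α β β' : ξ.Λ} {κ κ' : (ξ.sys α).V → (ξ.sys β).V} {x : (ξ.sys α).V}
  {Λ Λ' : (ξ.sys' α).V → (ξ.sys' β).V}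

lemma Trans.loc (h : ξ.Trans κ x Λ) : Loc _ _ Λ (ξ.l α x) := by
  obtain ⟨γ, a, b, w, rfl, h1, h2⟩ := h
  have e : ξ.l α (a w) = ξ.lam a (ξ.l γ w) := ξ.lift_comm a w
  obtain ⟨ψ, hψ, h3, h4, h5⟩ := ((ξ.lam a).loc (ξ.l γ w)).exists_inv
  rw [e]
  refine (Loc.comp (ψ := ξ.lam b) ((ξ.lam b).loc _) hψ).congr ?_
  rw [((ξ.lam a).loc (ξ.l γ w)).eventually_of_map]
  filter_upwards [h2, h4] with y h6 h7
  rw [h6, Function.comp_apply, h7]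

lemma exists_trans (hκ : Loc _ _ κ x) : ∃ Λ, ξ.Trans κ x Λ := by
  obtain ⟨γ, a, b, w, rfl, h1⟩ := ξ.exists_span hκ
  obtain ⟨ψ, -, -, h4, -⟩ := ((ξ.lam a).loc (ξ.l γ w)).exists_inv
  refine ⟨ξ.lam b ∘ ψ, γ, a, b, w, rfl, h1, ?_⟩
  filter_upwards [h4] with y h
  rw [Function.comp_apply, h]

/-- Two injections of the system with targets meeting at a point have a common refinement. -/
lemma exists_refinement {γ γ' : ξ.Λ} (a : Injection (ξ.sys γ) (ξ.sys α))
    (a' : Injection (ξ.sys γ') (ξ.sys α)) {w : (ξ.sys γ).V} {w' : (ξ.sys γ').V}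
    (h : a w = a' w') : ∃ (δ : ξ.Λ) (c : Injection (ξ.sys δ) (ξ.sys γ))
      (c' : Injection (ξ.sys δ) (ξ.sys γ')) (v : (ξ.sys δ).V), c v = w ∧ c' v = w' ∧
        a.comp c = a'.comp c' := by
  obtain ⟨ψ, hψ, h3, h4, h5⟩ := (a'.loc w').exists_inv
  rw [← h] at hψ h3 h5
  obtain ⟨δ, c, c', v, rfl, h6⟩ := ξ.exists_span (hψ.comp (a.loc w))
  refine ⟨δ, c, c', v, rfl, ?_, Injection.eq_of_eventually_eq (x := v) ?_⟩
  · rw [← h6.self_of_nhds]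
    exact h3
  · have h7 : ContinuousAt (fun u => a (c u)) v :=
      (a.loc (c v)).continuousAt.comp (c.loc v).continuousAt
    filter_upwards [h6, h7.eventually h5] with u h8 h9
    change a (c u) = a' (c' u)
    rw [← h8]
    exact h9.symm

lemma l_comp {γ : ξ.Λ} (a : Injection (ξ.sys γ) (ξ.sys α)) (w : (ξ.sys γ).V) :
    ξ.l α (a w) = ξ.lam a (ξ.l γ w) := ξ.lift_comm a w

lemma lam_comp_apply {γ : ξ.Λ} (b : Injection (ξ.sys α) (ξ.sys β))
    (a : Injection (ξ.sys γ) (ξ.sys α)) (y : (ξ.sys' γ).V) :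
    ξ.lam (b.comp a) y = ξ.lam b (ξ.lam a y) := by
  rw [ξ.lam_comp]
  rfl

/-- Two presentations `b ∘ a⁻¹` of one germ acquire a common refinement, on which functoriality of
`λ` identifies the associated target changes. So the target germ depends only on the source germ. -/
lemma Trans.eventually_eq (h : ξ.Trans κ x Λ) (h' : ξ.Trans κ' x Λ')
    (e : ∀ᶠ w in 𝓝 x, κ w = κ' w) : ∀ᶠ y in 𝓝 (ξ.l α x), Λ y = Λ' y := by
  obtain ⟨γ, a, b, w, rfl, h1, h2⟩ := h
  obtain ⟨γ', a', b', w', hw', h1', h2'⟩ := h'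
  obtain ⟨δ, c, c', v, rfl, rfl, hc⟩ := exists_refinement a a' hw'.symm
  have hb : b.comp c = b'.comp c' := by
    refine Injection.eq_of_eventually_eq (x := v) ?_
    have hac : ContinuousAt (fun u => a (c u)) v :=
      (a.loc (c v)).continuousAt.comp (c.loc v).continuousAt
    filter_upwards [(c.loc v).continuousAt.eventually h1, (c'.loc v).continuousAt.eventually h1',
      hac.eventually e] with u h3 h4 h5
    change b (c u) = b' (c' u)
    rw [← h3, ← h4, h5]
    exact congrArg κ' (congrArg (fun i : Injection _ _ => i u) hc)
  have e1 : ξ.l α (a (c v)) = ξ.lam (a.comp c) (ξ.l δ v) := l_comp (a.comp c) v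
  rw [e1, ((ξ.lam (a.comp c)).loc (ξ.l δ v)).eventually_of_map]
  rw [l_comp] at h2 h2'
  filter_upwards [((ξ.lam c).loc _).continuousAt.eventually h2,
    ((ξ.lam c').loc _).continuousAt.eventually h2'] with y h3 h4
  have e2 : ξ.lam (a.comp c) y = ξ.lam a (ξ.lam c y) := lam_comp_apply _ _ _
  have e3 : ξ.lam (a.comp c) y = ξ.lam a' (ξ.lam c' y) := by rw [hc, ξ.lam_comp]; rfl
  have e4 : ξ.lam b (ξ.lam c y) = ξ.lam b' (ξ.lam c' y) := by
    have := congrArg (fun i => (ξ.lam i) y) hb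
    simpa only [lam_comp_apply] using this
  rw [e2, h3, e4, ← h4, ← e3, e2]

lemma Trans.comm (h : ξ.Trans κ x Λ) : ∀ᶠ w in 𝓝 x, Λ (ξ.l α w) = ξ.l β (κ w) := by
  obtain ⟨γ, a, b, w, rfl, h1, h2⟩ := h
  rw [(a.loc w).eventually_of_map]
  filter_upwards [h1, (ξ.continuousAt_l w).eventually h2] with v h3 h4
  rw [l_comp, h4, h3, l_comp]

lemma Trans.eventually (h : ξ.Trans κ x Λ) : ∀ᶠ w in 𝓝 x, ξ.Trans κ w Λ := by
  obtain ⟨γ, a, b, w, rfl, h1, h2⟩ := h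
  rw [(a.loc w).eventually_of_map]
  filter_upwards [h1.eventually_nhds, (ξ.continuousAt_l w).eventually h2.eventually_nhds]
    with v h3 h4 using ⟨γ, a, b, v, rfl, h3, h4⟩

/-- On a common refinement of the middle injections the composite is presented by the outer ones. -/
lemma Trans.comp {κ₂ : (ξ.sys β).V → (ξ.sys β').V} {Λ₂ : (ξ.sys' β).V → (ξ.sys' β').V}
    (h : ξ.Trans κ x Λ) (h₂ : ξ.Trans κ₂ (κ x) Λ₂) : ξ.Trans (κ₂ ∘ κ) x (Λ₂ ∘ Λ) := by
  obtain ⟨γ, a, b, w, rfl, h1, h2⟩ := h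
  obtain ⟨γ', a', b', w', hw', h1', h2'⟩ := h₂
  rw [h1.self_of_nhds] at hw'
  obtain ⟨δ, c, c', v, rfl, rfl, hc⟩ := exists_refinement b a' hw'.symm
  rw [l_comp] at h2 h2'
  refine ⟨δ, a.comp c, b'.comp c', v, rfl, ?_, ?_⟩
  · filter_upwards [(c.loc v).continuousAt.eventually h1,
      (c'.loc v).continuousAt.eventually h1'] with u h3 h4
    change κ₂ (κ (a (c u))) = b' (c' u)
    rw [h3, ← h4]
    exact congrArg κ₂ (congrArg (fun i : Injection _ _ => i u) hc)
  · filter_upwards [((ξ.lam c).loc _).continuousAt.eventually h2,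
      ((ξ.lam c').loc _).continuousAt.eventually h2'] with y h3 h4
    have e2 : ξ.lam (a.comp c) y = ξ.lam a (ξ.lam c y) := lam_comp_apply _ _ _
    have e3 : ξ.lam (b'.comp c') y = ξ.lam b' (ξ.lam c' y) := lam_comp_apply _ _ _
    have e4 : ξ.lam b (ξ.lam c y) = ξ.lam a' (ξ.lam c' y) := by
      have := congrArg (fun i => (ξ.lam i) y) hc
      simpa only [lam_comp_apply] using this
    rw [e2, e3, Function.comp_apply, h3, e4, h4]

/-- `λ` of the identity is an idempotent injective map, hence the identity; so `i` is presented by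
the pair of the identity and `i`. -/
lemma trans_injection (i : Injection (ξ.sys α) (ξ.sys β)) (x : (ξ.sys α).V) :
    ξ.Trans i x (ξ.lam i) := by
  let e : Injection (ξ.sys α) (ξ.sys α) := Injection.ofGroup 1
  have he : e.comp e = e := Injection.ext rfl
  have hl : ∀ y, ξ.lam e y = y := fun y => (ξ.lam e).injective (by
    have := congrArg (fun i => (ξ.lam i) y) he
    simpa only [lam_comp_apply] using this)
  exact ⟨α, e, i, x, rfl, Filter.Eventually.of_forall fun _ => rfl,
    Filter.Eventually.of_forall fun y => by rw [hl]⟩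

end CompatibleSystem

end Transition

end Orb

namespace Orb

/-! ### The local system of isomorphisms between compatible systems -/

section Germs

variable {E : Type*} [NormedAddCommGroup E] [NormedSpace ℝ E] [FiniteDimensional ℝ E]
  {X : Type*} [TopologicalSpace X] {O : Orbifold E X}
  {S : Type*} [TopologicalSpace S] [T1Space S] [ChartedSpace ℂ S] [IsManifold 𝓘(ℂ) ω S]
  {f : C(S, X)} {OS : Orbifold ℂ S} {Z : Set S}

/-- The consequences of unique continuation for the lifts of `f`: away from `Z` the source has no
orbifold points, and lifts of `f` to systems of the target are unique up to local changes. -/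
structure UniqueLifts (OS : Orbifold ℂ S) (O : Orbifold E X) (f : C(S, X)) (Z : Set S) :
    Prop where
  isClosed : IsClosed Z
  good : ∀ c ∈ OS.charts, ∀ x : c.V, ∀ W ∈ 𝓝 x, ∃ N ⊆ W, GoodNhd O f Z c x N
  inj : ∀ c ∈ OS.charts, ∀ x : c.V, c.π x ∉ Z → ∃ U ∈ 𝓝 x, InjOn c.π U
  lift : ∀ l m : LocalLift ℂ E f, l.dom ∈ OS.charts → l.cod ∈ O.charts → m.cod ∈ O.charts →
    ∀ (κ : l.dom.V → m.dom.V) (x : l.dom.V), Loc l.dom m.dom κ x →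
      ∃ φ, Loc l.cod m.cod φ (l.toFun x) ∧ ∀ᶠ w in 𝓝 x, φ (l.toFun w) = m.toFun (κ w)

/-- Off `Z` the projection is locally injective, so a local change is determined by its value at one
point. -/
lemma UniqueLifts.eventually_eq (hU : UniqueLifts OS O f Z) {c d : UChart ℂ S}
    (hd : d ∈ OS.charts) {κ κ' : c.V → d.V} {x : c.V} (hκ : Loc c d κ x) (hκ' : Loc c d κ' x)
    (h : κ x = κ' x) (hx : c.π x ∉ Z) : ∀ᶠ w in 𝓝 x, κ w = κ' w := by
  obtain ⟨U, hU', hi⟩ := hU.inj d hd (κ x) (by rwa [hκ.comm])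
  filter_upwards [hκ.continuousAt.eventually hU', hκ'.continuousAt.eventually (h ▸ hU'),
    hκ.eventually, hκ'.eventually] with w h1 h2 h3 h4
  exact hi h1 h2 (h3.comm.trans h4.comm.symm)

lemma UniqueLifts.eventually_notMem (hU : UniqueLifts OS O f Z) {c : UChart ℂ S} {x : c.V}
    (hx : c.π x ∉ Z) : ∀ᶠ w in 𝓝 x, c.π w ∉ Z :=
  c.continuous.continuousAt.eventually (hU.isClosed.isOpen_compl.mem_nhds hx)

namespace CompatibleSystem

variable {F : SmoothMap OS O f}

/-- The points of the source systems. -/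
noncomputable abbrev Pt (ξ : CompatibleSystem F) : Type := Σ α : ξ.Λ, (ξ.sys α).V

/-- The projection to the source. -/
noncomputable def pr (ξ : CompatibleSystem F) (P : ξ.Pt) : S := (ξ.sys P.1).π P.2

lemma exists_pt (ξ : CompatibleSystem F) (p : S) : ∃ P : ξ.Pt, ξ.pr P = p := by
  obtain ⟨α, x, hx⟩ := ξ.cover p
  exact ⟨⟨α, x⟩, hx⟩

/-- A point over `p`. -/
noncomputable def base (ξ : CompatibleSystem F) (p : S) : ξ.Pt := (ξ.exists_pt p).choose

lemma pr_base (ξ : CompatibleSystem F) (p : S) : ξ.pr (ξ.base p) = p :=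
  (ξ.exists_pt p).choose_spec

lemma exists_loc (ξ η : CompatibleSystem F) {α : ξ.Λ} {β : η.Λ} {x : (ξ.sys α).V}
    {y : (η.sys β).V} (h : (ξ.sys α).π x = (η.sys β).π y) :
    ∃ κ, Loc (ξ.sys α) (η.sys β) κ x ∧ κ x = y :=
  (OS.compatible _ (ξ.sys_mem α) _ (η.sys_mem β)).exists_loc h

open Classical in
/-- The derivative of the target change associated to the change of source systems that takes
one point to another. -/
noncomputable def frame (ξ : CompatibleSystem F) (P Q : ξ.Pt) : E ≃L[ℝ] E :=
  if h : ∃ κ Λ, Loc _ _ κ P.2 ∧ κ P.2 = Q.2 ∧ ξ.Trans κ P.2 Λ then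
    der h.choose_spec.choose (ξ.l P.1 P.2) else 1

variable {ξ η ζ : CompatibleSystem F}

/-- Off `Z` the change taking one point to another is unique as a germ, so the choices in `frame` do
not matter. -/
lemma frame_eq (hU : UniqueLifts OS O f Z) {α β : ξ.Λ} {κ : (ξ.sys α).V → (ξ.sys β).V}
    {x : (ξ.sys α).V}
    {Λ : (ξ.sys' α).V → (ξ.sys' β).V} (hκ : Loc _ _ κ x) (hΛ : ξ.Trans κ x Λ)
    (hx : (ξ.sys α).π x ∉ Z) : ξ.frame ⟨α, x⟩ ⟨β, κ x⟩ = der Λ (ξ.l α x) := by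
  have h : ∃ κ' Λ, Loc (ξ.sys α) (ξ.sys β) κ' x ∧ κ' x = κ x ∧ ξ.Trans κ' x Λ :=
    ⟨κ, Λ, hκ, rfl, hΛ⟩
  rw [frame, dif_pos h]
  obtain ⟨h1, h2, h3⟩ := h.choose_spec.choose_spec
  exact der_congr (h3.eventually_eq hΛ (hU.eventually_eq (ξ.sys_mem β) h1 hκ h2 hx))

/-- The chain rule together with functoriality of the transitions. This cocycle identity is what
makes values at different representatives comparable. -/
lemma frame_comp (hU : UniqueLifts OS O f Z) {P Q R : ξ.Pt} (h1 : ξ.pr P = ξ.pr Q)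
    (h2 : ξ.pr Q = ξ.pr R) (hP : ξ.pr P ∉ Z) : ξ.frame Q R * ξ.frame P Q = ξ.frame P R := by
  obtain ⟨α, x⟩ := P
  obtain ⟨β, y⟩ := Q
  obtain ⟨γ, v⟩ := R
  obtain ⟨κ, hκ, rfl⟩ := ξ.exists_loc ξ (x := x) (y := y) h1
  obtain ⟨κ', hκ', rfl⟩ := ξ.exists_loc ξ (x := κ x) (y := v) h2
  obtain ⟨Λ, hΛ⟩ := exists_trans hκ
  obtain ⟨Λ', hΛ'⟩ := exists_trans hκ'
  have hP' : (ξ.sys β).π (κ x) ∉ Z := fun h => hP (h1.symm ▸ h)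
  rw [frame_eq hU hκ hΛ hP, frame_eq hU hκ' hΛ' hP']
  have e := hΛ.comm.self_of_nhds
  have := frame_eq hU (hκ'.comp hκ) (hΛ.comp hΛ') hP
  rw [Loc.der_comp (by rw [e]; exact hΛ'.loc) hΛ.loc, e] at this
  exact this.symm

lemma frame_self (hU : UniqueLifts OS O f Z) {P : ξ.Pt} (hP : ξ.pr P ∉ Z) : ξ.frame P P = 1 := by
  have := frame_comp hU (P := P) (Q := P) (R := P) rfl rfl hP
  simpa using this

lemma frame_inv (hU : UniqueLifts OS O f Z) {P Q : ξ.Pt} (h : ξ.pr P = ξ.pr Q)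
    (hP : ξ.pr P ∉ Z) : ξ.frame Q P = (ξ.frame P Q)⁻¹ := by
  rw [eq_inv_iff_mul_eq_one, frame_comp hU h h.symm hP, frame_self hU hP]

/-- The linear map, between the fibres at the base points, determined by the derivative of a local
change `φ` of target systems over a local change `κ` of source systems. -/
noncomputable def val {α : ξ.Λ} {β : η.Λ} (κ : (ξ.sys α).V → (η.sys β).V)
    (φ : (ξ.sys' α).V → (η.sys' β).V) (w : (ξ.sys α).V) : E ≃L[ℝ] E :=
  η.frame ⟨β, κ w⟩ (η.base ((ξ.sys α).π w)) * der φ (ξ.l α w) *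
    ξ.frame (ξ.base ((ξ.sys α).π w)) ⟨α, w⟩

/-- Germs of isomorphisms between compatible systems. -/
def germ (Z : Set S) (ξ η : CompatibleSystem F) (p : (Zᶜ : Set S)) :
    Set ((Zᶜ : Set S) → (E ≃L[ℝ] E)) :=
  {τ | ∃ (α : ξ.Λ) (x : (ξ.sys α).V) (β : η.Λ) (κ : (ξ.sys α).V → (η.sys β).V)
    (φ : (ξ.sys' α).V → (η.sys' β).V), (ξ.sys α).π x = p ∧ Loc _ _ κ x ∧ Loc _ _ φ (ξ.l α x) ∧
      ∀ᶠ w in 𝓝 x, φ (ξ.l α w) = η.l β (κ w) ∧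
        ∀ h : (ξ.sys α).π w ∉ Z, τ ⟨_, h⟩ = val κ φ w}

/-- Change of the presentation of a germ. -/
lemma exists_presentation (hU : UniqueLifts OS O f Z) {α α' : ξ.Λ} {β β' : η.Λ}
    {κ : (ξ.sys α).V → (η.sys β).V} {κ' : (ξ.sys α').V → (η.sys β').V}
    {φ : (ξ.sys' α).V → (η.sys' β).V} {x : (ξ.sys α).V} {x' : (ξ.sys α').V}
    (hκ : Loc _ _ κ x) (hφ : Loc _ _ φ (ξ.l α x)) (hc : ∀ᶠ w in 𝓝 x, φ (ξ.l α w) = η.l β (κ w))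
    (hx : (ξ.sys α).π x ∉ Z) (hκ' : Loc _ _ κ' x') (hxx : (ξ.sys α').π x' = (ξ.sys α).π x) :
    ∃ φ', Loc (ξ.sys' α') (η.sys' β') φ' (ξ.l α' x') ∧ ∃ σ, Loc (ξ.sys α') (ξ.sys α) σ x' ∧
      σ x' = x ∧ ∀ᶠ w in 𝓝 x', φ' (ξ.l α' w) = η.l β' (κ' w) ∧ val κ' φ' w = val κ φ (σ w) := by
  obtain ⟨σ, hσ, rfl⟩ := ξ.exists_loc ξ hxx
  obtain ⟨μ, hμ, hμx⟩ := η.exists_loc η (x := κ (σ x')) (y := κ' x')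
    (by rw [hκ.comm, hκ'.comm, hxx])
  have hx' : (ξ.sys α').π x' ∉ Z := by rwa [hxx]
  obtain ⟨Λ, hΛ⟩ := exists_trans hσ
  obtain ⟨Λ', hΛ'⟩ := exists_trans hμ
  have hκσ : Loc _ _ (κ ∘ σ) x' := hκ.comp hσ
  have hκκ := hU.eventually_eq (η.sys_mem β') (Loc.comp (φ := κ ∘ σ) (x := x') hμ hκσ) hκ' hμx hx'
  have e1 := hΛ.comm.self_of_nhds
  have e2 := hc.self_of_nhds
  have hφΛ : Loc _ _ (φ ∘ Λ) (ξ.l α' x') := Loc.comp (by rw [e1]; exact hφ) hΛ.loc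
  have e3 : (φ ∘ Λ) (ξ.l α' x') = η.l β (κ (σ x')) := by rw [Function.comp_apply, e1, e2]
  -- `σ` and `μ` pass between the old and new charts of the source. Composing with the target
  -- changes that `ξ` and `η` attach to them transports `φ`, and the frames absorb their
  -- derivatives.
  refine ⟨Λ' ∘ φ ∘ Λ, Loc.comp (by rw [e3]; exact hΛ'.loc) hφΛ, σ, hσ, rfl, ?_⟩
  have hσc := hσ.continuousAt
  have hκc : ContinuousAt (fun w => κ (σ w)) x' := hκσ.continuousAt
  filter_upwards [hΛ.comm, hΛ.eventually, hσ.eventually, hσc.eventually hc,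
    hσc.eventually hκ.eventually, hσc.eventually ((ξ.continuousAt_l _).eventually hφ.eventually),
    hκc.eventually hΛ'.comm, hκc.eventually hΛ'.eventually, hκc.eventually hμ.eventually, hκκ,
    hU.eventually_notMem hx'] with w a1 a2 a3 a4 a5 a6 a7 a8 a9 a10 hw
  have a10' : μ (κ (σ w)) = κ' w := a10
  refine ⟨?_, ?_⟩
  · rw [Function.comp_apply, Function.comp_apply, a1, a4, a7, a10']
  have hπ : (ξ.sys α).π (σ w) = (ξ.sys α').π w := a3.comm
  have hπ' : (η.sys β).π (κ (σ w)) = (ξ.sys α').π w := a5.comm.trans hπ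
  have hφΛw : Loc _ _ (φ ∘ Λ) (ξ.l α' w) := Loc.comp (by rw [a1]; exact a6) a2.loc
  have f3 : (φ ∘ Λ) (ξ.l α' w) = η.l β (κ (σ w)) := by rw [Function.comp_apply, a1, a4]
  have hd : der (Λ' ∘ φ ∘ Λ) (ξ.l α' w) =
      der Λ' (η.l β (κ (σ w))) * (der φ (ξ.l α (σ w)) * der Λ (ξ.l α' w)) := by
    rw [Loc.der_comp (by rw [f3]; exact a8.loc) hφΛw, f3,
      Loc.der_comp (by rw [a1]; exact a6) a2.loc, a1]
  have hdΛ := frame_eq hU a3 a2 hw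
  have hdΛ' := frame_eq hU a9 a8 (by rwa [hπ'])
  rw [a10'] at hdΛ'
  have hPκ' : η.pr ⟨β', κ' w⟩ = (ξ.sys α').π w := by
    rw [← a10']
    exact a9.comm.trans hπ'
  have c1 := frame_comp hU (ξ := η) (P := ⟨β, κ (σ w)⟩) (Q := ⟨β', κ' w⟩)
    (R := η.base ((ξ.sys α').π w)) (hπ'.trans hPκ'.symm) (hPκ'.trans (η.pr_base _).symm)
    (by rw [show η.pr ⟨β, κ (σ w)⟩ = _ from hπ']; exact hw)
  have c2 := frame_comp hU (ξ := ξ) (P := ξ.base ((ξ.sys α').π w)) (Q := ⟨α', w⟩)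
    (R := ⟨α, σ w⟩) (ξ.pr_base _) hπ.symm (by rwa [ξ.pr_base])
  rw [val, val, hd, hπ, ← hdΛ, ← hdΛ', ← c1, ← c2]
  group

/-- This allows two germs to be presented over one and the same `κ`, where they can be compared
directly. -/
lemma germ_presentation (hU : UniqueLifts OS O f Z) {p : (Zᶜ : Set S)}
    {τ : (Zᶜ : Set S) → (E ≃L[ℝ] E)} (hτ : τ ∈ germ Z ξ η p) {α : ξ.Λ} {β : η.Λ}
    {κ : (ξ.sys α).V → (η.sys β).V} {x : (ξ.sys α).V} (hκ : Loc _ _ κ x)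
    (hx : (ξ.sys α).π x = p) :
    ∃ φ, Loc (ξ.sys' α) (η.sys' β) φ (ξ.l α x) ∧ ∀ᶠ w in 𝓝 x, φ (ξ.l α w) = η.l β (κ w) ∧
        ∀ h : (ξ.sys α).π w ∉ Z, τ ⟨_, h⟩ = val κ φ w := by
  obtain ⟨α₀, x₀, β₀, κ₀, φ₀, h1, h2, h3, h4⟩ := hτ
  obtain ⟨φ, hφ, σ, hσ, rfl, h⟩ := exists_presentation hU h2 h3 (h4.mono fun w h => h.1)
    (by rw [h1]; exact p.2) hκ (hx.trans h1.symm)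
  refine ⟨φ, hφ, ?_⟩
  filter_upwards [h, hσ.continuousAt.eventually h4, hσ.eventually] with w h5 h6 h7
  refine ⟨h5.1, fun hw => ?_⟩
  rw [h5.2, ← h6.2 (by rwa [h7.comm])]
  congr 2
  exact h7.comm.symm

lemma eventually_of_eventually_π {c : UChart ℂ S} {x : c.V} {p : (Zᶜ : Set S)} (hx : c.π x = p)
    {Pr : (Zᶜ : Set S) → Prop} (h : ∀ᶠ w in 𝓝 x, ∀ h : c.π w ∉ Z, Pr ⟨_, h⟩) :
    ∀ᶠ q in 𝓝 p, Pr q := by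
  have h1 : ∀ᶠ q in 𝓝 (p : S), ∀ h : q ∉ Z, Pr ⟨q, h⟩ := by
    rw [← hx]
    exact c.isOpenMap.nhds_le x h
  exact (continuous_subtype_val.continuousAt.eventually h1).mono fun q hq => hq q.2

lemma germ_eventually {p : (Zᶜ : Set S)} {τ : (Zᶜ : Set S) → (E ≃L[ℝ] E)}
    (hτ : τ ∈ germ Z ξ η p) : ∀ᶠ q in 𝓝 p, τ ∈ germ Z ξ η q := by
  obtain ⟨α, x, β, κ, φ, h1, h2, h3, h4⟩ := hτ
  refine eventually_of_eventually_π h1 ?_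
  filter_upwards [h2.eventually, (ξ.continuousAt_l x).eventually h3.eventually,
    h4.eventually_nhds] with w a b c h
  exact ⟨α, w, β, κ, φ, rfl, a, b, c⟩

/-- Over a common `κ`, equal values mean that the two target changes have equal 1-jets, and the
1-jet determines the germ. -/
lemma germ_unique (hU : UniqueLifts OS O f Z) {p : (Zᶜ : Set S)}
    {τ τ' : (Zᶜ : Set S) → (E ≃L[ℝ] E)} (hτ : τ ∈ germ Z ξ η p) (hτ' : τ' ∈ germ Z ξ η p)
    (h : τ p = τ' p) : ∀ᶠ q in 𝓝 p, τ q = τ' q := by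
  obtain ⟨α, x, β, κ, φ, h1, h2, h3, h4⟩ := hτ
  obtain ⟨φ', h3', h4'⟩ := germ_presentation hU hτ' h2 h1
  have hp : (ξ.sys α).π x ∉ Z := by rw [h1]; exact p.2
  have e : (⟨_, hp⟩ : (Zᶜ : Set S)) = p := Subtype.ext h1
  have e1 := h4.self_of_nhds.2 hp
  have e2 := h4'.self_of_nhds.2 hp
  rw [e] at e1 e2
  rw [e1, e2, val, val, mul_left_inj, mul_right_inj] at h
  have h5 := h3.eventually_eq_of_der_eq h3'
    (h4.self_of_nhds.1.trans h4'.self_of_nhds.1.symm) h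
  refine eventually_of_eventually_π h1 ?_
  filter_upwards [h4, h4', (ξ.continuousAt_l x).eventually h5.eventually_nhds] with w a b c hw
  rw [a.2 hw, b.2 hw, val, val, der_congr c]

/-- The quotient is presented by `φ' ∘ φ⁻¹` over `κ' ∘ κ⁻¹`; the frames of `ζ` cancel. -/
lemma germ_div (hU : UniqueLifts OS O f Z) {p : (Zᶜ : Set S)}
    {τ τ' : (Zᶜ : Set S) → (E ≃L[ℝ] E)} (hτ : τ ∈ germ Z ζ ξ p) (hτ' : τ' ∈ germ Z ζ η p) :
    τ' * τ⁻¹ ∈ germ Z ξ η p := by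
  obtain ⟨α, x, β, κ, φ, h1, h2, h3, h4⟩ := hτ
  obtain ⟨⟨β', y'⟩, hy'⟩ := η.exists_pt p
  obtain ⟨κ', hκ', rfl⟩ := ζ.exists_loc η (x := x) (y := y') (h1.trans hy'.symm)
  obtain ⟨φ', h3', h4'⟩ := germ_presentation hU hτ' hκ' h1
  obtain ⟨ψ, hψ, hψx, hψκ, -⟩ := h2.exists_inv
  obtain ⟨χ, hχ, hχx, hχφ, -⟩ := h3.exists_inv
  have e1 := h4.self_of_nhds.1
  have hl1 : Loc _ _ (κ' ∘ ψ) (κ x) := Loc.comp (by rw [hψx]; exact hκ') hψ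
  have hl2 : Loc _ _ (φ' ∘ χ) (φ (ζ.l α x)) := Loc.comp (by rw [hχx]; exact h3') hχ
  refine ⟨β, κ x, β', κ' ∘ ψ, φ' ∘ χ, h2.comm.trans h1, hl1, by rw [← e1]; exact hl2, ?_⟩
  rw [h2.eventually_of_map]
  have hφc : ContinuousAt (fun w => φ (ζ.l α w)) x :=
    ContinuousAt.comp (g := φ) h3.continuousAt (ζ.continuousAt_l x)
  filter_upwards [h4, h4', hψκ, (ζ.continuousAt_l x).eventually hχφ.eventually_nhds,
    h2.eventually, (ζ.continuousAt_l x).eventually h3.eventually,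
    (ζ.continuousAt_l x).eventually h3'.eventually, hφc.eventually hχ.eventually]
    with w a b c d m n n' k
  have hχw := d.self_of_nhds
  refine ⟨?_, fun hw => ?_⟩
  · rw [← a.1, Function.comp_apply, hχw, b.1, Function.comp_apply, c]
  have hw' : (ζ.sys α).π w ∉ Z := by rwa [← m.comm]
  have e : (⟨_, hw⟩ : (Zᶜ : Set S)) = ⟨_, hw'⟩ := Subtype.ext m.comm
  have hder : der χ (φ (ζ.l α w)) * der φ (ζ.l α w) = 1 := by
    rw [← Loc.der_comp k n, der_congr (φ := χ ∘ φ) (ψ := id) d, der_id]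
  have hD : der (φ' ∘ χ) (ξ.l β (κ w)) = der φ' (ζ.l α w) * (der φ (ζ.l α w))⁻¹ := by
    rw [← a.1, Loc.der_comp (by rw [hχw]; exact n') k, hχw, eq_inv_of_mul_eq_one_left hder]
  have hF := frame_inv hU (ξ := ξ) (P := ⟨β, κ w⟩) (Q := ξ.base ((ζ.sys α).π w))
    (m.comm.trans (ξ.pr_base _).symm) hw
  rw [e, Pi.mul_apply, Pi.inv_apply, a.2 hw', b.2 hw', val, val, val, hD, Function.comp_apply, c,
    m.comm, hF]
  group

open Classical in
/-- The function with a given presentation. -/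
noncomputable def germFun (Z : Set S) {α : ξ.Λ} {β : η.Λ} (N : Set (ξ.sys α).V)
    (κ : (ξ.sys α).V → (η.sys β).V) (φ : (ξ.sys' α).V → (η.sys' β).V) :
    (Zᶜ : Set S) → (E ≃L[ℝ] E) := fun q =>
  if h : ∃ w ∈ N, (ξ.sys α).π w = q then val κ φ h.choose else 1

lemma germFun_apply {α : ξ.Λ} {β : η.Λ} {N : Set (ξ.sys α).V} (hN : InjOn (ξ.sys α).π N)
    (κ : (ξ.sys α).V → (η.sys β).V) (φ : (ξ.sys' α).V → (η.sys' β).V) {w : (ξ.sys α).V}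
    (hw : w ∈ N) (h : (ξ.sys α).π w ∉ Z) : germFun Z N κ φ ⟨_, h⟩ = val κ φ w := by
  have hex : ∃ w' ∈ N, (ξ.sys α).π w' = (ξ.sys α).π w := ⟨w, hw, rfl⟩
  rw [germFun, dif_pos hex, hN hex.choose_spec.1 hw hex.choose_spec.2]

lemma germFun_mem {α : ξ.Λ} {β : η.Λ} {N : Set (ξ.sys α).V} (hN : InjOn (ξ.sys α).π N)
    {κ : (ξ.sys α).V → (η.sys β).V} {φ : (ξ.sys' α).V → (η.sys' β).V} {w : (ξ.sys α).V}
    (hw : N ∈ 𝓝 w) (hκ : Loc _ _ κ w) (hφ : Loc _ _ φ (ξ.l α w))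
    (hc : ∀ᶠ w in 𝓝 w, φ (ξ.l α w) = η.l β (κ w)) {p : (Zᶜ : Set S)} (hp : (ξ.sys α).π w = p) :
    germFun Z N κ φ ∈ germ Z ξ η p := by
  refine ⟨α, w, β, κ, φ, hp, hκ, hφ, ?_⟩
  filter_upwards [hc, hw] with v h1 h2 using ⟨h1, fun h => germFun_apply hN _ _ h2 h⟩

lemma germ_nonempty (hU : UniqueLifts OS O f Z) (ξ η : CompatibleSystem F) (p : (Zᶜ : Set S)) :
    (germ Z ξ η p).Nonempty := by
  obtain ⟨⟨α, x⟩, hx⟩ := ξ.exists_pt p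
  obtain ⟨⟨β, y⟩, hy⟩ := η.exists_pt p
  obtain ⟨κ, hκ, -⟩ := ξ.exists_loc η (x := x) (y := y) (hx.trans hy.symm)
  obtain ⟨φ, hφ, hc⟩ := hU.lift (ξ.lift α) (η.lift β) (ξ.sys_mem α) (ξ.sys'_mem α)
    (η.sys'_mem β) κ x hκ
  obtain ⟨N, hN, hi⟩ := hU.inj _ (ξ.sys_mem α) x (by
    rw [show (ξ.sys α).π x = p from hx]; exact p.2)
  exact ⟨_, germFun_mem hi hN hκ hφ hc hx⟩

/-- Presented over the identity, an automorphism is a group element of the target chart fixing the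
lift of the point. Hence there are at most `M` values. -/
lemma germ_fibre (hU : UniqueLifts OS O f Z) {M : ℕ} (hM1 : 1 ≤ M)
    (hM : ∀ c ∈ O.charts, ∀ x : c.V, c.π x ∈ range f → (c.stab x).ncard ≤ M)
    (ξ : CompatibleSystem F) (p : (Zᶜ : Set S)) :
    ∃ e : (E ≃L[ℝ] E) → Fin M, InjOn e {h | ∃ τ ∈ germ Z ξ ξ p, τ p = h} := by
  obtain ⟨⟨α, x⟩, hx⟩ := ξ.exists_pt p
  have hx' : (ξ.sys α).π x = p := hx
  have hp : (ξ.sys α).π x ∉ Z := by rw [hx']; exact p.2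
  have e : (⟨_, hp⟩ : (Zᶜ : Set S)) = p := Subtype.ext hx
  have hsub : {h | ∃ τ ∈ germ Z ξ ξ p, τ p = h} ⊆
      (fun g : (ξ.sys' α).V ≃ₜ (ξ.sys' α).V => val (η := ξ) (α := α) (β := α) id g x) '' ((ξ.sys' α).stab (ξ.l α x)) := by
    rintro h ⟨τ, hτ, rfl⟩
    obtain ⟨φ, hφ, hc⟩ := germ_presentation hU hτ (loc_id x) hx'
    obtain ⟨g, hg, hgφ⟩ := (loc_id (ξ.l α x)).exists_group hφ
    have h1 : g (ξ.l α x) = ξ.l α x := hgφ.self_of_nhds.symm.trans hc.self_of_nhds.1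
    refine ⟨g, ⟨hg, h1⟩, ?_⟩
    have h2 := hc.self_of_nhds.2 hp
    rw [e] at h2
    rw [h2]
    simp only [val]
    rw [der_congr hgφ]
    rfl
  have hfin := (ξ.sys' α).finite_stab (ξ.l α x)
  have hcard := (Set.ncard_le_ncard hsub (hfin.image _)).trans ((Set.ncard_image_le hfin).trans
    (hM _ (ξ.sys'_mem α) (ξ.l α x) ⟨_, ((ξ.lift α).comm x).symm⟩))
  set A := {h | ∃ τ ∈ germ Z ξ ξ p, τ p = h}
  have hA : A.Finite := (hfin.image _).subset hsub
  have := hA.to_subtype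
  have := Fintype.ofFinite A
  obtain ⟨ε⟩ := Function.Embedding.nonempty_of_card_le (α := A) (β := Fin M) (by
    rw [Fintype.card_fin, ← Nat.card_eq_fintype_card, Nat.card_coe_set_eq]
    exact hcard)
  refine ⟨Function.extend Subtype.val ε fun _ => ⟨0, hM1⟩, fun a ha b hb hab => ?_⟩
  have h1 := Subtype.val_injective.extend_apply ε (fun _ => ⟨0, hM1⟩) (⟨a, ha⟩ : A)
  have h2 := Subtype.val_injective.extend_apply ε (fun _ => ⟨0, hM1⟩) (⟨b, hb⟩ : A)
  exact congrArg Subtype.val (ε.injective (h1.symm.trans (hab.trans h2)))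

/-- The sheets are the translates `g ∘ φ` of one comparison `φ` by the elements `g` that fix the
lift over all of `N`. By unique continuation, fixing it near one point of `N` is enough. -/
lemma germ_even (hU : UniqueLifts OS O f Z) (ξ η : CompatibleSystem F) (p : (Zᶜ : Set S)) :
    ∃ U, IsOpen U ∧ p ∈ U ∧ ∃ 𝒯 : Set ((Zᶜ : Set S) → (E ≃L[ℝ] E)),
      (∀ τ ∈ 𝒯, ∀ q ∈ U, τ ∈ germ Z ξ η q) ∧
        ∀ q ∈ U, ∀ τ ∈ germ Z ξ η q, ∃! τ', τ' ∈ 𝒯 ∧ τ' q = τ q := by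
  obtain ⟨⟨α, x⟩, hx⟩ := ξ.exists_pt p
  obtain ⟨⟨β, y⟩, hy⟩ := η.exists_pt p
  obtain ⟨κ, hκ, -⟩ := ξ.exists_loc η (x := x) (y := y) (hx.trans hy.symm)
  obtain ⟨φ, hφ, hc⟩ := hU.lift (ξ.lift α) (η.lift β) (ξ.sys_mem α) (ξ.sys'_mem α)
    (η.sys'_mem β) κ x hκ
  obtain ⟨U₀, hU₀, hi⟩ := hU.inj _ (ξ.sys_mem α) x (by
    rw [show (ξ.sys α).π x = p from hx]; exact p.2)
  obtain ⟨N, hNW, hN⟩ := hU.good _ (ξ.sys_mem α) x _ (((hκ.eventually.and hc).and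
    ((ξ.continuousAt_l x).eventually hφ.eventually)).and hU₀)
  have hNκ : ∀ w ∈ N, Loc _ _ κ w := fun w hw => (hNW hw).1.1.1
  have hNc : ∀ w ∈ N, φ (ξ.l α w) = η.l β (κ w) := fun w hw => (hNW hw).1.1.2
  have hNφ : ∀ w ∈ N, Loc _ _ φ (ξ.l α w) := fun w hw => (hNW hw).1.2
  have hNi : InjOn (ξ.sys α).π N := hi.mono fun w hw => (hNW hw).2
  have hNo : ∀ w ∈ N, N ∈ 𝓝 w := fun w hw => hN.isOpen.mem_nhds hw
  let A : Set ((η.sys' β).V ≃ₜ (η.sys' β).V) :=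
    {g | g ∈ (η.sys' β).G ∧ ∀ w ∈ N, g (η.l β (κ w)) = η.l β (κ w)}
  have hAφ : ∀ g ∈ A, ∀ w ∈ N, Loc _ _ (g ∘ φ) (ξ.l α w) := fun g hg w hw =>
    (loc_of_group hg.1 _).comp (hNφ w hw)
  refine ⟨Subtype.val ⁻¹' ((ξ.sys α).π '' N),
    ((ξ.sys α).isOpenMap N hN.isOpen).preimage continuous_subtype_val, ⟨x, hN.mem, hx⟩,
    (fun g : (η.sys' β).V ≃ₜ (η.sys' β).V => germFun Z N κ (g ∘ φ)) '' A, ?_, ?_⟩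
  · rintro _ ⟨g, hg, rfl⟩ q ⟨w, hw, hwq⟩
    refine germFun_mem hNi (hNo w hw) (hNκ w hw) (hAφ g hg w hw) ?_ hwq
    filter_upwards [hNo w hw] with v hv
    rw [Function.comp_apply, hNc v hv, hg.2 v hv]
  · rintro q ⟨w, hw, hwq⟩ τ hτ
    have hq : (ξ.sys α).π w ∉ Z := by rw [hwq]; exact q.2
    have e : (⟨_, hq⟩ : (Zᶜ : Set S)) = q := Subtype.ext hwq
    have hval : ∀ g : (η.sys' β).V ≃ₜ (η.sys' β).V,
        germFun Z N κ (g ∘ φ) q = val κ (g ∘ φ) w := fun g => by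
      rw [← e]
      exact germFun_apply hNi κ (g ∘ φ) hw hq
    obtain ⟨φ', hφ', hc'⟩ := germ_presentation hU hτ (hNκ w hw) hwq
    obtain ⟨g, hg, hgφ⟩ := (hNφ w hw).exists_group hφ'
    have hgA : g ∈ A := by
      refine ⟨hg, hN.unique (η.sys' β) (η.sys'_mem β) (fun w => g (η.l β (κ w)))
        (fun w => η.l β (κ w)) (fun v hv => ?_)
        (fun v hv => (η.lift β).contMDiffAt_comp_loc (hNκ v hv)) ⟨w, hw, ?_⟩⟩
      · obtain ⟨h1, h2⟩ := (η.lift β).contMDiffAt_comp_loc (hNκ v hv)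
        exact ⟨(contMDiffAt_of_group hg _).comp v h1, (π_group hg _).trans h2⟩
      · filter_upwards [hc', (ξ.continuousAt_l w).eventually hgφ, hNo w hw] with v h1 h2 h3
        rw [← hNc v h3, ← h2, h1.1, hNc v h3]
    have hgτ : germFun Z N κ (g ∘ φ) q = τ q := by
      have h1 := hc'.self_of_nhds.2 hq
      rw [e] at h1
      rw [hval, h1, val, val, der_congr hgφ]
      rfl
    refine ⟨_, ⟨⟨g, hgA, rfl⟩, hgτ⟩, ?_⟩
    rintro _ ⟨⟨g', hg', rfl⟩, h'⟩
    have h1 : val κ (g' ∘ φ) w = val κ (g ∘ φ) w := by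
      rw [← hval, ← hval]
      exact h'.trans hgτ.symm
    rw [val, val, mul_left_inj, mul_right_inj, Loc.der_comp (loc_of_group hg'.1 _) (hNφ w hw),
      Loc.der_comp (loc_of_group hg _) (hNφ w hw), mul_left_inj] at h1
    have h2 : g' (φ (ξ.l α w)) = g (φ (ξ.l α w)) := by
      rw [hNc w hw, hg'.2 w hw, hgA.2 w hw]
    rw [eq_of_der_eq hg'.1 hg h2 h1]

/-- The covering spaces of isomorphisms between the compatible systems of a map. -/
noncomputable def locSys (hU : UniqueLifts OS O f Z) (F : SmoothMap OS O f) {M : ℕ} (hM1 : 1 ≤ M)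
    (hM : ∀ c ∈ O.charts, ∀ x : c.V, c.π x ∈ range f → (c.stab x).ncard ≤ M) :
    LocSys (Zᶜ : Set S) (E ≃L[ℝ] E) (CompatibleSystem F) M where
  germ := germ Z
  eventually := germ_eventually
  even := germ_even hU
  unique := germ_unique hU
  div := germ_div hU
  one_le := hM1
  fibre := germ_fibre hU hM1 hM
  nonempty := germ_nonempty hU

end CompatibleSystem

end Germs

end Orb

namespace Orb

/-! ### The action of local changes on orbibundles -/

section BundleTransitions

variable {E : Type*} [NormedAddCommGroup E] [NormedSpace ℝ E] [FiniteDimensional ℝ E]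
  {X : Type*} [TopologicalSpace X] {O : Orbifold E X} {r : ℕ} {B : O.Bundle r}

namespace Orbibundle

variable (B) in
/-- `T` is the isomorphism by which the bundle lifts the germ of the local change `φ` at `y`. -/
def IsLift {c d : O.charts} (t : B.triv c) (s : B.triv d) (φ : c.1.V → d.1.V) (y : c.1.V)
    (T : Fib r ≃L[ℝ] Fib r) : Prop :=
  ∃ (e : O.charts) (q : B.triv e) (a : Injection e.1 c.1) (b : Injection e.1 d.1) (w : e.1.V),
    w ∈ B.dom q ∧ a w = y ∧ (∀ᶠ v in 𝓝 w, φ (a v) = b v) ∧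
      T * B.g q t a w = B.g q s b w

variable {c d c' d' : O.charts} {t : B.triv c} {s : B.triv d} {t' : B.triv c'} {s' : B.triv d'}
  {φ φ' : c.1.V → d.1.V} {y : c.1.V} {T T' : Fib r ≃L[ℝ] Fib r}

lemma exists_isLift (t : B.triv c) (s : B.triv d) (h : Loc c.1 d.1 φ y) :
    ∃ T, B.IsLift t s φ y T := by
  obtain ⟨e, he, a, b, w, hw, -, hab⟩ := h.exists_span O c.2 Filter.univ_mem
  obtain ⟨q, hq⟩ := B.cover ⟨e, he⟩ w
  exact ⟨B.g q s (show Injection (⟨e, he⟩ : O.charts).1 d.1 from b) w *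
    (B.g q t (show Injection (⟨e, he⟩ : O.charts).1 c.1 from a) w)⁻¹, ⟨e, he⟩, q, a, b, w, hq, hw,
    Filter.Eventually.of_forall hab, by simp⟩

lemma IsLift.congr (h : B.IsLift t s φ y T) (e : ∀ᶠ w in 𝓝 y, φ w = φ' w) :
    B.IsLift t s φ' y T := by
  obtain ⟨e', q, a, b, w, hq, rfl, hab, hT⟩ := h
  refine ⟨e', q, a, b, w, hq, rfl, ?_, hT⟩
  filter_upwards [hab, (a.loc w).continuousAt.eventually e] with v h1 h2
  rw [← h2, h1]

/-- Two presentations of the change are compared on a common refinement, where the cocycle identity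
leaves only one possible isomorphism. -/
lemma IsLift.eq (h : B.IsLift t s φ y T) (h' : B.IsLift t s φ y T') (ht : y ∈ B.dom t)
    (hs : φ y ∈ B.dom s) : T = T' := by
  obtain ⟨e, q, a, b, w, hq, rfl, hab, hT⟩ := h
  obtain ⟨e', q', a', b', w', hq', hw', hab', hT'⟩ := h'
  obtain ⟨ψ, hψ, h3, h4, h5⟩ := (a'.loc w').exists_inv
  rw [hw'] at hψ h3 h5
  obtain ⟨e₂, he₂, i, i', v, rfl, -, hi⟩ := (hψ.comp (a.loc w)).exists_span O e.2 Filter.univ_mem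
  obtain ⟨q₂, hq₂⟩ := B.cover ⟨e₂, he₂⟩ v
  have hv : i' v = w' := by rw [← hi]; exact h3
  have hc : ContinuousAt (fun u => a (i u)) v :=
    (a.loc (i v)).continuousAt.comp (i.loc v).continuousAt
  have ha : a.comp i = a'.comp i' := by
    refine Injection.eq_of_eventually_eq (x := v) ?_
    filter_upwards [hc.eventually h5] with u h9
    change a (i u) = a' (i' u)
    rw [← hi]
    exact h9.symm
  have hb : b.comp i = b'.comp i' := by
    refine Injection.eq_of_eventually_eq (x := v) ?_
    rw [← hv] at hab'
    filter_upwards [(i.loc v).continuousAt.eventually hab,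
      (i'.loc v).continuousAt.eventually hab'] with u h6 h7
    change b (i u) = b' (i' u)
    rw [← h6, ← h7]
    exact congrArg φ (congrArg (fun j : Injection _ _ => j u) ha)
  subst hv
  have k1 := B.cocycle q₂ q t a (show Injection (⟨e₂, he₂⟩ : O.charts).1 e.1 from i) v hq₂ hq ht
  have k2 := B.cocycle q₂ q' t a' (show Injection (⟨e₂, he₂⟩ : O.charts).1 e'.1 from i') v hq₂ hq'
    (by rw [hw']; exact ht)
  have hs2 : b (i v) ∈ B.dom s := by rw [← hab.self_of_nhds]; exact hs
  have k3 := B.cocycle q₂ q s b (show Injection (⟨e₂, he₂⟩ : O.charts).1 e.1 from i) v hq₂ hq hs2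
  have k4 := B.cocycle q₂ q' s b' (show Injection (⟨e₂, he₂⟩ : O.charts).1 e'.1 from i') v hq₂ hq'
    (by rw [← hab'.self_of_nhds, hw']; exact hs)
  have m1 : T * B.g q₂ t (show Injection (⟨e₂, he₂⟩ : O.charts).1 c.1 from a.comp i) v =
      B.g q₂ s (show Injection (⟨e₂, he₂⟩ : O.charts).1 d.1 from b.comp i) v :=
    (congrArg (T * ·) k1).trans ((mul_assoc _ _ _).symm.trans
      ((congrArg (· * _) hT).trans k3.symm))
  have m2 : T' * B.g q₂ t (show Injection (⟨e₂, he₂⟩ : O.charts).1 c.1 from a'.comp i') v =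
      B.g q₂ s (show Injection (⟨e₂, he₂⟩ : O.charts).1 d.1 from b'.comp i') v :=
    (congrArg (T' * ·) k2).trans ((mul_assoc _ _ _).symm.trans
      ((congrArg (· * _) hT').trans k4.symm))
  rw [← ha, ← hb, ← m1] at m2
  exact (mul_right_cancel m2).symm

/-- Lifts are natural under injections. -/
lemma IsLift.natural {φ' : c'.1.V → d'.1.V} (h : B.IsLift t s φ y T) {i : Injection c.1 c'.1}
    {j : Injection d.1 d'.1} (h' : B.IsLift t' s' φ' (i y) T')
    (hij : ∀ᶠ w in 𝓝 y, φ' (i w) = j (φ w)) (ht : y ∈ B.dom t) (hs : φ y ∈ B.dom s)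
    (ht' : i y ∈ B.dom t') (hs' : j (φ y) ∈ B.dom s') :
    T' * B.g t t' i y = B.g s s' j (φ y) * T := by
  obtain ⟨e, q, a, b, w, hq, rfl, hab, hT⟩ := h
  have hbw := hab.self_of_nhds
  have hφ' := hij.self_of_nhds
  have h2 : B.IsLift t' s' φ' (i (a w))
      (B.g q s' (j.comp b) w * (B.g q t' (i.comp a) w)⁻¹) := by
    refine ⟨e, q, i.comp a, j.comp b, w, hq, rfl, ?_, by simp⟩
    filter_upwards [hab, (a.loc w).continuousAt.eventually hij] with v h3 h4
    change φ' (i (a v)) = j (b v)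
    rw [h4, h3]
  have h3 := h'.eq h2 ht' (by rw [hφ']; exact hs')
  have k1 := B.cocycle q t t' i a w hq ht ht'
  rw [hbw] at hs hs' ⊢
  have k2 := B.cocycle q s s' j b w hq hs hs'
  have h4 : T' * B.g q t' (i.comp a) w = B.g q s' (j.comp b) w := by rw [h3]; simp
  rw [k1, k2, ← hT, ← mul_assoc, ← mul_assoc] at h4
  exact mul_right_cancel h4

/-- Lifts depend smoothly on the point. -/
lemma exists_contMDiffAt_isLift (h : Loc c.1 d.1 φ y) (ht : y ∈ B.dom t) (hs : φ y ∈ B.dom s) :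
    ∃ τ : c.1.V → (Fib r →L[ℝ] Fib r), ContMDiffAt 𝓘(ℝ, E) 𝓘(ℝ, Fib r →L[ℝ] Fib r) ∞ τ y ∧
      ∀ᶠ w in 𝓝 y, ∀ T, B.IsLift t s φ w T → (T : Fib r →L[ℝ] Fib r) = τ w := by
  obtain ⟨e, he, a, b, w, rfl, -, hab⟩ := h.exists_span O c.2 Filter.univ_mem
  obtain ⟨q, hq⟩ := B.cover ⟨e, he⟩ w
  let e' : O.charts := ⟨e, he⟩
  let a' : Injection e'.1 c.1 := a
  let b' : Injection e'.1 d.1 := b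
  obtain ⟨ψ, hψ, hψw, h4, h5⟩ := (a'.loc w).exists_inv
  have hbw : b' w ∈ B.dom s := by
    change b w ∈ B.dom s
    rw [← hab]
    exact hs
  have o1 : IsOpen (B.dom q ∩ a' ⁻¹' B.dom t) := (B.isOpen_dom q).inter
    ((B.isOpen_dom t).preimage a'.isLocalDiffeomorph.contMDiff.continuous)
  have o2 : IsOpen (B.dom q ∩ b' ⁻¹' B.dom s) := (B.isOpen_dom q).inter
    ((B.isOpen_dom s).preimage b'.isLocalDiffeomorph.contMDiff.continuous)
  have s1 := (B.smooth q t a').contMDiffAt (o1.mem_nhds ⟨hq, ht⟩)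
  have s2 := (B.smooth q s b').contMDiffAt (o2.mem_nhds ⟨hq, hbw⟩)
  have s1' : ContMDiffAt 𝓘(ℝ, E) 𝓘(ℝ, Fib r →L[ℝ] Fib r) ∞
      (fun v => (B.g q t a' (ψ v) : Fib r →L[ℝ] Fib r)) (a' w) :=
    ContMDiffAt.comp (a' w) (g := fun v => (B.g q t a' v : Fib r →L[ℝ] Fib r))
      (by rw [hψw]; exact s1) hψ.contMDiffAt
  have s2' : ContMDiffAt 𝓘(ℝ, E) 𝓘(ℝ, Fib r →L[ℝ] Fib r) ∞
      (fun v => (B.g q s b' (ψ v) : Fib r →L[ℝ] Fib r)) (a' w) :=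
    ContMDiffAt.comp (a' w) (g := fun v => (B.g q s b' v : Fib r →L[ℝ] Fib r))
      (by rw [hψw]; exact s2) hψ.contMDiffAt
  refine ⟨fun v => (B.g q s b' (ψ v) : Fib r →L[ℝ] Fib r).comp
    (ContinuousLinearMap.inverse (B.g q t a' (ψ v) : Fib r →L[ℝ] Fib r)), ?_, ?_⟩
  · refine s2'.clm_comp ?_
    have hinv : ContDiffAt ℝ ∞ (ContinuousLinearMap.inverse : (Fib r →L[ℝ] Fib r) → _)
      (B.g q t a' (ψ (a' w)) : Fib r →L[ℝ] Fib r) := contDiffAt_map_inverse _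
    exact ContMDiffAt.comp (a' w) hinv.contMDiffAt s1'
  · have hφc : ContinuousAt φ (a w) := h.continuousAt
    have hψq : ∀ᶠ v in 𝓝 (a' w), ψ v ∈ B.dom q :=
      hψ.continuousAt.eventually ((B.isOpen_dom q).mem_nhds (by rw [hψw]; exact hq))
    filter_upwards [h5, hψq, (B.isOpen_dom t).mem_nhds ht,
      hφc.eventually ((B.isOpen_dom s).mem_nhds hs)] with v h6 h7 h8 h9 T hT
    have h10 : B.IsLift t s φ v (B.g q s b' (ψ v) * (B.g q t a' (ψ v))⁻¹) :=
      ⟨e', q, a', b', ψ v, h7, h6, Filter.Eventually.of_forall hab, by simp⟩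
    rw [hT.eq h10 h8 h9, ContinuousLinearMap.inverse_equiv]
    rfl

end Orbibundle

end BundleTransitions

end Orb

namespace Orb

/-! ### From a section to an isomorphism of compatible systems -/

section SectionIso

variable {E : Type*} [NormedAddCommGroup E] [NormedSpace ℝ E] [FiniteDimensional ℝ E]
  {X : Type*} [TopologicalSpace X] {O : Orbifold E X}
  {S : Type*} [TopologicalSpace S] [T1Space S] [ChartedSpace ℂ S] [IsManifold 𝓘(ℂ) ω S]
  {f : C(S, X)} {OS : Orbifold ℂ S} {Z : Set S}

namespace CompatibleSystem

variable {F : SmoothMap OS O f} {ξ η : CompatibleSystem F}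
  {σ : (Zᶜ : Set S) → (E ≃L[ℝ] E)}

lemma mem_germ_of_isSec (hU : UniqueLifts OS O f Z) {M : ℕ} {hM1 : 1 ≤ M}
    {hM : ∀ c ∈ O.charts, ∀ x : c.V, c.π x ∈ range f → (c.stab x).ncard ≤ M}
    (h : (locSys hU F hM1 hM).IsSec ξ η id σ) (p : (Zᶜ : Set S)) : σ ∈ germ Z ξ η p := by
  obtain ⟨τ, ⟨α, x, β, κ, φ, h1, h2, h3, h4⟩, hτ⟩ := h p
  refine ⟨α, x, β, κ, φ, h1, h2, h3, ?_⟩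
  have h5 : ∀ᶠ q in 𝓝 (p : S), ∀ hq : q ∉ Z, σ ⟨q, hq⟩ = τ ⟨q, hq⟩ := by
    have h7 : ∀ᶠ q in Filter.map Subtype.val (𝓝 p), ∀ hq : q ∉ Z, σ ⟨q, hq⟩ = τ ⟨q, hq⟩ :=
      Filter.eventually_map.2 (hτ.mono fun q hq _ => hq)
    exact hU.isClosed.isOpen_compl.isOpenEmbedding_subtypeVal.isOpenMap.nhds_le p h7
  have h1' : (ξ.sys α).π x = p := h1
  rw [← h1'] at h5
  filter_upwards [h4, (ξ.sys α).continuous.continuousAt.eventually h5] with w h8 h9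
  exact ⟨h8.1, fun h => (h9 h).trans (h8.2 h)⟩

/-- The germ of `φ` at the lift of `x`, over the local change `κ`, belongs to the family `σ`. -/
structure Along (σ : (Zᶜ : Set S) → (E ≃L[ℝ] E)) {α : ξ.Λ} {β : η.Λ}
    (κ : (ξ.sys α).V → (η.sys β).V) (x : (ξ.sys α).V) (φ : (ξ.sys' α).V → (η.sys' β).V) :
    Prop where
  loc : Loc (ξ.sys' α) (η.sys' β) φ (ξ.l α x)
  eventually : ∀ᶠ w in 𝓝 x, φ (ξ.l α w) = η.l β (κ w) ∧
    ∀ h : (ξ.sys α).π w ∉ Z, σ ⟨_, h⟩ = val κ φ w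

variable {α α' : ξ.Λ} {β β' : η.Λ} {κ κ' : (ξ.sys α).V → (η.sys β).V} {x : (ξ.sys α).V}
  {φ φ' : (ξ.sys' α).V → (η.sys' β).V}

lemma Along.comm (h : Along σ κ x φ) : φ (ξ.l α x) = η.l β (κ x) := h.eventually.self_of_nhds.1

lemma Along.nhds (h : Along σ κ x φ) : ∀ᶠ w in 𝓝 x, Along σ κ w φ := by
  filter_upwards [(ξ.continuousAt_l x).eventually h.loc.eventually, h.eventually.eventually_nhds]
    with w h1 h2 using ⟨h1, h2⟩

lemma Along.congr (h : Along σ κ x φ) (e : ∀ᶠ w in 𝓝 x, κ w = κ' w) : Along σ κ' x φ := by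
  refine ⟨h.loc, ?_⟩
  filter_upwards [h.eventually, e] with w h1 h2
  rw [← h2]
  refine ⟨h1.1, fun hw => (h1.2 hw).trans ?_⟩
  rw [val, val, h2]

/-- Near every point there are regular points. -/
lemma UniqueLifts.frequently (hU : UniqueLifts OS O f Z) {c : UChart ℂ S} (hc : c ∈ OS.charts)
    (x : c.V) : ∃ᶠ w in 𝓝 x, c.π w ∉ Z := by
  obtain ⟨N, -, hN⟩ := hU.good c hc x univ Filter.univ_mem
  refine (hN.frequently.and_eventually (hN.isOpen.mem_nhds hN.mem)).mono ?_
  rintro w ⟨h1, h2⟩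
  exact hN.notMem w h2 h1

/-- The two changes differ by a group element near the lift of `x`. At a nearby point off `Z` their
1-jets agree, so this element is trivial, even when `x` itself lies over `Z`. -/
lemma Along.eventually_eq (hU : UniqueLifts OS O f Z) (h : Along σ κ x φ)
    (h' : Along σ κ x φ') : ∀ᶠ y in 𝓝 (ξ.l α x), φ y = φ' y := by
  obtain ⟨g, hg, hgφ⟩ := h.loc.exists_group h'.loc
  obtain ⟨w, hw, h1, h2, h3⟩ := ((UniqueLifts.frequently hU (ξ.sys_mem α) x).and_eventually
    (h.nhds.and (h'.nhds.and ((ξ.continuousAt_l x).eventually hgφ.eventually_nhds)))).exists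
  have h4 := (h1.eventually.self_of_nhds.2 hw).symm.trans (h2.eventually.self_of_nhds.2 hw)
  rw [val, val, mul_left_inj, mul_right_inj, der_congr (φ := φ') (ψ := g ∘ φ) h3,
    Loc.der_comp (loc_of_group hg _) h1.loc, eq_comm, mul_eq_right] at h4
  have h5 : g (φ (ξ.l α w)) = φ (ξ.l α w) := by
    rw [← h3.self_of_nhds, h1.comm, h2.comm]
  have h6 : g = 1 := eq_of_der_eq hg (η.sys' β).G.one_mem h5
    (h4.trans (der_id (φ (ξ.l α w))).symm)
  filter_upwards [hgφ] with y hy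
  rw [hy, h6]
  rfl

/-- The derivative of `Λ` is exactly the frame from the old point to the new one, so the value is
unchanged. The same holds for changes of the source chart. -/
lemma Along.trans_left (hU : UniqueLifts OS O f Z) (hκ : Loc _ _ κ x) (h : Along σ κ x φ)
    {μ : (η.sys β).V → (η.sys β').V} {Λ : (η.sys' β).V → (η.sys' β').V}
    (hμ : Loc _ _ μ (κ x)) (hΛ : η.Trans μ (κ x) Λ) : Along σ (μ ∘ κ) x (Λ ∘ φ) := by
  refine ⟨Loc.comp (by rw [h.comm]; exact hΛ.loc) h.loc, ?_⟩
  filter_upwards [h.nhds, hκ.eventually, hκ.continuousAt.eventually hμ.eventually,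
    hκ.continuousAt.eventually hΛ.eventually] with w h1 h2 h3 h4
  refine ⟨?_, fun hw => ?_⟩
  · rw [Function.comp_apply, h1.comm]
    exact h4.comm.self_of_nhds
  have hw' : (η.sys β).π (κ w) ∉ Z := by rwa [h2.comm]
  rw [h1.eventually.self_of_nhds.2 hw, val, val,
    Loc.der_comp (by rw [h1.comm]; exact h4.loc) h1.loc, h1.comm, ← frame_eq hU h3 h4 hw',
    ← frame_comp hU (P := ⟨β, κ w⟩) (Q := ⟨β', μ (κ w)⟩) (R := η.base ((ξ.sys α).π w))
      h3.comm.symm ((h3.comm.trans h2.comm).trans (η.pr_base _).symm) hw']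
  rfl

lemma Along.trans_right (hU : UniqueLifts OS O f Z) {x : (ξ.sys α').V}
    {ρ : (ξ.sys α').V → (ξ.sys α).V} {Λ : (ξ.sys' α').V → (ξ.sys' α).V} (hρ : Loc _ _ ρ x)
    (hΛ : ξ.Trans ρ x Λ) (h : Along σ κ (ρ x) φ) : Along σ (κ ∘ ρ) x (φ ∘ Λ) := by
  have e := hΛ.comm.self_of_nhds
  refine ⟨Loc.comp (by rw [e]; exact h.loc) hΛ.loc, ?_⟩
  filter_upwards [hΛ.eventually, hρ.eventually, hρ.continuousAt.eventually h.nhds]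
    with w h1 h2 h3
  have e' := h1.comm.self_of_nhds
  refine ⟨?_, fun hw => ?_⟩
  · rw [Function.comp_apply, e', h3.comm]
    rfl
  have hw' : (ξ.sys α).π (ρ w) ∉ Z := by rwa [h2.comm]
  have e2 : (⟨_, hw⟩ : (Zᶜ : Set S)) = ⟨_, hw'⟩ := Subtype.ext h2.comm.symm
  rw [e2, h3.eventually.self_of_nhds.2 hw', val, val,
    Loc.der_comp (by rw [e']; exact h3.loc) h1.loc, e', ← frame_eq hU h2 h1 hw, h2.comm,
    ← frame_comp hU (P := ξ.base ((ξ.sys α').π w)) (Q := ⟨α', w⟩) (R := ⟨α, ρ w⟩)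
      (ξ.pr_base _) h2.comm.symm (by rwa [ξ.pr_base])]
  rfl

/-- The family `σ` contains a germ over every local change, also at the orbifold points. -/
lemma exists_along (hU : UniqueLifts OS O f Z) (hσ : ∀ p, σ ∈ germ Z ξ η p)
    (hκ : Loc _ _ κ x) : ∃ φ, Along σ κ x φ := by
  by_cases hx : (ξ.sys α).π x ∉ Z
  · obtain ⟨φ, h1, h2⟩ := germ_presentation hU (hσ ⟨_, hx⟩) hκ rfl
    exact ⟨φ, h1, h2⟩
  obtain ⟨φ, hφ, hc⟩ := hU.lift (ξ.lift α) (η.lift β) (ξ.sys_mem α) (ξ.sys'_mem α)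
    (η.sys'_mem β) κ x hκ
  obtain ⟨N, hNW, hN⟩ := hU.good _ (ξ.sys_mem α) x _ ((hκ.eventually.and hc).and
    ((ξ.continuousAt_l x).eventually hφ.eventually))
  have hNκ : ∀ w ∈ N, Loc _ _ κ w := fun w hw => (hNW hw).1.1
  have hNφ : ∀ w ∈ N, Loc _ _ φ (ξ.l α w) := fun w hw => (hNW hw).2
  have hNo : ∀ w ∈ N, N ∈ 𝓝 w := fun w hw => hN.isOpen.mem_nhds hw
  -- Over `Z` the family prescribes nothing at `x`. At the other points of `N` it prescribes a group
  -- element relative to the fixed comparison `φ`; this element is locally constant, hence constant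
  -- on the connected set `N \ {x}`.
  have hex : ∀ w : (ξ.sys α).V, ∃ g : (η.sys' β).V ≃ₜ (η.sys' β).V, w ∈ N \ {x} →
      g ∈ (η.sys' β).G ∧ Along σ κ w (g ∘ φ) := by
    intro w
    by_cases hw : w ∈ N \ {x}
    · obtain ⟨φ', h1, h2⟩ := germ_presentation hU
        (hσ ⟨_, hN.notMem w hw.1 hw.2⟩) (hNκ w hw.1) rfl
      obtain ⟨g, hg, hgφ⟩ := (hNφ w hw.1).exists_group h1
      refine ⟨g, fun _ => ⟨hg, h1.congr hgφ, ?_⟩⟩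
      filter_upwards [h2, (ξ.continuousAt_l w).eventually hgφ.eventually_nhds] with v h3 h4
      refine ⟨h4.self_of_nhds.symm.trans h3.1, fun h => (h3.2 h).trans ?_⟩
      rw [val, val, der_congr (ψ := g ∘ φ) h4]
    · exact ⟨1, fun h => absurd h hw⟩
  choose γ hγ using hex
  have huniq : ∀ w ∈ N \ {x}, ∀ g ∈ (η.sys' β).G, Along σ κ w (g ∘ φ) → g = γ w := by
    intro w hw g hg h
    have h1 := h.eventually_eq hU (hγ w hw).2
    have h2 : ∀ᶠ y in 𝓝 (φ (ξ.l α w)), g y = γ w y := (hNφ w hw.1).eventually_of_map.2 h1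
    exact eq_of_eventually_eq hg (hγ w hw).1 h2
  obtain ⟨w₀, hw₀x, hw₀⟩ := (hN.frequently.and_eventually (hNo x hN.mem)).exists
  have hconst : ∀ w ∈ N \ {x}, γ w = γ w₀ := fun w hw => by
    refine eq_of_locally_const hN.preconnected (fun v hv => ?_) hw ⟨hw₀, hw₀x⟩
    filter_upwards [mem_nhdsWithin_of_mem_nhds (hγ v hv).2.nhds, self_mem_nhdsWithin] with u h1 h2
    exact (huniq u h2 _ (hγ v hv).1 h1).symm
  have hg := (hγ w₀ ⟨hw₀, hw₀x⟩).1
  refine ⟨γ w₀ ∘ φ, (loc_of_group hg _).comp hφ, ?_⟩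
  have hne : ∀ v ∈ N, v ≠ x → γ w₀ (φ (ξ.l α v)) = η.l β (κ v) ∧
      ∀ h : (ξ.sys α).π v ∉ Z, σ ⟨_, h⟩ = val κ (γ w₀ ∘ φ) v := fun v hv hvx => by
    have := (hγ v ⟨hv, hvx⟩).2.eventually.self_of_nhds
    rwa [hconst v ⟨hv, hvx⟩] at this
  filter_upwards [hNo x hN.mem] with v hv
  by_cases hvx : v = x
  · subst hvx
    refine ⟨?_, fun h => absurd h hx⟩
    -- At `x` itself the relation between the lifts follows by continuity.
    refine eq_of_frequently_eq (f := fun v => γ w₀ (φ (ξ.l α v))) (g := fun v => η.l β (κ v))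
      ((γ w₀).continuous.continuousAt.comp
        (ContinuousAt.comp (g := φ) hφ.continuousAt (ξ.continuousAt_l v)))
      (ContinuousAt.comp (g := η.l β) (η.continuousAt_l _) hκ.continuousAt) ?_
    exact (hN.frequently.and_eventually (hNo v hN.mem)).mono fun w hw => (hne w hw.2 hw.1).1
  · exact hne v hv hvx

/-- A global family of germs gives an isomorphism of compatible systems. -/
theorem isomorphic_of_mem_germ (hU : UniqueLifts OS O f Z) (hσ : ∀ p, σ ∈ germ Z ξ η p) :
    ξ.Isomorphic η := by
  classical
  intro r B
  have hA : ∀ {α : ξ.Λ} {β : η.Λ} (k : Change (ξ.sys α) (η.sys β)) (x : (ξ.sys α).V),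
      ∃ φ, x ∈ k.source → Along σ k x φ := by
    intro α β k x
    by_cases hx : x ∈ k.source
    · obtain ⟨φ, hφ⟩ := exists_along hU hσ (k.loc hx)
      exact ⟨φ, fun _ => hφ⟩
    · exact ⟨fun _ => η.l β (k x), fun h => absurd h hx⟩
  choose Φ hΦ using @hA
  have hT : ∀ {α : ξ.Λ} {β : η.Λ} (t : B.triv (ξ.cod α)) (s : B.triv (η.cod β))
      (k : Change (ξ.sys α) (η.sys β)) (x : (ξ.sys α).V), ∃ T : Fib r ≃L[ℝ] Fib r,
      x ∈ k.source → B.IsLift t s (Φ k x) (ξ.l α x) T := by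
    intro α β t s k x
    by_cases hx : x ∈ k.source
    · obtain ⟨T, hT⟩ := B.exists_isLift t s (hΦ k x hx).loc
      exact ⟨T, fun _ => hT⟩
    · exact ⟨1, fun h => absurd h hx⟩
  choose A hA using @hT
  have hnear : ∀ {α : ξ.Λ} {β : η.Λ} (k : Change (ξ.sys α) (η.sys β)) (x : (ξ.sys α).V),
      x ∈ k.source → ∀ᶠ w in 𝓝 x, w ∈ k.source ∧
        ∀ᶠ y in 𝓝 (ξ.l α w), Φ k w y = Φ k x y := by
    intro α β k x hx
    filter_upwards [k.diffeo.open_source.mem_nhds hx, (hΦ k x hx).nhds] with w h1 h2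
    exact ⟨h1, (hΦ k w h1).eventually_eq hU h2⟩
  have hcomm : ∀ {α : ξ.Λ} {β : η.Λ} (k : Change (ξ.sys α) (η.sys β)) (x : (ξ.sys α).V),
      x ∈ k.source → Φ k x (ξ.l α x) = η.l β (k x) := fun k x hx => (hΦ k x hx).comm
  let Iso : (ξ.pullback B).Iso (η.pullback B) :=
    { A := fun t s k x => A t s k x
      smooth := ?_
      natural := ?_ }
  · refine ⟨Iso, fun α β k x hx => ?_⟩
    obtain ⟨k', hk', hk'Φ⟩ := (hΦ k x hx).loc.exists_change
    refine ⟨k', hk', ?_⟩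
    filter_upwards [(hΦ k x hx).eventually, hnear k x hx,
      (ξ.continuousAt_l x).eventually (k'.diffeo.open_source.mem_nhds hk')] with w h1 h2 h3
    refine ⟨(hk'Φ _ h3).trans h1.1, fun t s _ _ => ?_⟩
    refine (hA t s k w h2.1).congr ?_
    filter_upwards [h2.2, k'.diffeo.open_source.mem_nhds h3] with y h4 h5
    rw [h4]
    exact (hk'Φ y h5).symm
  · intro α β t s k x hx
    obtain ⟨hx1, hx2, hx3⟩ := hx
    have hs : Φ k x (ξ.l α x) ∈ B.dom s := by
      rw [hcomm k x hx1]
      exact hx3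
    obtain ⟨τ, hτ, hτ'⟩ := B.exists_contMDiffAt_isLift (c := ξ.cod α) (d := η.cod β)
      (hΦ k x hx1).loc hx2 hs
    have h1 : ContMDiffAt 𝓘(ℝ, ℂ) 𝓘(ℝ, Fib r →L[ℝ] Fib r) ∞ (fun w => τ (ξ.l α w)) x :=
      ContMDiffAt.comp (M' := (ξ.lift α).cod.V) (g := τ) x hτ ((ξ.lift α).smooth x)
    refine (h1.congr_of_eventuallyEq ?_).contMDiffWithinAt
    filter_upwards [hnear k x hx1, (ξ.continuousAt_l x).eventually hτ'] with w h2 h3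
    exact h3 _ ((hA t s k w h2.1).congr h2.2)
  · intro α α' β β' t t' s s' i j k k' x hx hix hij ht ht' hs hs'
    have e1 : ξ.l α' (i x) = ξ.lam i (ξ.l α x) := l_comp i x
    have e2 : η.l β' (j (k x)) = η.lam j (η.l β (k x)) := l_comp j (k x)
    -- Both ways around the square present the same member of the family `σ`, so they agree as
    -- germs; naturality of bundle lifts finishes.
    have a1 := (hΦ k x hx).trans_left hU (k.loc hx) (j.loc (k x)) (trans_injection j (k x))
    have a2 := Along.trans_right hU (i.loc x) (trans_injection i x) (hΦ k' (i x) hix)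
    have a3 := (a2.congr hij).eventually_eq hU a1
    have hl := hA t' s' k' (i x) hix
    rw [e1] at hl
    have hs2 : Φ k x (ξ.l α x) ∈ B.dom s := by
      rw [hcomm k x hx]
      exact hs
    have hs2' : η.l β' (j (k x)) ∈ B.dom s' := hs'
    have ht2' : ξ.l α' (i x) ∈ B.dom t' := ht'
    rw [e2, ← hcomm k x hx] at hs2'
    rw [e1] at ht2'
    have := (hA t s k x hx).natural (c := ξ.cod α) (c' := ξ.cod α') (d := η.cod β)
      (d' := η.cod β') hl a3 ht hs2 ht2' hs2'
    rw [hcomm k x hx] at this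
    exact this

end CompatibleSystem

end SectionIso

end Orb

namespace Orb

/-! ### Final count -/

section Counting

variable {E : Type*} [NormedAddCommGroup E] [NormedSpace ℝ E] [FiniteDimensional ℝ E]
  {X : Type*} [TopologicalSpace X] {O : Orbifold E X}
  {S : Type*} [TopologicalSpace S] [T1Space S] [ChartedSpace ℂ S] [IsManifold 𝓘(ℂ) ω S]
  {f : C(S, X)} {J : AlmostComplex O} {k : ℕ} {z : Fin k → S} {OS : Orbifold ℂ S} {Z : Set S}

/-- With multiplicity `1` the projection is injective in the local parameter. -/
lemma LocalForm.exists_injOn {c : UChart ℂ S} {x : c.V} (F : LocalForm c x 1) :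
    ∃ U ∈ 𝓝 x, InjOn c.π U := by
  obtain ⟨ρ, hρ, h1, -⟩ := F.exists_ball (p := fun _ => True) (by simp)
  refine ⟨F.s '' Metric.ball 0 ρ, (F.isOpen_image h1).mem_nhds
    ⟨0, Metric.mem_ball_self hρ, F.s_zero⟩, ?_⟩
  rintro _ ⟨ζ, hζ, rfl⟩ _ ⟨ζ', hζ', rfl⟩ h
  have h2 := congrArg (LocalForm.ψ F) h
  rw [F.ψ_π_s (h1 hζ), F.ψ_π_s (h1 hζ'), pow_one, pow_one] at h2
  rw [h2]

lemma uniqueLifts (hf : IsPseudoHolomorphic J f) (hOS : IsOrbifoldSurface z OS) (hZ : Z.Finite)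
    (hz : range z ⊆ Z) : UniqueLifts OS O f Z where
  isClosed := hZ.isClosed
  good c hc x W hW := by
    obtain ⟨m, -, ⟨F⟩⟩ := hOS.exists_localForm hc x
    exact F.exists_goodNhd hf hZ hW
  inj c hc x hx := by
    obtain ⟨m, hm, ⟨F⟩⟩ := hOS.exists_localForm hc x
    obtain rfl : m = 1 := by
      by_contra h
      exact hx (hz (hm h))
    exact F.exists_injOn
  lift l m hl hlc hmc κ x hκ := exists_loc_of_lifts hf hOS hl hlc hmc hκ

/-- The isomorphism classes of compatible systems are told apart by the invariants of the local
system of changes between them. -/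
lemma exists_injective_goodLifts (hf : IsPseudoHolomorphic J f) (hOS : IsOrbifoldSurface z OS)
    (hZ : Z.Finite) (hz : range z ⊆ Z) {M N : ℕ} (hM1 : 1 ≤ M)
    (hM : ∀ c ∈ O.charts, ∀ x : c.V, c.π x ∈ range f → (c.stab x).ncard ≤ M)
    (hB : ∀ F : SmoothMap OS O f,
      (CompatibleSystem.locSys (uniqueLifts hf hOS hZ hz) F hM1 hM).Bd id N) :
    ∃ ι : GoodLifts OS O f → Fin N, Function.Injective ι := by
  have := subsingleton_smoothMap (O := O) hf hOS
  by_cases hF : Nonempty (SmoothMap OS O f)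
  · obtain ⟨F⟩ := hF
    obtain ⟨K, _, I, hK, hI⟩ := hB F
    let e : K ≃ Fin (Nat.card K) := Finite.equivFin K
    have key : ∀ a b : GoodLifts OS O f, ∃ ξ η : {ξ : CompatibleSystem F // ξ.Mono},
        a = ⟨F, Quot.mk _ ξ⟩ ∧ b = ⟨F, Quot.mk _ η⟩ := by
      rintro ⟨F₁, ⟨ξ⟩⟩ ⟨F₂, ⟨η⟩⟩
      obtain rfl := Subsingleton.elim F F₁
      obtain rfl := Subsingleton.elim F F₂
      exact ⟨ξ, η, rfl, rfl⟩
    have hrep : ∀ a : GoodLifts OS O f, ∃ ξ : {ξ : CompatibleSystem F // ξ.Mono},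
        a = ⟨F, Quot.mk _ ξ⟩ := fun a => (key a a).imp fun ξ ⟨_, h, _⟩ => h
    choose r hr using hrep
    refine ⟨fun a => Fin.castLE hK (e (I (r a).1)), fun a b hab => ?_⟩
    have h1 : I (r a).1 = I (r b).1 := e.injective (Fin.castLE_injective hK hab)
    obtain ⟨σ, hσ⟩ := hI _ _ h1
    rw [hr a, hr b]
    refine congrArg (Sigma.mk F) (Quot.sound ?_)
    exact CompatibleSystem.isomorphic_of_mem_germ (uniqueLifts hf hOS hZ hz)
      (CompatibleSystem.mem_germ_of_isSec _ hσ)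
  · exact ⟨fun a => (hF ⟨a.1⟩).elim, fun a => (hF ⟨a.1⟩).elim⟩

end Counting

section Bound

variable {E : Type*} [NormedAddCommGroup E] [NormedSpace ℝ E] [FiniteDimensional ℝ E]
  {X : Type*} [TopologicalSpace X]

/-- The number of good lifts of a pseudo-holomorphic map is bounded in terms of the genus, the
number of marked points and the orders of the isotropy groups along the image. -/
theorem exists_goodLifts_bound (O : Orbifold E X) : ∃ C : ℕ → ℕ → ℕ → ℕ,
    ∀ (J : AlmostComplex O) (g k M : ℕ) (S : Type*) [TopologicalSpace S] [T2Space S]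
      [CompactSpace S] [ChartedSpace ℂ S] [IsManifold 𝓘(ℂ) ω S],
      HasGenus S g → ∀ (z : Fin k → S) (f : C(S, X)), IsPseudoHolomorphic J f → 1 ≤ M →
      (∀ c ∈ O.charts, ∀ x : c.V, c.π x ∈ range f → (c.stab x).ncard ≤ M) →
      ∀ OS : Orbifold ℂ S, IsOrbifoldSurface z OS →
        ∃ ι : GoodLifts OS O f → Fin (C g k M), Function.Injective ι := by
  obtain ⟨C, hC⟩ := LocSys.exists_bound
  refine ⟨C, fun J g k M S _ _ _ _ _ hS z f hf hM1 hM OS hOS => ?_⟩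
  obtain ⟨Z, hZ, hz, hB⟩ := hC g k M S hS (range z) (finite_range z) (by
    rw [← image_univ]
    exact (ncard_image_le finite_univ).trans (by simp [ncard_univ]))
  exact exists_injective_goodLifts hf hOS hZ hz hM1 hM fun F => hB _ _ _

end Bound

end Orb

theorem lemma4p3 {E : Type*} [NormedAddCommGroup E] [NormedSpace ℝ E] [FiniteDimensional ℝ E]
    {X : Type*} [TopologicalSpace X] [T2Space X] (O : Orb.Orbifold E X) :
    (∀ (J : Orb.AlmostComplex O) (g k : ℕ) (S : Type*) [TopologicalSpace S] [T2Space S]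
      [CompactSpace S] [ConnectedSpace S] [ChartedSpace ℂ S] [IsManifold 𝓘(ℂ) ω S],
      Orb.HasGenus S g → ∀ z : Fin k → S, Function.Injective z →
      ∀ f : C(S, X), Orb.IsPseudoHolomorphic J f →
        {OS : Orb.Orbifold ℂ S |
          Orb.IsOrbifoldSurface z OS ∧ Nonempty (Orb.GoodLifts OS O f)}.Finite ∧
        ∀ OS : Orb.Orbifold ℂ S, Orb.IsOrbifoldSurface z OS → Finite (Orb.GoodLifts OS O f)) ∧
    (CompactSpace X → ∃ C : ℕ → ℕ → ℕ,
      ∀ (J : Orb.AlmostComplex O) (g k : ℕ) (S : Type*) [TopologicalSpace S] [T2Space S]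
        [CompactSpace S] [ConnectedSpace S] [ChartedSpace ℂ S] [IsManifold 𝓘(ℂ) ω S],
        Orb.HasGenus S g → ∀ z : Fin k → S, Function.Injective z →
        ∀ f : C(S, X), Orb.IsPseudoHolomorphic J f →
          ENat.card (Σ OS : {OS : Orb.Orbifold ℂ S // Orb.IsOrbifoldSurface z OS},
            Orb.GoodLifts OS.1 O f) ≤ C g k) := by
  constructor
  · obtain ⟨C, hC⟩ := Orb.exists_goodLifts_bound O
    intro J g k S _ _ _ _ _ _ hS z _ f hf
    obtain ⟨M, hM⟩ := O.exists_isotropy_bound (isCompact_range f.continuous)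
    refine ⟨?_, fun OS hOS => ?_⟩
    · obtain ⟨ι, hι⟩ := Orb.finite_orbifold_of_isotropy_le (z := z) hM
      exact finite_coe_iff.1 (Finite.of_injective ι hι)
    -- The gluing bound needs at least one label, hence the maximum with `1`.
    · obtain ⟨ι, hι⟩ := hC J g k (max M 1) S hS z f hf (le_max_right _ _)
        (fun c hc x hx => (hM c hc x hx).trans (le_max_left _ _)) OS hOS
      exact Finite.of_injective ι hι
  · intro _
    obtain ⟨C, hC⟩ := Orb.exists_goodLifts_bound O
    obtain ⟨M, hM⟩ := O.exists_isotropy_bound isCompact_univ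
    -- At most `(M + 1) ^ k` multiplicity vectors, each with at most `C g k (max M 1)` good lifts;
    -- `M` comes from `X` alone.
    refine ⟨fun g k => (M + 1) ^ k * C g k (max M 1), fun J g k S _ _ _ _ _ _ hS z _ f hf => ?_⟩
    obtain ⟨ι, hι⟩ := Orb.finite_orbifold_of_isotropy_le (z := z) (f := f)
      fun c hc x _ => hM c hc x (mem_univ _)
    choose κ hκ using hC J g k (max M 1) S hS z f hf (le_max_right _ _)
      (fun c hc x _ => (hM c hc x (mem_univ _)).trans (le_max_left _ _))
    let e : (Σ OS : {OS : Orb.Orbifold ℂ S // Orb.IsOrbifoldSurface z OS},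
        Orb.GoodLifts OS.1 O f) → (Fin k → Fin (M + 1)) × Fin (C g k (max M 1)) :=
      fun a => (ι ⟨a.1.1, a.1.2, ⟨a.2⟩⟩, κ a.1.1 a.1.2 a.2)
    have he : Function.Injective e := by
      rintro ⟨⟨OS, h⟩, a⟩ ⟨⟨OS', h'⟩, a'⟩ hab
      obtain rfl : OS = OS' := congrArg Subtype.val (hι (congrArg Prod.fst hab))
      obtain rfl : a = a' := hκ OS h (congrArg Prod.snd hab)
      rfl
    refine (ENat.card_le_card_of_injective he).trans ?_
    rw [ENat.card_eq_coe_fintype_card]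
    simp
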